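/- Let $M$ be a connected complex manifold of complex dimension $m\ge 2$ with complex structure $J$, and let $\omega$ be the Kähler form of a Kähler metric $g(u,v)=\omega(u,Jv)$ on $M$ that is Einstein, i.e. the Ricci form $-\sqrt{-1}\,\partial\bar\partial\log\det(g_{j\bar k})$ is a constant multiple of $\omega$. Suppose that $(M,J,\omega)$ is toric: the torus $T^m$ acts smoothly and effectively on $M$, preserving $J$ and $\omega$, with a $T^m$-invariant moment map $\mu=(\mu_1,\dots,\mu_m):M\to\mathbb R^m$, $i_{V_i}\omega=d\mu_i$, where $V_1,\dots,V_m$ are the generating vector fields of the action. ($M$ need not be compact.) Conventions. On $TM\oplus T^*M$ put $\langle v+\xi,u+\eta\rangle=\tfrac12(\xi(u)+\eta(v))$. A generalized complex structure is a smooth orthogonal endomorphism $\mathcal J$ of $TM\oplus T^*M$ with $\mathcal J^2=-1$ whose $-\sqrt{-1}$-eigenbundle is involutive for the Courant bracket. Set $\mathcal J_J(v+\xi)=Jv-\xi\circ J$; for a real $2$-form $b$ set $e^b(v+\xi)=v-i_vb+\xi$; and for $\psi=e^{b+\sqrt{-1}\omega'}$ with $b,\omega'$ real closed $2$-forms and $\omega'$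 nondegenerate set $\mathcal J_\psi=e^b\circ\mathcal J_{\omega'}\circ e^{-b}$, where $\mathcal J_{\omega'}(v+\xi)=-\hat\omega'^{-1}\xi+i_v\omega'$ and $\hat\omega'(v)=i_v\omega'$. The pair $(\mathcal J,\psi)$ is a generalized Kähler structure (of symplectic type) if $\mathcal J$ and $\mathcal J_\psi$ are commuting generalized complex structures and $\langle-\mathcal J\mathcal J_\psi\,\cdot,\cdot\rangle$ is positive definite. A mixed-degree complex form $\phi$ on an open set is a local trivialization of the canonical line bundle of $\mathcal J$ if the annihilator of $\phi$ under the action $(v+\xi)\cdot\phi=i_v\phi+\xi\wedge\phi$ is the $-\sqrt{-1}$-eigenbundle of $\mathcal J$; then $d\phi=\eta\cdot\phi$ for a unique real section $\eta$ of $TM\oplus T^*M$, and $\langle\phi,\bar\phi\rangle_s=\rho\,\langle\psi,\bar\psi\rangle_s$ for a nonvanishing real function $\rho$, where $\langle\alpha,\beta\rangle_s$ is the top-degree part of $\alpha\wedge\sigma\beta$ and $\sigma$ is $+1$ in degrees $\equiv0,1$ and $-1$ in degrees $\equiv2,3\pmod 4$. Writing $-2\mathcal J\eta+\mathcal J\,d\log|\rho|=v+\theta$,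 the generalized Ricci form is the global $2$-form given locally by $\mathrm{GRic}=-d(i_vb+\theta)$. The structure is generalized Kähler–Einstein if $\mathrm{GRic}=\lambda\omega'$ for a real constant $\lambda$. Proposition. There are a constant $\lambda\in\mathbb R$ and a smooth family $(\mathcal J_t,\psi_t=e^{b_t+\sqrt{-1}\omega_t})$, $t\in\mathbb R$, of generalized Kähler–Einstein structures on $M$ with $\mathrm{GRic}_t=\lambda\omega_t$, which starts at the given structure, $(\mathcal J_0,\psi_0)=(\mathcal J_J,e^{\sqrt{-1}\omega})$, and is nontrivial in the following sense: for every $t\neq0$, $\mathcal J_t$ is not of the form $e^B\mathcal J_{J'}e^{-B}$ for any almost complex structure $J'$ and real $2$-form $B$ on $M$. In particular, for $t\ne0$, $\mathcal J_t$ is not equivalent, under diffeomorphisms and closed $B$-fields, to an ordinary complex structure. -/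

import Mathlib

open Set
open scoped Manifold ContDiff

noncomputable section

namespace GKE

/-! ## Linear algebra of `T ⊕ T*` for a real vector space `T = E` -/

section Linear

variable (E : Type*) [NormedAddCommGroup E] [NormedSpace ℝ E]

/-- The generalized tangent space `T ⊕ T*`. -/
abbrev GT := E × (E →L[ℝ] ℝ)

/-- Real alternating `2`-forms on `E`. -/
abbrev Form2 := E [⋀^Fin 2]→L[ℝ] ℝ

/-- Differential forms of mixed degree with complex coefficients, at a point. -/
abbrev MForm := ∀ p : ℕ, E [⋀^Fin p]→L[ℝ] ℂ

/-- The same as `MForm`, without continuity (automatic in finite dimension); used for products. -/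
abbrev AForm := ∀ p : ℕ, E [⋀^Fin p]→ₗ[ℝ] ℂ

variable {E}

/-- `⟨v + ξ, u + η⟩ = (ξ(u) + η(v)) / 2`. -/
def pairing (e e' : GT E) : ℝ := (1 / 2) * (e.2 e'.1 + e'.2 e.1)

/-- `v ↦ i_v b`. -/
def flat (b : Form2 E) : E →L[ℝ] (E →L[ℝ] ℝ) :=
  ((ContinuousAlternatingMap.ofSubsingletonLIE (𝕜 := ℝ) (E := E) (F := ℝ) (0 : Fin 1)).symm :
      (E [⋀^Fin 1]→L[ℝ] ℝ) →L[ℝ] (E →L[ℝ] ℝ)).comp b.curryLeft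

theorem flat_apply (b : Form2 E) (v w : E) : flat b v w = b ![v, w] := by
  simp only [flat, ContinuousLinearMap.comp_apply]
  change b (Matrix.vecCons v (fun _ => w)) = b ![v, w]
  congr 1
  ext i
  fin_cases i <;> rfl

/-- The orthogonal transformation `Ad(e^b)(v + θ) = v - i_v b + θ`. -/
def bField (b : Form2 E) : GT E →L[ℝ] GT E :=
  (ContinuousLinearMap.fst ℝ E (E →L[ℝ] ℝ)).prod
    (ContinuousLinearMap.snd ℝ E (E →L[ℝ] ℝ) -
      (flat b).comp (ContinuousLinearMap.fst ℝ E (E →L[ℝ] ℝ)))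

/-- `v + ξ ↦ j v - ξ ∘ j`: the generalized complex structure of a complex structure `j`. -/
def ofComplex (j : E →L[ℝ] E) : GT E →L[ℝ] GT E :=
  (j.comp (ContinuousLinearMap.fst ℝ E (E →L[ℝ] ℝ))).prod
    (-(((ContinuousLinearMap.compL ℝ E E ℝ).flip j).comp
      (ContinuousLinearMap.snd ℝ E (E →L[ℝ] ℝ))))

/-- `v + ξ ↦ -ω⁻¹ ξ + i_v ω`: the generalized complex structure of a symplectic form `ω`. -/
def ofSymplectic (w : Form2 E) : GT E →L[ℝ] GT E :=
  (-((flat w).inverse.comp (ContinuousLinearMap.snd ℝ E (E →L[ℝ] ℝ)))).prod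
    ((flat w).comp (ContinuousLinearMap.fst ℝ E (E →L[ℝ] ℝ)))

/-- The generalized complex structure of `ψ = exp (b + i ω)`: the transform by `e^b` of the one
of `ω`. -/
def ofSpinor (b w : Form2 E) : GT E →L[ℝ] GT E :=
  (bField b).comp ((ofSymplectic w).comp (bField (-b)))

/-- The complex vector `a + i b` lies in the `-i`-eigenspace of `K`, that is `K (a + i b) = b - i a`
(real and imaginary parts: `K a = b` and `K b = -a`). -/
def MemE (K : GT E →L[ℝ] GT E) (a b : GT E) : Prop := K a = b ∧ K b = -a

/-- The wedge product `ξ ∧ α` of a real `1`-form with a `p`-form. -/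
def wedgeOne (ξ : E →L[ℝ] ℝ) {p : ℕ} (α : E [⋀^Fin p]→L[ℝ] ℂ) : E [⋀^Fin (p + 1)]→L[ℝ] ℂ :=
  ContinuousAlternatingMap.alternatizeUncurryFin (ξ.smulRight α)

/-- The spin representation: `(v + ξ) · φ = i_v φ + ξ ∧ φ`. -/
def cliff (e : GT E) (φ : MForm E) : MForm E
  | 0 => (φ 1).curryLeft e.1
  | p + 1 => (φ (p + 2)).curryLeft e.1 + wedgeOne e.2 (φ p)

/-- `φ` spans the canonical line of `K`: the complex vectors `a + i b` with `(a + i b) · φ = 0` are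
exactly the elements of the `-i`-eigenspace of `K`. -/
def IsSpinorOf (K : GT E →L[ℝ] GT E) (φ : MForm E) : Prop :=
  ∀ a b : GT E, cliff a φ + Complex.I • cliff b φ = 0 ↔ MemE K a b

/-- The wedge product of complex valued forms. -/
def wedge {p q : ℕ} (α : E [⋀^Fin p]→ₗ[ℝ] ℂ) (β : E [⋀^Fin q]→ₗ[ℝ] ℂ) :
    E [⋀^Fin (p + q)]→ₗ[ℝ] ℂ :=
  ((LinearMap.mul' ℝ ℂ).compAlternatingMap (α.domCoprod β)).domDomCongr finSumFinEquiv

/-- `exp F = ∑ k, F ^ k / k!` for a complex `2`-form `F`; in degree `2 k` it is the component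
in degree `2 k - 2` times `F / k`. -/
def expForm (F : E [⋀^Fin 2]→ₗ[ℝ] ℂ) : AForm E
  | 0 => AlternatingMap.constOfIsEmpty ℝ E (Fin 0) 1
  | 1 => 0
  | p + 2 => (1 / (((p + 2 : ℕ) : ℝ) / 2)) • wedge (expForm F p) F

/-- The complex `2`-form `b + i ω`. -/
def complexForm (b w : Form2 E) : E [⋀^Fin 2]→ₗ[ℝ] ℂ :=
  Complex.ofRealCLM.toLinearMap.compAlternatingMap b.toAlternatingMap +
    Complex.I • Complex.ofRealCLM.toLinearMap.compAlternatingMap w.toAlternatingMap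

/-- Complex conjugation of forms. -/
def conjForm (α : AForm E) : AForm E :=
  fun p => Complex.conjCLE.toLinearMap.compAlternatingMap (α p)

/-- A mixed form, with continuity forgotten. -/
def forget (φ : MForm E) : AForm E := fun p => (φ p).toAlternatingMap

/-- The sign of the Clifford involution `σ` in degree `q`. -/
def sigmaSign (q : ℕ) : ℝ := if q % 4 = 0 ∨ q % 4 = 1 then 1 else -1

/-- `⟨α, β⟩_s`: the component of degree `N` of `α ∧ σ β`, where `N` is the dimension. -/
def mukai (N : ℕ) (α β : AForm E) : E [⋀^Fin N]→ₗ[ℝ] ℂ :=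
  ∑ p : Fin (N + 1),
    (wedge (α p) (sigmaSign (N - p) • β (N - p))).domDomCongr
      (finCongr (Nat.add_sub_of_le (Nat.lt_succ_iff.mp p.2)))

end Linear

/-! ## Calculus on open subsets of `E` -/

section Local

variable {E : Type*} [NormedAddCommGroup E] [NormedSpace ℝ E]

/-- Exterior derivative of a `1`-form: `dα(u, w) = (D_u α)(w) - (D_w α)(u)`. -/
def dOne (α : E → (E →L[ℝ] ℝ)) (y u w : E) : ℝ := fderiv ℝ α y u w - fderiv ℝ α y w u

/-- Exterior derivative of a mixed form. -/
def dForm (φ : E → MForm E) (y : E) : MForm E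
  | 0 => 0
  | p + 1 => extDeriv (fun z => φ z p) y

/-- Lie derivative of a `1`-form: `(L_u η)(w) = (D_u η)(w) + η(D_w u)`. -/
def lieOne (u : E → E) (η : E → (E →L[ℝ] ℝ)) (y : E) : E →L[ℝ] ℝ :=
  fderiv ℝ η y (u y) + (η y).comp (fderiv ℝ u y)

/-- The Courant bracket
`[u + ξ, v + η] = [u, v] + L_u η - L_v ξ - (1/2) d (η(u) - ξ(v))`. -/
def courant (X Y : E → GT E) (y : E) : GT E :=
  (VectorField.lieBracket ℝ (fun z => (X z).1) (fun z => (Y z).1) y,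
    lieOne (fun z => (X z).1) (fun z => (Y z).2) y -
      lieOne (fun z => (Y z).1) (fun z => (X z).2) y -
      (1 / 2 : ℝ) • fderiv ℝ (fun z => (Y z).2 (X z).1 - (X z).2 (Y z).1) y)

/-- The bundle of `-i`-eigenspaces of `K` over `U` is involutive: the (complex bilinear) Courant
bracket of two of its smooth sections `a + i b` and `c + i d` over an open subset of `U` is again
one of its sections. -/
def Involutive (K : E → (GT E →L[ℝ] GT E)) (U : Set E) : Prop :=
  ∀ W : Set E, IsOpen W → W ⊆ U → ∀ a b c d : E → GT E,
    ContDiffOn ℝ ∞ a W → ContDiffOn ℝ ∞ b W → ContDiffOn ℝ ∞ c W → ContDiffOn ℝ ∞ d W →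
    (∀ z ∈ W, MemE (K z) (a z) (b z)) → (∀ z ∈ W, MemE (K z) (c z) (d z)) →
    ∀ z ∈ W, MemE (K z) (courant a c z - courant b d z) (courant a d z + courant b c z)

/-- `φ`, `η`, `ρ` are a smooth local trivialization of the canonical line bundle of the generalized
complex structure `K` over `U`, the real section `η` of `T ⊕ T*` with `dφ = η · φ`, and the
nonvanishing real function `ρ` with `⟨φ, φ̄⟩_s = ρ ⟨ψ, ψ̄⟩_s`, where `ψ = exp (b + i ω)`. Here `N` is
the real dimension. -/
structure IsTrivialization (N : ℕ) (K : E → (GT E →L[ℝ] GT E)) (b w : E → Form2 E) (U : Set E)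
    (φ : E → MForm E) (η : E → GT E) (ρ : E → ℝ) : Prop where
  smooth_φ : ∀ p, ContDiffOn ℝ ∞ (fun z => φ z p) U
  smooth_η : ContDiffOn ℝ ∞ η U
  smooth_ρ : ContDiffOn ℝ ∞ ρ U
  spinor : ∀ z ∈ U, IsSpinorOf (K z) (φ z)
  dφ : ∀ z ∈ U, dForm φ z = cliff (η z) (φ z)
  ρ_ne : ∀ z ∈ U, ρ z ≠ 0
  ρ_eq : ∀ z ∈ U, mukai N (forget (φ z)) (conjForm (forget (φ z))) =
    ρ z • mukai N (expForm (complexForm (b z) (w z)))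
      (conjForm (expForm (complexForm (b z) (w z))))

/-- The section `-2 K η + K (d log |ρ|)` of `T ⊕ T*`; note `d log |ρ| = ρ⁻¹ dρ`. -/
def ricciSection (K : E → (GT E →L[ℝ] GT E)) (η : E → GT E) (ρ : E → ℝ) (y : E) : GT E :=
  (-2 : ℝ) • K y (η y) + K y (0, (ρ y)⁻¹ • fderiv ℝ ρ y)

/-- If `-2 K η + K (d log |ρ|) = v + θ`, then this is the form `P = d (i_v b + θ)`, which is
characterized by `d (-2 K η + K (d log |ρ|)) · ψ̄ = (P - i Q) · ψ̄` with `P` and `Q` real. -/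
def formP (K : E → (GT E →L[ℝ] GT E)) (b : E → Form2 E) (η : E → GT E) (ρ : E → ℝ)
    (y u w : E) : ℝ :=
  dOne (fun z => flat (b z) (ricciSection K η ρ z).1 + (ricciSection K η ρ z).2) y u w

end Local

/-! ## Complex manifolds

`M` is a complex manifold with charts in the complex vector space `E`. The tangent space at `x` is
by definition a copy of `E`; the complex structure `J` is multiplication by `i` on it. Tensor fields
are functions on `M`, and are expressed in the charts of `M` by means of the derivatives of the
charts. -/

section Mfd

variable {E : Type*} [NormedAddCommGroup E] [NormedSpace ℂ E]
  {M : Type*} [TopologicalSpace M] [ChartedSpace E M]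

/-- The derivative `E → T_x M` of the inverse of a chart at `y`, where `x = e.symm y`. -/
def fromChart (e : OpenPartialHomeomorph M E) (y : E) : E →L[ℝ] E :=
  (mfderiv 𝓘(ℝ, E) 𝓘(ℝ, E) e.symm y : E →L[ℝ] E)

/-- The derivative `T_x M → E` of a chart at `x = e.symm y`. -/
def toChart (e : OpenPartialHomeomorph M E) (y : E) : E →L[ℝ] E :=
  (mfderiv 𝓘(ℝ, E) 𝓘(ℝ, E) e (e.symm y) : E →L[ℝ] E)

/-- For an isomorphism `A` with inverse `A'`, the induced map `v + ξ ↦ A v + ξ ∘ A'`. -/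
def genMap (A A' : E →L[ℝ] E) : GT E →L[ℝ] GT E :=
  (A.comp (ContinuousLinearMap.fst ℝ E (E →L[ℝ] ℝ))).prod
    (((ContinuousLinearMap.compL ℝ E E ℝ).flip A').comp
      (ContinuousLinearMap.snd ℝ E (E →L[ℝ] ℝ)))

/-- A field of endomorphisms of `TM ⊕ T*M`, in a chart. -/
def endIn (K : M → (GT E →L[ℝ] GT E)) (e : OpenPartialHomeomorph M E) (y : E) :
    GT E →L[ℝ] GT E :=
  (genMap (toChart e y) (fromChart e y)).comp
    ((K (e.symm y)).comp (genMap (fromChart e y) (toChart e y)))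

/-- A real `2`-form on `M`, in a chart. -/
def formIn (b : M → Form2 E) (e : OpenPartialHomeomorph M E) (y : E) : Form2 E :=
  (b (e.symm y)).compContinuousLinearMap (fromChart e y)

/-- A smooth closed real `2`-form on `M`. -/
def IsSmoothClosed (b : M → Form2 E) : Prop :=
  ∀ e ∈ atlas E M, ContDiffOn ℝ ∞ (formIn b e) e.target ∧
    ∀ y ∈ e.target, extDeriv (formIn b e) y = 0

/-- A generalized complex structure on `M`. -/
structure IsGenComplex (K : M → (GT E →L[ℝ] GT E)) : Prop where
  smooth : ∀ e ∈ atlas E M, ContDiffOn ℝ ∞ (endIn K e) e.target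
  sq : ∀ x u, K x (K x u) = -u
  orthogonal : ∀ x u v, pairing (K x u) (K x v) = pairing u v
  involutive : ∀ e ∈ atlas E M, Involutive (endIn K e) e.target

/-- `(K, J_ψ)` with `ψ = exp (b + i ω)` is a generalized Kähler structure on `M` of symplectic
type: `ψ` is a closed nondegenerate spinor, `K` and `J_ψ` are commuting generalized complex
structures, and `- K ∘ J_ψ` defines a positive definite form on `TM ⊕ T*M`. -/
structure IsGenKahler (K : M → (GT E →L[ℝ] GT E)) (b w : M → Form2 E) : Prop where
  closed_b : IsSmoothClosed b
  closed_w : IsSmoothClosed w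
  nondegenerate : ∀ x (v : E), v ≠ 0 → ∃ u : E, w x ![v, u] ≠ 0
  genComplex : IsGenComplex K
  genComplex_spinor : IsGenComplex (fun x => ofSpinor (b x) (w x))
  commute : ∀ x u, K x (ofSpinor (b x) (w x) u) = ofSpinor (b x) (w x) (K x u)
  pos : ∀ x u, u ≠ 0 → 0 < pairing (-(K x (ofSpinor (b x) (w x) u))) u

/-- `R` is the generalized Ricci form of the generalized Kähler structure `(K, exp (b + i ω))`:
there are trivializations of the canonical line bundle of `K` over open sets that cover `M`, on each
of which `R = -P`. The form `P` does not depend on the trivialization: another one changes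
`-2 K η + K (d log |ρ|)` by a closed `1`-form. -/
def IsGenRicci (K : M → (GT E →L[ℝ] GT E)) (b w : M → Form2 E) (R : M → Form2 E) : Prop :=
  ∀ e ∈ atlas E M, ∀ y₀ ∈ e.target, ∃ U : Set E, IsOpen U ∧ y₀ ∈ U ∧ U ⊆ e.target ∧
    ∃ (φ : E → MForm E) (η : E → GT E) (ρ : E → ℝ),
      IsTrivialization (2 * Module.finrank ℂ E) (endIn K e) (formIn b e) (formIn w e) U φ η ρ ∧
      ∀ y ∈ U, ∀ u v : E,
        formIn R e y ![u, v] = -formP (endIn K e) (formIn b e) η ρ y u v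

/-- A generalized Kähler–Einstein structure: a generalized Kähler structure whose generalized Ricci
form is `l • ω`. -/
structure IsGenKahlerEinstein (K : M → (GT E →L[ℝ] GT E)) (b w : M → Form2 E) (l : ℝ) : Prop where
  genKahler : IsGenKahler K b w
  einstein : IsGenRicci K b w (fun x => l • w x)

/-- Multiplication by `i`: the complex structure `J` on each tangent space. -/
def cplx (E : Type*) [NormedAddCommGroup E] [NormedSpace ℂ E] : E →L[ℝ] E :=
  (Complex.I • ContinuousLinearMap.id ℂ E).restrictScalars ℝ

/-- `w` is the Kähler form of a Kähler metric `g(u, v) = w(u, J v)` on the complex manifold `M`. -/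
structure IsKahler (w : M → Form2 E) : Prop where
  closed : IsSmoothClosed w
  invariant : ∀ x (u v : E), w x ![Complex.I • u, Complex.I • v] = w x ![u, v]
  pos : ∀ x (v : E), v ≠ 0 → 0 < w x ![v, Complex.I • v]

/-- The determinant of the Hermitian matrix `h(∂_j, ∂_k)`, where `h = g - i w`, at `y` in the
holomorphic coordinates given by the chart `e` and a complex basis of `E`. -/
def detMetric [FiniteDimensional ℂ E] (w : M → Form2 E) (e : OpenPartialHomeomorph M E) (y : E) : ℝ :=
  (Matrix.det (Matrix.of fun j k : Fin (Module.finrank ℂ E) =>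
    ((formIn w e y ![Module.finBasis ℂ E j,
        Complex.I • Module.finBasis ℂ E k] : ℝ) : ℂ) -
      Complex.I * ((formIn w e y ![Module.finBasis ℂ E j,
        Module.finBasis ℂ E k] : ℝ) : ℂ))).re

/-- The Ricci form `-i ∂ ∂̄ log det h = (1/2) d ((d log det h) ∘ J)` of a Kähler metric, in a
chart. -/
def ricciForm [FiniteDimensional ℂ E] (w : M → Form2 E) (e : OpenPartialHomeomorph M E) (y u v : E) : ℝ :=
  (1 / 2) *
    dOne (fun z => (fderiv ℝ (fun z' => Real.log (detMetric w e z')) z).comp (cplx E)) y u v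

/-- A Kähler–Einstein structure: a Kähler structure whose Ricci form is a constant multiple of the
Kähler form. -/
structure IsKahlerEinstein [FiniteDimensional ℂ E] (w : M → Form2 E) : Prop where
  kahler : IsKahler w
  einstein : ∃ c : ℝ, ∀ e ∈ atlas E M, ∀ y ∈ e.target, ∀ u v : E,
    ricciForm w e y u v = c * formIn w e y ![u, v]

/-- The derivative at `x` of the action of `g`, as a map of tangent spaces. -/
def dAct {G : Type*} [SMul G M] (g : G) (x : M) : E →L[ℝ] E :=
  (mfderiv 𝓘(ℝ, E) 𝓘(ℝ, E) (fun y : M => g • y) x : E →L[ℝ] E)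

/-- The exponential map `ℝ^m → T^m` of the standard torus. -/
def torusExp {m : ℕ} (s : Fin m → ℝ) : Fin m → Circle := fun i => Circle.exp (s i)

/-- The vector field on `M` generated by the `i`-th standard basis vector of the Lie algebra
`ℝ^m` of `T^m`. -/
def generator {m : ℕ} [SMul (Fin m → Circle) M] (i : Fin m) (x : M) : E :=
  (mfderiv 𝓘(ℝ, ℝ) 𝓘(ℝ, E) (fun s : ℝ => torusExp (Pi.single i s : Fin m → ℝ) • x) 0 :
    ℝ →L[ℝ] E) 1

/-- The action of `T^m` on the Kähler manifold `(M, J, w)` is smooth, effective, preserves `J` and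
`w`, and has moment map `μ`. -/
structure IsHamiltonianTorusAction (m : ℕ) [MulAction (Fin m → Circle) M] (w : M → Form2 E)
    (μ : M → (Fin m → ℝ)) : Prop where
  effective : ∀ g : Fin m → Circle, (∀ x : M, g • x = x) → g = 1
  smooth : ContMDiff (𝓘(ℝ, Fin m → ℝ).prod 𝓘(ℝ, E)) 𝓘(ℝ, E) ∞
    (fun p : (Fin m → ℝ) × M => torusExp p.1 • p.2)
  preserves_J : ∀ (g : Fin m → Circle) (x : M) (v : E),
    dAct (E := E) g x (Complex.I • v) = Complex.I • dAct (E := E) g x v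
  preserves_w : ∀ (g : Fin m → Circle) (x : M) (u v : E),
    w (g • x) ![dAct (E := E) g x u, dAct (E := E) g x v] = w x ![u, v]
  smooth_μ : ContMDiff 𝓘(ℝ, E) 𝓘(ℝ, Fin m → ℝ) ∞ μ
  invariant_μ : ∀ (g : Fin m → Circle) (x : M), μ (g • x) = μ x
  moment : ∀ (i : Fin m) (x : M) (v : E),
    (mfderiv 𝓘(ℝ, E) 𝓘(ℝ, Fin m → ℝ) μ x : E →L[ℝ] (Fin m → ℝ)) v i =
      w x ![generator (E := E) i x, v]

/-- `(M, J, w)` is a toric Kähler–Einstein manifold of complex dimension `m`, for the given action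
of `T^m` with moment map `μ`. -/
structure IsToricKahlerEinstein [FiniteDimensional ℂ E] (m : ℕ) [MulAction (Fin m → Circle) M] (w : M → Form2 E)
    (μ : M → (Fin m → ℝ)) : Prop where
  dim : Module.finrank ℂ E = m
  kahlerEinstein : IsKahlerEinstein w
  action : IsHamiltonianTorusAction m w μ

/-- `K` is a `B`-field transform of the generalized complex structure of an ordinary almost complex
structure on `M`. No regularity or closedness is asked for, and pulling back by a diffeomorphism
preserves the property, so every `K` equivalent under diffeomorphisms and closed `B`-fields to an
ordinary complex structure has it. -/
def IsOrdinary (K : M → (GT E →L[ℝ] GT E)) : Prop :=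
  ∃ (j : M → (E →L[ℝ] E)) (B : M → Form2 E), (∀ x v, j x (j x v) = -v) ∧
    ∀ x, K x = (bField (B x)).comp ((ofComplex (j x)).comp (bField (-B x)))

/-- `(K t, b t, w t)` is a smooth family, parametrized by `t ∈ ℝ`. -/
structure IsSmoothFamily (K : ℝ → M → (GT E →L[ℝ] GT E)) (b w : ℝ → M → Form2 E) : Prop where
  smooth_K : ∀ e ∈ atlas E M,
    ContDiffOn ℝ ∞ (fun p : ℝ × E => endIn (K p.1) e p.2) (univ ×ˢ e.target)
  smooth_b : ∀ e ∈ atlas E M,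
    ContDiffOn ℝ ∞ (fun p : ℝ × E => formIn (b p.1) e p.2) (univ ×ˢ e.target)
  smooth_w : ∀ e ∈ atlas E M,
    ContDiffOn ℝ ∞ (fun p : ℝ × E => formIn (w p.1) e p.2) (univ ×ˢ e.target)

end Mfd

end GKE

end

/-! Let V, W be the fields generated by two different circle factors of the torus, and θ = i_V ω, τ
= i_W ω. The family keeps b = 0 and ω fixed and takes K_t = e^{tA} 𝒥_J e^{-tA}, where A is the
infinitesimal rotation of T ⊕ T* given by the Clifford element VW + θτ. Since the moment map is
invariant, ω(V, W) = 0, so V, W, θ, τ span an isotropic subspace, A² = 0 and e^{tA} = 1 + tA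
(`rot`). As θ, τ are the ω-duals of V, W, the rotation A commutes with 𝒥_ω (`nilMap_ofSymplectic`).
Conjugation by e^{tA} therefore fixes 𝒥_ω and carries the pair (𝒥_J, 𝒥_ω) to (K_t, 𝒥_ω), preserving
commutation and positivity.

Integrability. The vector and covector halves of e^{tA} separate (`deform_eq_shear`): K_t is the
transform, by a multiple of the closed 2-form θ ∧ τ, of the deformation of J by a multiple of the
holomorphic bivector V ∧ W. The bivector is Poisson because V and W are holomorphic and commute
(`poisson_jacobi`, `nijenhuisAt_betaMap`), and closed 2-forms act by symmetries of the Courant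
bracket (`courant_shear`).

Ricci form. In a holomorphic chart, φ_t = e^{t(VW + θτ)} vol spans the canonical line of K_t. The
spin action preserves the Mukai pairing, so ρ = ±1/det h for every t; this rests on the comparison
of vol with e^{iω} in `IsPositive.mukai_expForm`. Differentiation gives dφ_t = t (tr V' · W - tr W'
· V) · φ_t (`forget_dForm_spinM`). Invariance of ω gives V(log det h) = -2 Re tr V'
(`LocalData.fderiv_logDet`), and with it all dependence on t cancels in the covector part of -2 K η
+ K d log |ρ| (`LocalData.ricciSection_snd`). What remains is (d log det h) ∘ J, so GRic_t is -2
times the ordinary Ricci form, and λ = -2c if the Ricci form is cω.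

Nontriviality. An ordinary structure, even after a B-field transform, maps T* into T*. For K_t with
t ≠ 0 this forces W to be a real multiple of V wherever V ≠ 0. A real ratio of holomorphic fields is
locally constant (`exists_eventually_eq_smul`), so by the identity principle and connectedness W =
cV on all of M. Then a nonzero element of the Lie algebra acts trivially, against effectiveness
(`IsHamiltonianTorusAction.not_isOrdinary_torusDeform`). -/

noncomputable section

namespace GKE

set_option maxSynthPendingDepth 3

/-! ### Alternating sums organized by the slot of one argument. -/

section Shuffle

variable {R M N : Type*} [CommRing R] [AddCommGroup M] [Module R M] [AddCommGroup N] [Module R N]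

/-- Every permutation of `Fin (n + 1)` is a permutation fixing `0` times a unique cycle range. -/
theorem bijective_decomposeFin_mul_cycleRange (n : ℕ) :
    Function.Bijective fun jτ : Fin (n + 1) × Equiv.Perm (Fin n) =>
      Equiv.Perm.decomposeFin.symm (0, jτ.2) * Fin.cycleRange jτ.1 := by
  rw [Fintype.bijective_iff_injective_and_card]
  refine ⟨?_, by simp [Fintype.card_perm, Nat.factorial_succ]⟩
  rintro ⟨j, τ⟩ ⟨j', τ'⟩ h
  simp only at h
  -- The index is recovered from the product permutation as the preimage of `0`.
  have key : ∀ (i : Fin (n + 1)) (ρ : Equiv.Perm (Fin n)),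
      (Equiv.Perm.decomposeFin.symm (0, ρ) * Fin.cycleRange i) i = 0 := by
    intro i ρ
    rw [Equiv.Perm.mul_apply, Fin.cycleRange_self]
    simp
  have hj : j = j' := by
    apply (Equiv.Perm.decomposeFin.symm (0, τ) * Fin.cycleRange j).injective
    rw [key j τ, h, key j' τ']
  subst hj
  have h2 := mul_right_cancel h
  have h3 := Equiv.Perm.decomposeFin.symm.injective h2
  simpa using h3

/-- The permutations are sorted by the slot `j` into which `v` falls; the cycle that moves this slot
to the front has sign `(-1) ^ j`. Contractions of wedge products are read off from this expansion.
-/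
theorem alternatization_vecCons {n : ℕ} (m : MultilinearMap R (fun _ : Fin (n + 1) => M) N)
    (v : M) (x : Fin n → M) :
    MultilinearMap.alternatization m (Matrix.vecCons v x) =
      ∑ j : Fin (n + 1), (-1 : ℤ) ^ (j : ℕ) • ∑ τ : Equiv.Perm (Fin n),
        Equiv.Perm.sign τ • m (j.insertNth v (x ∘ τ)) := by
  rw [MultilinearMap.alternatization_apply,
    ← (Equiv.ofBijective _ (bijective_decomposeFin_mul_cycleRange n)).sum_comp,
    Fintype.sum_prod_type]
  refine Finset.sum_congr rfl fun j _ => ?_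
  rw [Finset.smul_sum]
  refine Finset.sum_congr rfl fun τ _ => ?_
  rw [Equiv.ofBijective_apply, MultilinearMap.domDomCongr_apply, Equiv.Perm.sign_mul,
    Fin.sign_cycleRange]
  have h1 : Equiv.Perm.sign (Equiv.Perm.decomposeFin.symm ((0 : Fin (n + 1)), τ))
      = Equiv.Perm.sign τ := by simp
  have h2 : (fun i => (Matrix.vecCons v x : Fin (n + 1) → M)
      ((Equiv.Perm.decomposeFin.symm (0, τ) * Fin.cycleRange j) i))
      = j.insertNth v (x ∘ τ) := by
    rw [← Fin.cons_comp_cycleRange]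
    funext i
    simp only [Equiv.Perm.mul_apply, Function.comp_apply]
    generalize (Fin.cycleRange j) i = k
    refine Fin.cases ?_ (fun k => ?_) k
    · simp [Matrix.vecCons]
    · simp [Matrix.vecCons]
  rw [h1, h2, mul_comm, mul_smul]
  simp [Units.smul_def]

end Shuffle

/-! ### Wedge products of forms of fixed degree and their contractions. -/

section Wedge

variable {E : Type*} [NormedAddCommGroup E] [NormedSpace ℝ E]

/-- The wedge product in a prescribed total degree. -/
def wedgeTo {p q n : ℕ} (h : p + q = n) (α : E [⋀^Fin p]→ₗ[ℝ] ℂ) (β : E [⋀^Fin q]→ₗ[ℝ] ℂ) :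
    E [⋀^Fin n]→ₗ[ℝ] ℂ :=
  (wedge α β).domDomCongr (finCongr h)

/-- The product `α(x₀, …) β(x_p, …)` of forms as a multilinear map. -/
def tensorTo {p q n : ℕ} (h : p + q = n) (α : E [⋀^Fin p]→ₗ[ℝ] ℂ) (β : E [⋀^Fin q]→ₗ[ℝ] ℂ) :
    MultilinearMap ℝ (fun _ : Fin n => E) ℂ :=
  (((LinearMap.mul' ℝ ℂ).compMultilinearMap
    (MultilinearMap.domCoprod (α : MultilinearMap ℝ (fun _ : Fin p => E) ℂ)
      (β : MultilinearMap ℝ (fun _ : Fin q => E) ℂ))).domDomCongr finSumFinEquiv).domDomCongr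
      (finCongr h)

theorem tensorTo_apply {p q n : ℕ} (h : p + q = n) (α : E [⋀^Fin p]→ₗ[ℝ] ℂ)
    (β : E [⋀^Fin q]→ₗ[ℝ] ℂ) (x : Fin n → E) :
    tensorTo h α β x = α (fun i => x (Fin.cast h (Fin.castAdd q i))) *
      β (fun i => x (Fin.cast h (Fin.natAdd p i))) := by
  subst h
  simp [tensorTo]

theorem alternatization_domDomCongr {ι κ N : Type*} [Fintype ι] [DecidableEq ι] [Fintype κ]
    [DecidableEq κ] [AddCommGroup N] [Module ℝ N] (e : ι ≃ κ)
    (m : MultilinearMap ℝ (fun _ : ι => E) N) :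
    MultilinearMap.alternatization (m.domDomCongr e) =
      (MultilinearMap.alternatization m).domDomCongr e := by
  ext x
  rw [MultilinearMap.alternatization_apply, AlternatingMap.domDomCongr_apply,
    MultilinearMap.alternatization_apply, ← (Equiv.permCongr e).sum_comp]
  refine Finset.sum_congr rfl fun σ _ => ?_
  rw [Equiv.Perm.sign_permCongr]
  simp [Equiv.permCongr_apply, Function.comp_def]

/-- The wedge product sums over shuffles only, and each shuffle class contains `p! q!` permutations.
The factor is kept on this side, and later identities are proved by cancelling it. -/
theorem alternatization_tensorTo {p q n : ℕ} (h : p + q = n) (α : E [⋀^Fin p]→ₗ[ℝ] ℂ)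
    (β : E [⋀^Fin q]→ₗ[ℝ] ℂ) :
    MultilinearMap.alternatization (tensorTo h α β) =
      (p.factorial * q.factorial) • wedgeTo h α β := by
  rw [tensorTo, alternatization_domDomCongr, alternatization_domDomCongr,
    LinearMap.compMultilinearMap_alternatization, MultilinearMap.domCoprod_alternization_eq]
  ext x
  simp [wedgeTo, wedge]

theorem wedgeTo_apply {p q n : ℕ} (h : p + q = n) (α : E [⋀^Fin p]→ₗ[ℝ] ℂ)
    (β : E [⋀^Fin q]→ₗ[ℝ] ℂ) (x : Fin n → E) :
    (p.factorial * q.factorial : ℂ) * wedgeTo h α β x =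
      ∑ τ : Equiv.Perm (Fin n), Equiv.Perm.sign τ • tensorTo h α β (x ∘ τ) := by
  have := congrArg (fun f => f x) (alternatization_tensorTo h α β)
  simp only [MultilinearMap.alternatization_apply, AlternatingMap.smul_apply, nsmul_eq_mul] at this
  push_cast at this
  rw [← this]
  rfl

theorem tensorTo_insertNth_left {p q n : ℕ} (h : p + 1 + q = n + 1) (h' : p + q = n)
    (α : E [⋀^Fin (p + 1)]→ₗ[ℝ] ℂ) (β : E [⋀^Fin q]→ₗ[ℝ] ℂ) (j : Fin (p + 1)) (v : E)
    (y : Fin n → E) :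
    tensorTo h α β ((Fin.cast h (Fin.castAdd q j)).insertNth v y) =
      (-1 : ℤ) ^ (j : ℕ) • tensorTo h' (α.curryLeft v) β y := by
  rw [tensorTo_apply, tensorTo_apply]
  have h1 : (fun i => (Fin.cast h (Fin.castAdd q j)).insertNth (α := fun _ => E) v y
      (Fin.cast h (Fin.castAdd q i)))
      = j.insertNth (α := fun _ => E) v (fun i => y (Fin.cast h' (Fin.castAdd q i))) := by
    funext i
    refine Fin.succAboveCases j ?_ (fun k => ?_) i
    · simp
    · have : Fin.cast h (Fin.castAdd q (j.succAbove k)) =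
          (Fin.cast h (Fin.castAdd q j)).succAbove (Fin.cast h' (Fin.castAdd q k)) := by
        ext
        simp only [Fin.succAbove, Fin.lt_def, Fin.val_cast, Fin.val_castAdd, Fin.val_castSucc]
        split_ifs <;> simp
      rw [this, Fin.insertNth_apply_succAbove, Fin.insertNth_apply_succAbove]
  have h2 : (fun i => (Fin.cast h (Fin.castAdd q j)).insertNth (α := fun _ => E) v y
      (Fin.cast h (Fin.natAdd (p + 1) i)))
      = fun i => y (Fin.cast h' (Fin.natAdd p i)) := by
    funext i
    have : Fin.cast h (Fin.natAdd (p + 1) i) =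
        (Fin.cast h (Fin.castAdd q j)).succAbove (Fin.cast h' (Fin.natAdd p i)) := by
      ext
      have := j.2
      simp only [Fin.succAbove, Fin.lt_def, Fin.val_cast, Fin.val_castAdd, Fin.val_castSucc,
        Fin.val_natAdd]
      split_ifs <;> simp <;> omega
    rw [this, Fin.insertNth_apply_succAbove]
  rw [h1, h2, AlternatingMap.map_insertNth, AlternatingMap.curryLeft_apply_apply]
  simp only [zsmul_eq_mul, mul_assoc]

/-- Only the position inside the second block gives a sign here; the sign `(-1) ^ p` for crossing
the first block enters in `wedgeTo_right_sum`. -/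
theorem tensorTo_insertNth_right {p q n : ℕ} (h : p + (q + 1) = n + 1) (h' : p + q = n)
    (α : E [⋀^Fin p]→ₗ[ℝ] ℂ) (β : E [⋀^Fin (q + 1)]→ₗ[ℝ] ℂ) (j : Fin (q + 1)) (v : E)
    (y : Fin n → E) :
    tensorTo h α β ((Fin.cast h (Fin.natAdd p j)).insertNth v y) =
      (-1 : ℤ) ^ (j : ℕ) • tensorTo h' α (β.curryLeft v) y := by
  rw [tensorTo_apply, tensorTo_apply]
  have h1 : (fun i => (Fin.cast h (Fin.natAdd p j)).insertNth (α := fun _ => E) v y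
      (Fin.cast h (Fin.natAdd p i)))
      = j.insertNth (α := fun _ => E) v (fun i => y (Fin.cast h' (Fin.natAdd p i))) := by
    funext i
    refine Fin.succAboveCases j ?_ (fun k => ?_) i
    · simp
    · have : Fin.cast h (Fin.natAdd p (j.succAbove k)) =
          (Fin.cast h (Fin.natAdd p j)).succAbove (Fin.cast h' (Fin.natAdd p k)) := by
        ext
        simp only [Fin.succAbove, Fin.lt_def, Fin.val_cast, Fin.val_natAdd, Fin.val_castSucc]
        split_ifs <;> simp <;> omega
      rw [this, Fin.insertNth_apply_succAbove, Fin.insertNth_apply_succAbove]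
  have h2 : (fun i => (Fin.cast h (Fin.natAdd p j)).insertNth (α := fun _ => E) v y
      (Fin.cast h (Fin.castAdd (q + 1) i)))
      = fun i => y (Fin.cast h' (Fin.castAdd q i)) := by
    funext i
    have : Fin.cast h (Fin.castAdd (q + 1) i) =
        (Fin.cast h (Fin.natAdd p j)).succAbove (Fin.cast h' (Fin.castAdd q i)) := by
      ext
      have := i.2
      simp only [Fin.succAbove, Fin.lt_def, Fin.val_cast, Fin.val_castAdd, Fin.val_castSucc,
        Fin.val_natAdd]
      split_ifs <;> simp
      omega
    rw [this, Fin.insertNth_apply_succAbove]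
  rw [h1, h2, AlternatingMap.map_insertNth, AlternatingMap.curryLeft_apply_apply]
  simp only [zsmul_eq_mul]
  ring

theorem wedgeTo_vecCons {p q n : ℕ} (h : p + q = n + 1) (α : E [⋀^Fin p]→ₗ[ℝ] ℂ)
    (β : E [⋀^Fin q]→ₗ[ℝ] ℂ) (v : E) (x : Fin n → E) :
    (p.factorial * q.factorial : ℂ) * wedgeTo h α β (Matrix.vecCons v x) =
      (∑ j : Fin p, (-1 : ℤ) ^ (j : ℕ) • ∑ τ : Equiv.Perm (Fin n), Equiv.Perm.sign τ •
        tensorTo h α β ((Fin.cast h (Fin.castAdd q j)).insertNth v (x ∘ τ))) +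
      ∑ j : Fin q, (-1 : ℤ) ^ (p + j : ℕ) • ∑ τ : Equiv.Perm (Fin n), Equiv.Perm.sign τ •
        tensorTo h α β ((Fin.cast h (Fin.natAdd p j)).insertNth v (x ∘ τ)) := by
  have key := congrArg (fun f => f (Matrix.vecCons v x)) (alternatization_tensorTo h α β)
  simp only [alternatization_vecCons, AlternatingMap.smul_apply, nsmul_eq_mul] at key
  push_cast at key
  rw [← key, ← (finCongr h).sum_comp, Fin.sum_univ_add]
  rfl

theorem wedgeTo_left_sum {p q n : ℕ} (h : p + 1 + q = n + 1) (h' : p + q = n)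
    -- All `p + 1` slots of the first factor contribute the same amount, which turns `p!` into `(p +
    -- 1)!`.
    (α : E [⋀^Fin (p + 1)]→ₗ[ℝ] ℂ) (β : E [⋀^Fin q]→ₗ[ℝ] ℂ) (v : E) (x : Fin n → E) :
    (∑ j : Fin (p + 1), (-1 : ℤ) ^ (j : ℕ) • ∑ τ : Equiv.Perm (Fin n), Equiv.Perm.sign τ •
        tensorTo h α β ((Fin.cast h (Fin.castAdd q j)).insertNth v (x ∘ τ))) =
      ((p + 1).factorial * q.factorial : ℂ) * wedgeTo h' (α.curryLeft v) β x := by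
  have : ∀ j : Fin (p + 1), (-1 : ℤ) ^ (j : ℕ) • ∑ τ : Equiv.Perm (Fin n), Equiv.Perm.sign τ •
        tensorTo h α β ((Fin.cast h (Fin.castAdd q j)).insertNth v (x ∘ τ)) =
      (p.factorial * q.factorial : ℂ) * wedgeTo h' (α.curryLeft v) β x := by
    intro j
    rw [wedgeTo_apply, Finset.smul_sum]
    refine Finset.sum_congr rfl fun τ _ => ?_
    rw [tensorTo_insertNth_left h h', smul_comm, smul_smul, ← pow_add, Even.neg_one_pow ⟨_, rfl⟩,
      one_smul]
  simp only [this, Finset.sum_const, Finset.card_univ, Fintype.card_fin, nsmul_eq_mul,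
    Nat.factorial_succ]
  push_cast
  ring

theorem wedgeTo_right_sum {p q n : ℕ} (h : p + (q + 1) = n + 1) (h' : p + q = n)
    (α : E [⋀^Fin p]→ₗ[ℝ] ℂ) (β : E [⋀^Fin (q + 1)]→ₗ[ℝ] ℂ) (v : E) (x : Fin n → E) :
    (∑ j : Fin (q + 1), (-1 : ℤ) ^ (p + j : ℕ) • ∑ τ : Equiv.Perm (Fin n), Equiv.Perm.sign τ •
        tensorTo h α β ((Fin.cast h (Fin.natAdd p j)).insertNth v (x ∘ τ))) =
      (p.factorial * (q + 1).factorial : ℂ) * ((-1) ^ p * wedgeTo h' α (β.curryLeft v) x) := by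
  have : ∀ j : Fin (q + 1), (-1 : ℤ) ^ (p + j : ℕ) • ∑ τ : Equiv.Perm (Fin n),
        Equiv.Perm.sign τ • tensorTo h α β ((Fin.cast h (Fin.natAdd p j)).insertNth v (x ∘ τ)) =
      (-1) ^ p * ((p.factorial * q.factorial : ℂ) * wedgeTo h' α (β.curryLeft v) x) := by
    intro j
    rw [wedgeTo_apply, Finset.smul_sum, Finset.mul_sum]
    refine Finset.sum_congr rfl fun τ _ => ?_
    rw [tensorTo_insertNth_right h h', smul_comm, smul_smul, pow_add, mul_assoc, ← pow_add,
      Even.neg_one_pow ⟨_, rfl⟩, mul_one, smul_comm]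
    simp
  simp only [this, Finset.sum_const, Finset.card_univ, Fintype.card_fin, nsmul_eq_mul,
    Nat.factorial_succ]
  push_cast
  ring

theorem factorial_mul_factorial_ne_zero (p q : ℕ) : (p.factorial * q.factorial : ℂ) ≠ 0 := by
  exact_mod_cast mul_ne_zero (Nat.factorial_ne_zero p) (Nat.factorial_ne_zero q)

/-- The vector falls either into the first factor or into the second, which gives the graded Leibniz
rule. A factor of degree zero has no contraction, so those cases are stated separately. -/
theorem wedgeTo_curryLeft {p q n : ℕ} (h : p + 1 + (q + 1) = n + 1) (h₁ : p + (q + 1) = n)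
    (h₂ : p + 1 + q = n) (α : E [⋀^Fin (p + 1)]→ₗ[ℝ] ℂ) (β : E [⋀^Fin (q + 1)]→ₗ[ℝ] ℂ) (v : E) :
    (wedgeTo h α β).curryLeft v = wedgeTo h₁ (α.curryLeft v) β +
      (-1 : ℂ) ^ (p + 1) • wedgeTo h₂ α (β.curryLeft v) := by
  ext x
  apply mul_left_cancel₀ (factorial_mul_factorial_ne_zero (p + 1) (q + 1))
  rw [AlternatingMap.curryLeft_apply_apply, wedgeTo_vecCons, wedgeTo_left_sum h h₁,
    wedgeTo_right_sum h h₂]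
  simp only [AlternatingMap.add_apply, AlternatingMap.smul_apply, smul_eq_mul]
  ring

theorem wedgeTo_curryLeft_zero_left {q n : ℕ} (h : 0 + (q + 1) = n + 1) (h' : 0 + q = n)
    (α : E [⋀^Fin 0]→ₗ[ℝ] ℂ) (β : E [⋀^Fin (q + 1)]→ₗ[ℝ] ℂ) (v : E) :
    (wedgeTo h α β).curryLeft v = wedgeTo h' α (β.curryLeft v) := by
  ext x
  apply mul_left_cancel₀ (factorial_mul_factorial_ne_zero 0 (q + 1))
  rw [AlternatingMap.curryLeft_apply_apply, wedgeTo_vecCons, wedgeTo_right_sum h h']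
  simp

theorem wedgeTo_curryLeft_zero_right {p n : ℕ} (h : p + 1 + 0 = n + 1) (h' : p + 0 = n)
    (α : E [⋀^Fin (p + 1)]→ₗ[ℝ] ℂ) (β : E [⋀^Fin 0]→ₗ[ℝ] ℂ) (v : E) :
    (wedgeTo h α β).curryLeft v = wedgeTo h' (α.curryLeft v) β := by
  ext x
  apply mul_left_cancel₀ (factorial_mul_factorial_ne_zero (p + 1) 0)
  rw [AlternatingMap.curryLeft_apply_apply, wedgeTo_vecCons, wedgeTo_left_sum h h']
  simp

end Wedge

/-! ### The Clifford action on mixed forms. -/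

section Clifford

variable {E : Type*} [NormedAddCommGroup E] [NormedSpace ℝ E]

/-- Interior product of a mixed form with a vector. -/
def contr (v : E) : AForm E →ₗ[ℂ] AForm E where
  toFun α p := (α (p + 1)).curryLeft v
  map_add' α β := by ext p x; simp
  map_smul' c α := by ext p x; simp

/-- Exterior product of a real `1`-form with a mixed form. -/
def extMul (ξ : E →L[ℝ] ℝ) : AForm E →ₗ[ℂ] AForm E where
  toFun α p := match p with
    | 0 => 0
    | p + 1 => AlternatingMap.alternatizeUncurryFin (ξ.toLinearMap.smulRight (α p))
  map_add' α β := by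
    ext p x
    cases p with
    | zero => simp
    | succ p => simp [AlternatingMap.alternatizeUncurryFin_apply, Finset.sum_add_distrib]
  map_smul' c α := by
    ext p x
    cases p with
    | zero => simp
    | succ p =>
      simp [AlternatingMap.alternatizeUncurryFin_apply, Finset.mul_sum, mul_left_comm]

/-- The grading involution. -/
def gradeInv : AForm E →ₗ[ℂ] AForm E where
  toFun α p := (-1 : ℂ) ^ p • α p
  map_add' α β := by ext p x; simp
  map_smul' c α := by ext p x; simp [mul_left_comm]

/-- The wedge product of mixed forms. -/
def mulForm (α β : AForm E) : AForm E := fun n =>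
  ∑ p : Fin (n + 1), wedgeTo (Nat.add_sub_of_le (Nat.lt_succ_iff.mp p.2)) (α p) (β (n - p))

theorem contr_apply (v : E) (α : AForm E) (p : ℕ) : contr v α p = (α (p + 1)).curryLeft v := rfl

theorem extMul_zero (ξ : E →L[ℝ] ℝ) (α : AForm E) : extMul ξ α 0 = 0 := rfl

theorem extMul_succ (ξ : E →L[ℝ] ℝ) (α : AForm E) (p : ℕ) :
    extMul ξ α (p + 1) =
      AlternatingMap.alternatizeUncurryFin (ξ.toLinearMap.smulRight (α p)) := rfl

theorem gradeInv_apply (α : AForm E) (p : ℕ) : gradeInv α p = (-1 : ℂ) ^ p • α p := rfl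

/-- Contractions lower the degree by one and determine a form of positive degree; this drives the
inductions on degree below. -/
theorem succ_ext {p : ℕ} {α β : E [⋀^Fin (p + 1)]→ₗ[ℝ] ℂ}
    (h : ∀ v, α.curryLeft v = β.curryLeft v) : α = β := by
  ext x
  have := congrArg (fun f => f (Matrix.vecTail x)) (h (Matrix.vecHead x))
  simpa using this

/-- The summand in which `ξ` receives `v` is split off; in the others `v` sits in the first slot of
`α`, at the cost of one sign. -/
theorem contr_extMul (v : E) (ξ : E →L[ℝ] ℝ) (α : AForm E) :
    contr v (extMul ξ α) = (ξ v : ℂ) • α - extMul ξ (contr v α) := by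
  funext p
  ext x
  cases p with
  | zero =>
    simp [contr_apply, extMul_succ, extMul_zero, AlternatingMap.alternatizeUncurryFin_apply]
  | succ p =>
    simp only [contr_apply, extMul_succ, AlternatingMap.curryLeft_apply_apply,
      AlternatingMap.alternatizeUncurryFin_apply, Pi.sub_apply, Pi.smul_apply,
      AlternatingMap.sub_apply, AlternatingMap.smul_apply]
    rw [Fin.sum_univ_succ, sub_eq_add_neg, ← Finset.sum_neg_distrib]
    congr 1
    · simp
    · refine Finset.sum_congr rfl fun i _ => ?_
      have : (i.succ.removeNth (Matrix.vecCons v x) : Fin (p + 1) → E) =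
          Matrix.vecCons v (i.removeNth x) := by
        funext k
        refine Fin.cases ?_ (fun k => ?_) k
        · simp [Fin.removeNth]
        · simp [Fin.removeNth]
      simp [this, pow_succ]

theorem contr_contr (u v : E) (α : AForm E) : contr u (contr v α) = -contr v (contr u α) := by
  funext p
  ext x
  simp only [contr_apply, AlternatingMap.curryLeft_apply_apply, Pi.neg_apply,
    AlternatingMap.neg_apply]
  have h := (α (p + 1 + 1)).map_swap (Matrix.vecCons u (Matrix.vecCons v x))
    (i := 0) (j := 1) (by simp)
  rw [← h]
  congr 1
  funext k
  refine Fin.cases ?_ (fun k => Fin.cases ?_ (fun k => ?_) k) k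
  · simp
  · simp
  · have h0 : k.succ.succ ≠ 0 := Fin.succ_ne_zero _
    have h1 : k.succ.succ ≠ 1 := by
      intro h
      have := congrArg Fin.val h
      simp at this
    simp [Equiv.swap_apply_of_ne_of_ne h0 h1]

theorem extMul_apply_eq_of_forall {n : ℕ} {ξ : E →L[ℝ] ℝ} {α β : AForm E}
    (h : ∀ k, k + 1 = n → α k = β k) : extMul ξ α n = extMul ξ β n := by
  cases n with
  | zero => rfl
  | succ n => rw [extMul_succ, extMul_succ, h n rfl]

theorem extMul_extMul (ξ η : E →L[ℝ] ℝ) (α : AForm E) :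
    extMul ξ (extMul η α) = -extMul η (extMul ξ α) := by
  funext n
  induction n generalizing α with
  | zero => simp [extMul_zero]
  | succ n ih =>
    refine succ_ext fun v => ?_
    have h1 := congrFun (contr_extMul v ξ (extMul η α)) n
    have h2 := congrFun (contr_extMul v η (extMul ξ α)) n
    rw [contr_apply] at h1 h2
    rw [h1, Pi.neg_apply]
    have h3 : ((-extMul η (extMul ξ α) (n + 1)).curryLeft v) =
      -((extMul η (extMul ξ α) (n + 1)).curryLeft v) := rfl
    rw [h3, h2, contr_extMul, contr_extMul, map_sub, map_sub, map_smul, map_smul]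
    have := ih (contr v α)
    simp only [Pi.sub_apply, Pi.neg_apply, Pi.smul_apply] at this ⊢
    rw [this]
    abel

theorem gradeInv_contr (v : E) (α : AForm E) : gradeInv (contr v α) = -contr v (gradeInv α) := by
  funext p
  ext x
  simp [contr_apply, gradeInv_apply, pow_succ]

theorem gradeInv_extMul (ξ : E →L[ℝ] ℝ) (α : AForm E) :
    gradeInv (extMul ξ α) = -extMul ξ (gradeInv α) := by
  funext p
  ext x
  cases p with
  | zero => simp [extMul_zero, gradeInv_apply]
  | succ p =>
    simp [extMul_succ, gradeInv_apply, pow_succ, AlternatingMap.alternatizeUncurryFin_apply,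
      Finset.mul_sum, mul_left_comm]

theorem gradeInv_gradeInv (α : AForm E) : gradeInv (gradeInv α) = α := by
  funext p
  simp [gradeInv_apply, smul_smul, ← mul_pow]

theorem wedgeTo_add_left {p q n : ℕ} (h : p + q = n) (α α' : E [⋀^Fin p]→ₗ[ℝ] ℂ)
    (β : E [⋀^Fin q]→ₗ[ℝ] ℂ) :
    wedgeTo h (α + α') β = wedgeTo h α β + wedgeTo h α' β := by
  ext x
  apply mul_left_cancel₀ (factorial_mul_factorial_ne_zero p q)
  rw [AlternatingMap.add_apply, mul_add, wedgeTo_apply, wedgeTo_apply, wedgeTo_apply,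
    ← Finset.sum_add_distrib]
  refine Finset.sum_congr rfl fun τ _ => ?_
  simp [tensorTo_apply, add_mul]

theorem wedgeTo_add_right {p q n : ℕ} (h : p + q = n) (α : E [⋀^Fin p]→ₗ[ℝ] ℂ)
    (β β' : E [⋀^Fin q]→ₗ[ℝ] ℂ) :
    wedgeTo h α (β + β') = wedgeTo h α β + wedgeTo h α β' := by
  ext x
  apply mul_left_cancel₀ (factorial_mul_factorial_ne_zero p q)
  rw [AlternatingMap.add_apply, mul_add, wedgeTo_apply, wedgeTo_apply, wedgeTo_apply,
    ← Finset.sum_add_distrib]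
  refine Finset.sum_congr rfl fun τ _ => ?_
  simp [tensorTo_apply, mul_add]

theorem wedgeTo_smul_left {p q n : ℕ} (h : p + q = n) (c : ℂ) (α : E [⋀^Fin p]→ₗ[ℝ] ℂ)
    (β : E [⋀^Fin q]→ₗ[ℝ] ℂ) : wedgeTo h (c • α) β = c • wedgeTo h α β := by
  ext x
  apply mul_left_cancel₀ (factorial_mul_factorial_ne_zero p q)
  rw [AlternatingMap.smul_apply, smul_eq_mul, mul_left_comm, wedgeTo_apply, wedgeTo_apply,
    Finset.mul_sum]
  refine Finset.sum_congr rfl fun τ _ => ?_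
  rw [mul_smul_comm]
  simp [tensorTo_apply, mul_assoc]

theorem wedgeTo_smul_right {p q n : ℕ} (h : p + q = n) (c : ℂ) (α : E [⋀^Fin p]→ₗ[ℝ] ℂ)
    (β : E [⋀^Fin q]→ₗ[ℝ] ℂ) : wedgeTo h α (c • β) = c • wedgeTo h α β := by
  ext x
  apply mul_left_cancel₀ (factorial_mul_factorial_ne_zero p q)
  rw [AlternatingMap.smul_apply, smul_eq_mul, mul_left_comm, wedgeTo_apply, wedgeTo_apply,
    Finset.mul_sum]
  refine Finset.sum_congr rfl fun τ _ => ?_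
  rw [mul_smul_comm]
  simp [tensorTo_apply, mul_left_comm]

theorem wedgeTo_congr {α β : AForm E} {p p' q q' n : ℕ} (h : p + q = n) (h' : p' + q' = n)
    (hp : p = p') : wedgeTo h (α p) (β q) = wedgeTo h' (α p') (β q') := by
  subst hp
  obtain rfl : q = q' := by omega
  rfl

/-- The wedge product of mixed forms is bilinear. -/
def mulFormₗ : AForm E →ₗ[ℂ] AForm E →ₗ[ℂ] AForm E :=
  LinearMap.mk₂ ℂ mulForm
    (fun α α' β => by
      funext n; simp [mulForm, wedgeTo_add_left, Finset.sum_add_distrib])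
    (fun c α β => by
      funext n; simp [mulForm, wedgeTo_smul_left, Finset.smul_sum])
    (fun α β β' => by
      funext n; simp [mulForm, wedgeTo_add_right, Finset.sum_add_distrib])
    (fun c α β => by
      funext n; simp [mulForm, wedgeTo_smul_right, Finset.smul_sum])

theorem mulFormₗ_apply (α β : AForm E) : mulFormₗ α β = mulForm α β := rfl

theorem sum_curryLeft {ι : Type*} (s : Finset ι) {n : ℕ} (f : ι → E [⋀^Fin (n + 1)]→ₗ[ℝ] ℂ)
    (v : E) : (∑ i ∈ s, f i).curryLeft v = ∑ i ∈ s, (f i).curryLeft v := by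
  classical
  induction s using Finset.induction_on with
  | empty => simp
  | insert i s hi ih => rw [Finset.sum_insert hi, Finset.sum_insert hi, ← ih]; rfl

/-- The graded Leibniz rule summed over bidegrees, with `gradeInv` supplying the sign of the second
term. -/
theorem contr_mulForm (v : E) (α β : AForm E) :
    contr v (mulForm α β) = mulForm (contr v α) β + mulForm (gradeInv α) (contr v β) := by
  funext n
  rw [contr_apply, mulForm, sum_curryLeft, Pi.add_apply]
  -- The conditions record that the extreme bidegrees `p = 0` and `p = n + 1` have only one
  -- contraction; the two sums are then reindexed separately.
  have key : ∀ p : ℕ, ∀ hp : p ≤ n + 1, (wedgeTo (Nat.add_sub_of_le hp) (α p)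
        (β (n + 1 - p))).curryLeft v =
      (if h : 1 ≤ p then wedgeTo (show (p - 1) + (n - (p - 1)) = n by omega) (contr v α (p - 1))
        (β (n - (p - 1))) else 0) +
      (if h : p ≤ n then wedgeTo (Nat.add_sub_of_le h) (gradeInv α p) (contr v β (n - p)) else 0) := by
    intro p hp
    obtain ⟨q, hq⟩ : ∃ q, q = n + 1 - p := ⟨_, rfl⟩
    have hpq : p + q = n + 1 := by omega
    rw [wedgeTo_congr (α := α) (β := β) (Nat.add_sub_of_le hp) hpq rfl]
    rcases p with _ | p
    · obtain ⟨q, rfl⟩ : ∃ q', q = q' + 1 := ⟨q - 1, by omega⟩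
      rw [wedgeTo_curryLeft_zero_left hpq (show 0 + q = n by omega)]
      rw [dif_neg (by omega), dif_pos (by omega)]
      refine Eq.trans ?_ (zero_add _).symm
      rw [wedgeTo_congr (α := gradeInv α) (β := contr v β) (p := 0) (p' := 0) (q' := q) _
          (show 0 + q = n by omega) rfl]
      simp [gradeInv_apply, contr_apply]
    · rcases q with _ | q
      · rw [wedgeTo_curryLeft_zero_right hpq (show p + 0 = n by omega)]
        rw [dif_pos (by omega), dif_neg (by omega)]
        refine Eq.trans ?_ (add_zero _).symm
        exact wedgeTo_congr (α := contr v α) (β := β) _ _ rfl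
      · rw [wedgeTo_curryLeft hpq (by omega) (by omega), dif_pos (by omega), dif_pos (by omega)]
        congr 1
        · exact wedgeTo_congr (α := contr v α) (β := β) _ _ rfl
        · rw [wedgeTo_congr (α := gradeInv α) (β := contr v β) (p := p + 1) (p' := p + 1) (q' := q) _
          (show p + 1 + q = n by omega) rfl, gradeInv_apply, wedgeTo_smul_left]
          rfl
  rw [Finset.sum_congr rfl fun (p : Fin (n + 1 + 1)) _ => key p (Nat.lt_succ_iff.mp p.2), Finset.sum_add_distrib]
  congr 1
  · rw [Fin.sum_univ_succ]
    simp [mulForm]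
  · rw [Fin.sum_univ_castSucc]
    simp only [Fin.val_castSucc, Fin.val_last]
    rw [dif_neg (by omega), add_zero, mulForm]
    exact Finset.sum_congr rfl fun p _ => dif_pos (Nat.lt_succ_iff.mp p.2)

theorem mulForm_zero_apply (α β : AForm E) :
    mulForm α β 0 = wedgeTo (by rfl) (α 0) (β 0) := by
  simp [mulForm]

theorem wedgeTo_zero_left {p q n : ℕ} (h : p + q = n) (β : E [⋀^Fin q]→ₗ[ℝ] ℂ) :
    wedgeTo h 0 β = 0 := by
  have := wedgeTo_smul_left h 0 0 β
  simpa using this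

theorem wedgeTo_zero_right {p q n : ℕ} (h : p + q = n) (α : E [⋀^Fin p]→ₗ[ℝ] ℂ) :
    wedgeTo h α (0 : E [⋀^Fin q]→ₗ[ℝ] ℂ) = 0 := by
  have := wedgeTo_smul_right h 0 α (0 : E [⋀^Fin q]→ₗ[ℝ] ℂ)
  simpa using this

/-- Both sides have the same contractions by induction on the degree, so associativity of the wedge
product is not needed. -/
theorem mulForm_extMul_left (ξ : E →L[ℝ] ℝ) (α β : AForm E) :
    mulForm (extMul ξ α) β = extMul ξ (mulForm α β) := by
  funext n
  induction n generalizing α β with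
  | zero => rw [mulForm_zero_apply, extMul_zero, extMul_zero, wedgeTo_zero_left]
  | succ n ih =>
    refine succ_ext fun v => ?_
    have h1 := congrFun (contr_mulForm v (extMul ξ α) β) n
    have h2 := congrFun (contr_extMul v ξ (mulForm α β)) n
    rw [contr_apply] at h1 h2
    rw [h1, h2, contr_extMul, gradeInv_extMul, contr_mulForm]
    simp only [← mulFormₗ_apply, map_sub, map_neg, map_smul, map_add, LinearMap.sub_apply,
      LinearMap.neg_apply, LinearMap.smul_apply, Pi.add_apply, Pi.sub_apply, Pi.neg_apply] at ih ⊢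
    rw [ih, ih]
    abel

theorem mulForm_extMul_right (ξ : E →L[ℝ] ℝ) (α β : AForm E) :
    mulForm (gradeInv α) (extMul ξ β) = extMul ξ (mulForm α β) := by
  funext n
  induction n generalizing α β with
  | zero => rw [mulForm_zero_apply, extMul_zero, extMul_zero, wedgeTo_zero_right]
  | succ n ih =>
    refine succ_ext fun v => ?_
    have h1 := congrFun (contr_mulForm v (gradeInv α) (extMul ξ β)) n
    have h2 := congrFun (contr_extMul v ξ (mulForm α β)) n
    rw [contr_apply] at h1 h2
    have h3 : contr v (gradeInv α) = -gradeInv (contr v α) := by rw [gradeInv_contr, neg_neg]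
    have ih' := ih (gradeInv α) (contr v β)
    rw [gradeInv_gradeInv] at ih'
    rw [h1, h2, contr_extMul, gradeInv_gradeInv, contr_mulForm, h3]
    simp only [← mulFormₗ_apply, map_sub, map_neg, map_smul, map_add,
      LinearMap.neg_apply, Pi.add_apply, Pi.sub_apply, Pi.neg_apply] at ih ih' ⊢
    rw [ih, ih']
    abel

/-- The Clifford action on mixed forms. -/
def cl (e : GT E) : AForm E →ₗ[ℂ] AForm E := contr e.1 + extMul e.2

theorem cl_apply (e : GT E) (α : AForm E) : cl e α = contr e.1 α + extMul e.2 α := rfl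

theorem contr_add (u v : E) : contr (u + v) = contr u + contr v := by
  ext α p x
  simp [contr_apply]

theorem contr_smul (c : ℝ) (v : E) : contr (c • v) = (c : ℂ) • contr v := by
  ext α p x
  simp [contr_apply]

theorem extMul_add (ξ η : E →L[ℝ] ℝ) : extMul (ξ + η) = extMul ξ + extMul η := by
  ext α p x
  cases p with
  | zero => simp [extMul_zero]
  | succ p => simp [extMul_succ, AlternatingMap.alternatizeUncurryFin_apply, add_mul,
      Finset.sum_add_distrib]

theorem extMul_smul (c : ℝ) (ξ : E →L[ℝ] ℝ) : extMul (c • ξ) = (c : ℂ) • extMul ξ := by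
  ext α p x
  cases p with
  | zero => simp [extMul_zero]
  | succ p => simp [extMul_succ, AlternatingMap.alternatizeUncurryFin_apply, Finset.mul_sum,
      mul_assoc, mul_left_comm]

theorem cl_add (e f : GT E) : cl (e + f) = cl e + cl f := by
  simp only [cl, Prod.fst_add, Prod.snd_add, contr_add, extMul_add]
  abel

theorem cl_smul (c : ℝ) (e : GT E) : cl (c • e) = (c : ℂ) • cl e := by
  simp only [cl, Prod.smul_fst, Prod.smul_snd, contr_smul, extMul_smul, smul_add]

/-- The Clifford relation: the anticommutator of `e` and `f` is twice their `pairing`. -/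
theorem cl_cl (e f : GT E) (α : AForm E) :
    cl e (cl f α) = ((f.2 e.1 + e.2 f.1 : ℝ) : ℂ) • α - cl f (cl e α) := by
  simp only [cl_apply, map_add]
  rw [contr_contr e.1 f.1, extMul_extMul e.2 f.2, contr_extMul e.1 f.2, contr_extMul f.1 e.2]
  push_cast
  rw [add_smul]
  abel

end Clifford

/-! ### The Mukai pairing, conjugation, and compatibility with the Clifford action. -/

section Mukai

variable {E : Type*} [NormedAddCommGroup E] [NormedSpace ℝ E]

/-- The Clifford involution `σ`. -/
def sigmaInv : AForm E →ₗ[ℂ] AForm E where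
  toFun α p := (sigmaSign p : ℂ) • α p
  map_add' α β := by ext p x; simp
  map_smul' c α := by ext p x; simp [mul_left_comm]

theorem sigmaInv_apply (α : AForm E) (p : ℕ) : sigmaInv α p = (sigmaSign p : ℂ) • α p := rfl

/-- σ is the reversal sign (-1)^{p(p-1)/2}. -/
theorem sigmaSign_succ (p : ℕ) : sigmaSign (p + 1) = (-1) ^ p * sigmaSign p := by
  obtain ⟨k, r, hr, rfl⟩ : ∃ k r, r < 4 ∧ p = 4 * k + r :=
    ⟨p / 4, p % 4, Nat.mod_lt _ (by norm_num), by omega⟩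
  have h4 : ((-1 : ℝ)) ^ (4 * k) = 1 := by rw [pow_mul]; norm_num
  interval_cases r <;> norm_num [sigmaSign, pow_add, h4, Nat.add_mod]

theorem mukai_eq (N : ℕ) (α β : AForm E) : mukai N α β = mulForm α (sigmaInv β) N := by
  unfold mukai mulForm
  refine Finset.sum_congr rfl fun p _ => ?_
  have : sigmaInv β (N - p) = sigmaSign (N - p) • β (N - p) := by
    ext x; simp [sigmaInv_apply]
  rw [this]
  rfl

theorem contr_sigmaInv (v : E) (α : AForm E) :
    contr v (sigmaInv α) = gradeInv (sigmaInv (contr v α)) := by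
  funext p
  ext x
  simp [contr_apply, sigmaInv_apply, gradeInv_apply, sigmaSign_succ, mul_assoc]

theorem extMul_sigmaInv (ξ : E →L[ℝ] ℝ) (α : AForm E) :
    extMul ξ (sigmaInv α) = -gradeInv (sigmaInv (extMul ξ α)) := by
  funext p
  ext x
  cases p with
  | zero => simp [extMul_zero, gradeInv_apply, sigmaInv_apply]
  | succ p =>
    have h : ((-1 : ℂ)) ^ p * (-1) ^ p = 1 := by rw [← mul_pow]; simp
    simp only [extMul_succ, sigmaInv_apply, gradeInv_apply, Pi.neg_apply,
      AlternatingMap.neg_apply, AlternatingMap.smul_apply, smul_eq_mul, sigmaSign_succ,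
      AlternatingMap.alternatizeUncurryFin_apply, LinearMap.smulRight_apply, Finset.mul_sum,
      ← Finset.sum_neg_distrib]
    refine Finset.sum_congr rfl fun i _ => ?_
    push_cast
    simp only [Complex.real_smul, zsmul_eq_mul]
    push_cast
    linear_combination (-(-1 : ℂ) ^ (i : ℕ) * (ContinuousLinearMap.toLinearMap ξ (x i)) *
      (sigmaSign p * (α p) (i.removeNth x))) * h

theorem mulForm_gradeInv (α β : AForm E) :
    mulForm (gradeInv α) (gradeInv β) = gradeInv (mulForm α β) := by
  funext n
  rw [gradeInv_apply]
  unfold mulForm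
  rw [Finset.smul_sum]
  refine Finset.sum_congr rfl fun p _ => ?_
  rw [gradeInv_apply, gradeInv_apply, wedgeTo_smul_left, wedgeTo_smul_right, smul_smul,
    ← pow_add, Nat.add_sub_of_le (Nat.lt_succ_iff.mp p.2)]

theorem mulForm_gradeInv_left (α β : AForm E) :
    mulForm (gradeInv α) β = gradeInv (mulForm α (gradeInv β)) := by
  rw [← mulForm_gradeInv, gradeInv_gradeInv]

theorem alternating_eq_zero_of_finrank_lt [FiniteDimensional ℝ E] {n : ℕ}
    (hn : Module.finrank ℝ E < n) (α : E [⋀^Fin n]→ₗ[ℝ] ℂ) : α = 0 := by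
  ext x
  refine α.map_linearDependent x fun h => ?_
  have := h.fintype_card_le_finrank
  simp at this
  omega

/-- For vectors, the product of degree `N + 1` vanishes and its contraction gives the identity. For
covectors, the factor is moved across the wedge product. In both cases the leftover grading sign is
`(-1) ^ N = 1`. -/
theorem mukai_cl [FiniteDimensional ℝ E] {N : ℕ} (hN : Module.finrank ℝ E = N) (hE : Even N)
    (e : GT E) (α β : AForm E) : mukai N (cl e α) β = -mukai N α (cl e β) := by
  have h1 : mukai N (contr e.1 α) β = -mukai N α (contr e.1 β) := by
    simp only [mukai_eq]
    have h := congrFun (contr_mulForm e.1 α (sigmaInv β)) N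
    rw [contr_apply, alternating_eq_zero_of_finrank_lt (n := N + 1) (by omega)
      (mulForm α (sigmaInv β) (N + 1)), contr_sigmaInv, mulForm_gradeInv, Pi.add_apply,
      gradeInv_apply, hE.neg_one_pow, one_smul, AlternatingMap.curryLeft_zero,
      LinearMap.zero_apply] at h
    exact eq_neg_of_add_eq_zero_left h.symm
  have h2 : mukai N (extMul e.2 α) β = -mukai N α (extMul e.2 β) := by
    simp only [mukai_eq]
    have h := mulForm_extMul_right e.2 α (sigmaInv β)
    rw [← mulForm_extMul_left, extMul_sigmaInv] at h
    have h' := congrFun h N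
    rw [← h', mulForm_gradeInv_left, gradeInv_apply, hE.neg_one_pow, one_smul]
    simp only [← mulFormₗ_apply, map_neg, gradeInv_gradeInv]
    rfl
  have hl : ∀ a b c : AForm E, mukai N (a + b) c = mukai N a c + mukai N b c := by
    intro a b c
    simp only [mukai_eq, ← mulFormₗ_apply, map_add, LinearMap.add_apply, Pi.add_apply]
  have hr : ∀ a b c : AForm E, mukai N a (b + c) = mukai N a b + mukai N a c := by
    intro a b c
    simp only [mukai_eq, ← mulFormₗ_apply, map_add, Pi.add_apply]
  rw [cl_apply, cl_apply, hl, hr, h1, h2]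
  abel

theorem mukai_smul_left (N : ℕ) (c : ℂ) (α β : AForm E) :
    mukai N (c • α) β = c • mukai N α β := by
  simp only [mukai_eq, ← mulFormₗ_apply, map_smul, LinearMap.smul_apply, Pi.smul_apply]

theorem mukai_smul_right (N : ℕ) (c : ℂ) (α β : AForm E) :
    mukai N α (c • β) = c • mukai N α β := by
  simp only [mukai_eq, ← mulFormₗ_apply, map_smul, Pi.smul_apply]

theorem mukai_add_left (N : ℕ) (α β γ : AForm E) :
    mukai N (α + β) γ = mukai N α γ + mukai N β γ := by
  simp only [mukai_eq, ← mulFormₗ_apply, map_add, LinearMap.add_apply, Pi.add_apply]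

theorem mukai_add_right (N : ℕ) (α β γ : AForm E) :
    mukai N α (β + γ) = mukai N α β + mukai N α γ := by
  simp only [mukai_eq, ← mulFormₗ_apply, map_add, Pi.add_apply]

theorem conjForm_apply (α : AForm E) (p : ℕ) (x : Fin p → E) :
    conjForm α p x = (starRingEnd ℂ) (α p x) := rfl

theorem conjForm_add (α β : AForm E) : conjForm (α + β) = conjForm α + conjForm β := by
  funext p; ext x; simp [conjForm_apply]

theorem conjForm_smul (c : ℂ) (α : AForm E) :
    conjForm (c • α) = (starRingEnd ℂ) c • conjForm α := by
  funext p; ext x; simp [conjForm_apply]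

theorem conjForm_cl (e : GT E) (α : AForm E) : conjForm (cl e α) = cl e (conjForm α) := by
  funext p
  ext x
  cases p with
  | zero => simp [conjForm_apply, cl_apply, contr_apply, extMul_zero]
  | succ p =>
    simp [conjForm_apply, cl_apply, contr_apply, extMul_succ,
      AlternatingMap.alternatizeUncurryFin_apply]

theorem forget_injective : Function.Injective (forget : MForm E → AForm E) := by
  intro φ φ' h
  funext p
  exact ContinuousAlternatingMap.toAlternatingMap_injective (congrFun h p)

theorem forget_add (φ φ' : MForm E) : forget (φ + φ') = forget φ + forget φ' := rfl

theorem forget_smul (c : ℂ) (φ : MForm E) : forget (c • φ) = c • forget φ := rfl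

theorem forget_cliff (e : GT E) (φ : MForm E) : forget (cliff e φ) = cl e (forget φ) := by
  funext p
  cases p with
  | zero => ext x; simp [forget, cliff, cl_apply, contr_apply, extMul_zero]
  | succ p =>
    ext x
    simp [forget, cliff, cl_apply, contr_apply, extMul_succ, wedgeOne,
      AlternatingMap.alternatizeUncurryFin_apply,
      ContinuousAlternatingMap.alternatizeUncurryFin_apply]

end Mukai

/-! ### The exponential of a 2-form as a pure spinor. -/

section Exp

variable {E : Type*} [NormedAddCommGroup E] [NormedSpace ℝ E]

/-- The mixed form `1`. -/
def oneForm : AForm E := Pi.single 0 (AlternatingMap.constOfIsEmpty ℝ E (Fin 0) 1)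

/-- A `2`-form as a mixed form. -/
def twoForm (F : E [⋀^Fin 2]→ₗ[ℝ] ℂ) : AForm E := Pi.single 2 F

theorem twoForm_of_ne (F : E [⋀^Fin 2]→ₗ[ℝ] ℂ) {n : ℕ} (hn : n ≠ 2) : twoForm F n = 0 :=
  Pi.single_eq_of_ne hn _

theorem mulForm_twoForm (F : E [⋀^Fin 2]→ₗ[ℝ] ℂ) (α : AForm E) (p : ℕ) :
    mulForm α (twoForm F) (p + 2) = wedge (α p) F := by
  unfold mulForm
  rw [Finset.sum_eq_single (⟨p, by omega⟩ : Fin (p + 2 + 1))]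
  · rw [wedgeTo_congr (α := α) (β := twoForm F) (p' := p) (q' := 2) _ rfl rfl, twoForm,
      Pi.single_eq_same]
    rfl
  · intro q _ hq
    rw [twoForm_of_ne, wedgeTo_zero_right]
    intro h
    apply hq
    ext
    simp
    omega
  · simp

theorem mulForm_twoForm_of_lt (F : E [⋀^Fin 2]→ₗ[ℝ] ℂ) (α : AForm E) {n : ℕ} (hn : n < 2) :
    mulForm α (twoForm F) n = 0 := by
  unfold mulForm
  refine Finset.sum_eq_zero fun q _ => ?_
  rw [twoForm_of_ne F (by omega), wedgeTo_zero_right]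

/-- The recursion that defines `expForm`, rewritten as an Euler identity valid in every degree, odd
degrees and degree zero included. -/
theorem mulForm_twoForm_expForm (F : E [⋀^Fin 2]→ₗ[ℝ] ℂ) (n : ℕ) :
    mulForm (expForm F) (twoForm F) n = ((n : ℂ) / 2) • expForm F n := by
  match n with
  | 0 => rw [mulForm_twoForm_of_lt F _ (by norm_num)]; simp
  | 1 => rw [mulForm_twoForm_of_lt F _ (by norm_num)]; simp [expForm]
  | p + 2 =>
    rw [mulForm_twoForm, expForm]
    have h : ((p : ℂ) + 2) ≠ 0 := by exact_mod_cast Nat.succ_ne_zero (p + 1)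
    ext x
    simp
    field_simp

theorem mulForm_oneForm (α : AForm E) : mulForm α oneForm = α := by
  have hc : ∀ v : E, contr v (oneForm : AForm E) = 0 := by
    intro v
    funext p
    rw [contr_apply, oneForm, Pi.single_eq_of_ne (Nat.succ_ne_zero p)]
    simp
  funext n
  induction n generalizing α with
  | zero =>
    rw [mulForm_zero_apply]
    ext x
    apply mul_left_cancel₀ (factorial_mul_factorial_ne_zero 0 0)
    rw [wedgeTo_apply]
    have hs : ∀ y : Fin 0 → E, y = x := fun y => Subsingleton.elim _ _
    simp [tensorTo_apply, oneForm]
  | succ n ih =>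
    refine succ_ext fun v => ?_
    have h1 := congrFun (contr_mulForm v α oneForm) n
    rw [contr_apply] at h1
    rw [h1, hc, ← mulFormₗ_apply (gradeInv α), map_zero, add_zero, ih]
    rfl

theorem mulForm_twoForm_congr (F : E [⋀^Fin 2]→ₗ[ℝ] ℂ) {α β : AForm E} {n : ℕ}
    (h : ∀ k, k + 2 = n → α k = β k) :
    mulForm α (twoForm F) n = mulForm β (twoForm F) n := by
  match n with
  | 0 => rw [mulForm_twoForm_of_lt F _ (by norm_num), mulForm_twoForm_of_lt F _ (by norm_num)]
  | 1 => rw [mulForm_twoForm_of_lt F _ (by norm_num), mulForm_twoForm_of_lt F _ (by norm_num)]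
  | p + 2 => rw [mulForm_twoForm, mulForm_twoForm, h p rfl]

theorem complexForm_zero_apply (w : Form2 E) (x : Fin 2 → E) :
    complexForm 0 w x = Complex.I * (w x : ℂ) := by
  simp [complexForm]

theorem contr_twoForm (w : Form2 E) (v : E) :
    contr v (twoForm (complexForm 0 w)) = Complex.I • extMul (flat w v) oneForm := by
  funext p
  by_cases hp : p = 1
  · subst hp
    ext x
    rw [contr_apply, twoForm, Pi.single_eq_same, AlternatingMap.curryLeft_apply_apply,
      complexForm_zero_apply, Pi.smul_apply, extMul_succ]
    have : (Matrix.vecCons v x : Fin 2 → E) = ![v, x 0] := by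
      funext i; fin_cases i <;> rfl
    simp [AlternatingMap.alternatizeUncurryFin_apply, flat_apply, oneForm, this]
  · rw [contr_apply, twoForm_of_ne _ (by omega), Pi.smul_apply]
    cases p with
    | zero => simp [extMul_zero]
    | succ p =>
      rw [extMul_succ, oneForm, Pi.single_eq_of_ne (by omega)]
      ext x
      simp [AlternatingMap.alternatizeUncurryFin_apply]

/-- This is i_v e^F = (i_v F) ∧ e^F for F = iω. Contracting e^F ∧ F reduces each degree to the one
two steps lower. -/
theorem contr_expForm (w : Form2 E) (v : E) :
    contr v (expForm (complexForm 0 w)) =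
      Complex.I • extMul (flat w v) (expForm (complexForm 0 w)) := by
  set F := complexForm 0 w with hF
  funext n
  induction n using Nat.strong_induction_on with
  | _ n ih =>
  match n with
  | 0 =>
    rw [contr_apply, Pi.smul_apply, extMul_zero]
    ext x
    simp [expForm]
  | n + 1 =>
    have h1 := congrFun (contr_mulForm v (expForm F) (twoForm F)) (n + 1)
    rw [contr_apply, mulForm_twoForm_expForm, contr_twoForm, Pi.add_apply,
      ← mulFormₗ_apply (gradeInv _), map_smul, mulFormₗ_apply, mulForm_extMul_right,
      mulForm_oneForm, mulForm_twoForm_congr F (β := Complex.I • extMul (flat w v) (expForm F))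
        (fun k hk => ih k (by omega)), ← mulFormₗ_apply, map_smul, LinearMap.smul_apply,
      mulFormₗ_apply, mulForm_extMul_left, Pi.smul_apply,
      extMul_apply_eq_of_forall (β := ((n : ℂ) / 2) • expForm F) (fun k hk => by
        obtain rfl : k = n := by omega
        rw [mulForm_twoForm_expForm, Pi.smul_apply]), map_smul, Pi.smul_apply, Pi.smul_apply] at h1
    have hc : ∀ (c : ℂ) (G : E [⋀^Fin (n + 1 + 1)]→ₗ[ℝ] ℂ),
        (c • G).curryLeft v = c • G.curryLeft v := fun c G => rfl
    rw [hc] at h1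
    have h : ((n : ℂ) + 2) ≠ 0 := by exact_mod_cast Nat.succ_ne_zero (n + 1)
    -- The contraction of the first factor contributes `n / 2` by induction and that of the second
    -- contributes `1`, which together match the coefficient `(n + 2) / 2` on the left.
    have h2 : (((n + 1 + 1 : ℕ) : ℂ) / 2) • contr v (expForm F) (n + 1) =
        (((n + 1 + 1 : ℕ) : ℂ) / 2) • (Complex.I • extMul (flat w v) (expForm F) (n + 1)) := by
      rw [contr_apply, h1, smul_smul, smul_smul, ← add_smul]
      congr 1
      push_cast
      ring
    have h3 : (((n + 1 + 1 : ℕ) : ℂ) / 2) ≠ 0 := by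
      push_cast
      intro h'
      apply h
      linear_combination 2 * h'
    rw [Pi.smul_apply]
    exact smul_right_injective _ h3 h2

/-- The contraction condition determines each component of positive degree from lower ones, so a
spinor of the symplectic structure is fixed by its part of degree zero. -/
theorem eq_expForm (w : Form2 E) {Ψ : AForm E} (h0 : Ψ 0 = expForm (complexForm 0 w) 0)
    (h : ∀ v, contr v Ψ = Complex.I • extMul (flat w v) Ψ) : Ψ = expForm (complexForm 0 w) := by
  funext n
  induction n using Nat.strong_induction_on with
  | _ n ih =>
  cases n with
  | zero => exact h0
  | succ n =>
    refine succ_ext fun v => ?_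
    rw [← contr_apply, ← contr_apply, h, contr_expForm, Pi.smul_apply, Pi.smul_apply,
      extMul_apply_eq_of_forall fun k hk => ih k (by omega)]

end Exp

/-! ### Comparison of e^{iω} with the holomorphic volume form in unitary coordinates. -/

section TwoForm

variable {E : Type*} [NormedAddCommGroup E] [NormedSpace ℝ E]

theorem flat_swap (w : Form2 E) (u v : E) : flat w u v = -flat w v u := by
  rw [flat_apply, flat_apply]
  have h := w.toAlternatingMap.map_swap ![v, u] (i := 0) (j := 1) (by simp)
  have h2 : (![v, u] ∘ (Equiv.swap 0 1) : Fin 2 → E) = ![u, v] := by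
    funext i; fin_cases i <;> simp
  rw [h2] at h
  exact h

theorem flat_self (w : Form2 E) (v : E) : flat w v v = 0 := by
  have := flat_swap w v v
  linarith

/-- Swapping `∂/∂x_k` and `dx_k` for the unitary coordinates turns the holomorphic volume form into
`exp (i w)`. -/
theorem mukai_expForm_of_unitary [FiniteDimensional ℝ E] {m : ℕ}
    (hdim : Module.finrank ℝ E = 2 * m) (w : Form2 E) (f f' : ℕ → E) (dx dy : ℕ → (E →L[ℝ] ℝ))
    (φ : AForm E)
    (hxx : ∀ k l, k < m → l < m → dx k (f l) = if k = l then 1 else 0)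
    (hxy : ∀ k l, k < m → l < m → dx k (f' l) = 0)
    (hyx : ∀ k l, k < m → l < m → dy k (f l) = 0)
    (hyy : ∀ k l, k < m → l < m → dy k (f' l) = if k = l then 1 else 0)
    (hw : ∀ v, flat w v = ∑ k ∈ Finset.range m, (dx k v • dy k - dy k v • dx k))
    (hspan : ∀ v : E, v = ∑ k ∈ Finset.range m, (dx k v • f k + dy k v • f' k))
    (hφ0 : ∀ p < m, φ p = 0) (hφ1 : φ m (fun i => f i) = 1)
    (hφa : ∀ k < m, contr (f k) φ + Complex.I • contr (f' k) φ = 0)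
    (hφb : ∀ k < m, extMul (dx k) φ + Complex.I • extMul (dy k) φ = 0) :
    mukai (2 * m) (expForm (complexForm 0 w)) (conjForm (expForm (complexForm 0 w))) =
      (-1 : ℂ) ^ m • mukai (2 * m) φ (conjForm φ) := by
  -- Successive Clifford multiplication by ∂/∂x_j + dx_j. Each of these elements has square 1 and
  -- acts on T ⊕ T*, up to sign, as a reflection exchanging ∂/∂x_j and dx_j.
  let Ψ : ℕ → AForm E := fun j => Nat.rec φ (fun j a => cl (f j, dx j) a) j
  have hΨ0 : Ψ 0 = φ := rfl
  have hΨ : ∀ j, Ψ (j + 1) = cl (f j, dx j) (Ψ j) := fun j => rfl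
  have hv : ∀ (v : E) (α : AForm E), contr v α = cl (v, 0) α := by
    intro v α
    have : extMul (0 : E →L[ℝ] ℝ) α = 0 := by
      have := congrArg (fun g => g α) (extMul_smul 0 (0 : E →L[ℝ] ℝ))
      simpa using this
    rw [cl_apply, this, add_zero]
  have hξ : ∀ (ξ : E →L[ℝ] ℝ) (α : AForm E), extMul ξ α = cl (0, ξ) α := by
    intro ξ α
    have : contr (0 : E) α = 0 := by
      have := congrArg (fun g => g α) (contr_smul 0 (0 : E))
      simpa using this
    rw [cl_apply, this, zero_add]
  have hcu : ∀ (v : E) (j : ℕ), contr v (Ψ (j + 1)) = (dx j v : ℂ) • Ψ j -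
      cl (f j, dx j) (contr v (Ψ j)) := by
    intro v j
    rw [hΨ, hv, cl_cl, ← hv]
    simp
  have hxu : ∀ (ξ : E →L[ℝ] ℝ) (j : ℕ), extMul ξ (Ψ (j + 1)) = (ξ (f j) : ℂ) • Ψ j -
      cl (f j, dx j) (extMul ξ (Ψ j)) := by
    intro ξ j
    rw [hΨ, hξ, cl_cl, ← hξ]
    simp
  have hI : Complex.I * Complex.I = -1 := Complex.I_mul_I
  -- After `j` reflections the coordinates `k < j` carry annihilators of symplectic type, while the
  -- others still carry those of complex type.
  have key : ∀ j ≤ m, (∀ k < m, j ≤ k → contr (f k) (Ψ j) + Complex.I • contr (f' k) (Ψ j) = 0 ∧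
        extMul (dx k) (Ψ j) + Complex.I • extMul (dy k) (Ψ j) = 0) ∧
      (∀ k < j, contr (f k) (Ψ j) - Complex.I • extMul (dy k) (Ψ j) = 0 ∧
        contr (f' k) (Ψ j) + Complex.I • extMul (dx k) (Ψ j) = 0) := by
    intro j
    induction j with
    | zero => exact fun _ => ⟨fun k hk _ => ⟨hφa k hk, hφb k hk⟩, fun k hk => by omega⟩
    | succ j ih =>
      intro hj
      obtain ⟨ih1, ih2⟩ := ih (by omega)
      refine ⟨fun k hk hjk => ?_, fun k hk => ?_⟩
      · obtain ⟨h1, h2⟩ := ih1 k hk (by omega)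
        rw [hcu, hcu, hxu, hxu, hxx j k (by omega) hk, hxy j k (by omega) hk,
          hxx k j hk (by omega), hyx k j hk (by omega), if_neg (by omega), if_neg (by omega)]
        refine ⟨?_, ?_⟩
        · have := congrArg (cl (f j, dx j)) h1
          rw [map_zero, map_add, map_smul] at this
          simp only [Complex.ofReal_zero, zero_smul, zero_sub, smul_neg]
          rw [← neg_add, this, neg_zero]
        · have := congrArg (cl (f j, dx j)) h2
          rw [map_zero, map_add, map_smul] at this
          simp only [Complex.ofReal_zero, zero_smul, zero_sub, smul_neg]
          rw [← neg_add, this, neg_zero]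
      · by_cases hkj : k = j
        · subst hkj
          obtain ⟨h1, h2⟩ := ih1 k (by omega) le_rfl
          have e1 : extMul (dy k) (Ψ k) = Complex.I • extMul (dx k) (Ψ k) := by
            have h3 := congrArg (fun a => Complex.I • a) h2
            simp only [smul_add, smul_smul, hI, smul_zero, neg_smul, one_smul] at h3
            exact (eq_of_sub_eq_zero (by rw [← h3]; abel)).symm
          have e2 : contr (f' k) (Ψ k) = Complex.I • contr (f k) (Ψ k) := by
            have h3 := congrArg (fun a => Complex.I • a) h1
            simp only [smul_add, smul_smul, hI, smul_zero, neg_smul, one_smul] at h3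
            exact (eq_of_sub_eq_zero (by rw [← h3]; abel)).symm
          have e3 : cl (f k, dx k) (contr (f k) (Ψ k)) + cl (f k, dx k) (extMul (dx k) (Ψ k)) =
              Ψ k := by
            rw [← map_add, ← cl_apply (f k, dx k)]
            have := cl_cl (f k, dx k) (f k, dx k) (Ψ k)
            simp only [hxx k k (by omega) (by omega), if_true] at this
            have h4 : (2 : ℂ) • cl (f k, dx k) (cl (f k, dx k) (Ψ k)) = (2 : ℂ) • Ψ k := by
              rw [two_smul]
              nth_rewrite 1 [this]
              norm_num
            exact smul_right_injective _ two_ne_zero h4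
          rw [hcu, hcu, hxu, hxu, hxx k k (by omega) (by omega), hxy k k (by omega) (by omega),
            hyx k k (by omega) (by omega), if_pos rfl, e1, e2, map_smul, map_smul]
          simp only [Complex.ofReal_zero, zero_smul, zero_sub, Complex.ofReal_one, one_smul,
            smul_neg, smul_smul, hI, neg_neg, neg_smul, one_smul, smul_sub]
          generalize cl (f k, dx k) (contr (f k) (Ψ k)) = A at e3 ⊢
          generalize cl (f k, dx k) (extMul (dx k) (Ψ k)) = B at e3 ⊢
          rw [← e3, smul_add]
          exact ⟨by abel, by abel⟩
        · obtain ⟨h1, h2⟩ := ih2 k (by omega)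
          rw [hcu, hcu, hxu, hxu, hxx j k (by omega) (by omega), hxy j k (by omega) (by omega),
            hxx k j (by omega) (by omega), hyx k j (by omega) (by omega), if_neg (by omega),
            if_neg (by omega)]
          refine ⟨?_, ?_⟩
          · have := congrArg (cl (f j, dx j)) h1
            rw [map_zero, map_sub, map_smul] at this
            simp only [Complex.ofReal_zero, zero_smul, zero_sub, smul_neg, sub_neg_eq_add]
            rw [neg_add_eq_sub, ← neg_sub, this, neg_zero]
          · have := congrArg (cl (f j, dx j)) h2
            rw [map_zero, map_add, map_smul] at this
            simp only [Complex.ofReal_zero, zero_smul, zero_sub, smul_neg]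
            rw [← neg_add, this, neg_zero]
  -- Each reflection lowers the least degree by one and keeps the normalization, so `Ψ m` has part
  -- `1` in degree zero.
  have hdeg : ∀ j n, j + n = m → (∀ p < n, Ψ j p = 0) ∧ Ψ j n (fun i => f (j + i)) = 1 := by
    intro j
    induction j with
    | zero =>
      intro n hn
      obtain rfl : n = m := by omega
      exact ⟨hφ0, by rw [hΨ0]; simpa only [zero_add] using hφ1⟩
    | succ j ih =>
      intro n hn
      obtain ⟨ih1, ih2⟩ := ih (n + 1) (by omega)
      have hz : ∀ p ≤ n, extMul (dx j) (Ψ j) p = 0 := by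
        intro p hp
        rw [extMul_apply_eq_of_forall (β := 0) fun k hk => ih1 k (by omega), map_zero]
        rfl
      refine ⟨fun p hp => ?_, ?_⟩
      · rw [hΨ, cl_apply, Pi.add_apply, hz p hp.le, contr_apply, ih1 (p + 1) (by omega)]
        simp
      · rw [hΨ, cl_apply, Pi.add_apply, hz n le_rfl, contr_apply, add_zero,
          AlternatingMap.curryLeft_apply_apply, ← ih2]
        congr 1
        funext i
        refine Fin.cases ?_ (fun i => ?_) i
        · simp
        · simp only [Matrix.cons_val_succ, Fin.val_succ]
          congr 1
          omega
  have hmain : Ψ m = expForm (complexForm 0 w) := by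
    apply eq_expForm
    · obtain ⟨-, h⟩ := hdeg m 0 rfl
      ext x
      rw [show x = (fun i : Fin 0 => f (m + i)) from Subsingleton.elim _ _, h]
      simp [expForm]
    · intro v
      obtain ⟨-, h⟩ := key m le_rfl
      have hc : ∀ (s : Finset ℕ) (g : ℕ → E), contr (∑ k ∈ s, g k) (Ψ m) =
          ∑ k ∈ s, contr (g k) (Ψ m) := by
        intro s g
        induction s using Finset.induction_on with
        | empty => simpa using congrArg (fun g => g (Ψ m)) (contr_smul 0 (0 : E))
        | insert i s hi ih =>
          rw [Finset.sum_insert hi, Finset.sum_insert hi, contr_add, LinearMap.add_apply, ih]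
      have he : ∀ (s : Finset ℕ) (g : ℕ → (E →L[ℝ] ℝ)), extMul (∑ k ∈ s, g k) (Ψ m) =
          ∑ k ∈ s, extMul (g k) (Ψ m) := by
        intro s g
        induction s using Finset.induction_on with
        | empty => simpa using congrArg (fun g => g (Ψ m)) (extMul_smul 0 (0 : E →L[ℝ] ℝ))
        | insert i s hi ih =>
          rw [Finset.sum_insert hi, Finset.sum_insert hi, extMul_add, LinearMap.add_apply, ih]
      rw [hw v, he]
      conv_lhs => rw [hspan v]
      rw [hc, Finset.smul_sum]
      refine Finset.sum_congr rfl fun k hk => ?_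
      obtain ⟨h1, h2⟩ := h k (Finset.mem_range.mp hk)
      have hs : dx k v • dy k - dy k v • dx k = dx k v • dy k + (-(dy k v)) • dx k := by
        ext u; simp; ring
      rw [hs, contr_add, extMul_add, contr_smul, contr_smul, extMul_smul,
        extMul_smul]
      simp only [LinearMap.add_apply, LinearMap.smul_apply]
      rw [sub_eq_zero.mp h1, eq_neg_of_add_eq_zero_left h2, smul_add, smul_neg, smul_comm,
        smul_comm (Complex.I)]
      simp only [Complex.ofReal_neg, neg_smul, smul_neg]
      rw [smul_comm Complex.I]
  -- The Clifford element is skew for the pairing and has square 1, so each reflection changes the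
  -- sign.
  have hstep : ∀ j ≤ m, mukai (2 * m) (Ψ j) (conjForm (Ψ j)) =
      (-1 : ℂ) ^ j • mukai (2 * m) φ (conjForm φ) := by
    intro j
    induction j with
    | zero => intro _; simp [hΨ0]
    | succ j ih =>
      intro hj
      have := cl_cl (f j, dx j) (f j, dx j) (conjForm (Ψ j))
      simp only [hxx j j (by omega) (by omega), if_true] at this
      have h4 : (2 : ℂ) • cl (f j, dx j) (cl (f j, dx j) (conjForm (Ψ j))) =
          (2 : ℂ) • conjForm (Ψ j) := by
        rw [two_smul]
        nth_rewrite 1 [this]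
        norm_num
      have h5 : cl (f j, dx j) (cl (f j, dx j) (conjForm (Ψ j))) = conjForm (Ψ j) :=
        smul_right_injective _ two_ne_zero h4
      rw [hΨ, conjForm_cl, mukai_cl hdim (even_two_mul m), h5, ih (by omega), pow_succ]
      simp
  rw [← hmain, hstep m le_rfl]

end TwoForm

/-! ### The Hermitian form of a positive (1,1)-form. -/

section HermitianForm

variable {E : Type*} [NormedAddCommGroup E] [NormedSpace ℂ E]

/-- A real `2`-form invariant under `i` and positive on complex lines. -/
structure IsPositive (w : Form2 E) : Prop where
  invariant : ∀ u v : E, w ![Complex.I • u, Complex.I • v] = w ![u, v]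
  pos : ∀ v : E, v ≠ 0 → 0 < w ![v, Complex.I • v]

/-- The sesquilinear form `w(u, i v) - i w(u, v)`. -/
def herm (w : Form2 E) (u v : E) : ℂ :=
  ((flat w u (Complex.I • v) : ℝ) : ℂ) - Complex.I * ((flat w u v : ℝ) : ℂ)

theorem herm_add_left (w : Form2 E) (u u' v : E) : herm w (u + u') v = herm w u v + herm w u' v := by
  simp [herm]; ring

theorem herm_add_right (w : Form2 E) (u v v' : E) : herm w u (v + v') = herm w u v + herm w u v' := by
  simp [herm]; ring

theorem IsPositive.flat_I {w : Form2 E} (hw : IsPositive w) (u v : E) :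
    flat w (Complex.I • u) (Complex.I • v) = flat w u v := by
  rw [flat_apply, flat_apply, hw.invariant]

theorem IsPositive.flat_I_left {w : Form2 E} (hw : IsPositive w) (u v : E) :
    flat w (Complex.I • u) v = -flat w u (Complex.I • v) := by
  rw [← hw.flat_I u (Complex.I • v), smul_smul, Complex.I_mul_I]
  simp

theorem complex_smul_eq (c : ℂ) (v : E) : c • v = c.re • v + c.im • (Complex.I • v) := by
  conv_lhs => rw [← Complex.re_add_im c]
  rw [add_smul, mul_smul, Complex.coe_smul, Complex.coe_smul]

theorem IsPositive.herm_smul_left {w : Form2 E} (hw : IsPositive w) (c : ℂ) (u v : E) :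
    herm w (c • u) v = c * herm w u v := by
  rw [complex_smul_eq]
  apply Complex.ext <;> simp [herm, hw.flat_I, hw.flat_I_left] <;> ring

theorem herm_smul_right (w : Form2 E) (c : ℂ) (u v : E) :
    herm w u (c • v) = (starRingEnd ℂ) c * herm w u v := by
  have hI : Complex.I • Complex.I • v = -v := by rw [smul_smul, Complex.I_mul_I]; simp
  rw [complex_smul_eq]
  apply Complex.ext <;> simp [herm, smul_comm (Complex.I), hI] <;> ring

theorem IsPositive.herm_conj {w : Form2 E} (hw : IsPositive w) (u v : E) :
    (starRingEnd ℂ) (herm w u v) = herm w v u := by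
  have h := flat_swap w v (Complex.I • u)
  rw [hw.flat_I_left, neg_neg] at h
  apply Complex.ext <;> simp [herm, h, flat_swap w v u]

theorem herm_sum_left (w : Form2 E) {ι : Type*} (s : Finset ι) (f : ι → E) (v : E) :
    herm w (∑ i ∈ s, f i) v = ∑ i ∈ s, herm w (f i) v := by
  classical
  induction s using Finset.induction_on with
  | empty => simp [herm]
  | insert i s hi ih => rw [Finset.sum_insert hi, Finset.sum_insert hi, herm_add_left, ih]

theorem herm_sum_right (w : Form2 E) {ι : Type*} (s : Finset ι) (f : ι → E) (v : E) :
    herm w v (∑ i ∈ s, f i) = ∑ i ∈ s, herm w v (f i) := by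
  classical
  induction s using Finset.induction_on with
  | empty => simp [herm]
  | insert i s hi ih => rw [Finset.sum_insert hi, Finset.sum_insert hi, herm_add_right, ih]

end HermitianForm

/-! ### The complex volume form and the determinant of the metric. -/

section Hermitian

variable {E : Type*} [NormedAddCommGroup E] [NormedSpace ℂ E] [FiniteDimensional ℂ E]

variable (E) in
/-- The standard complex volume form on `E`. -/
def volC : E [⋀^Fin (Module.finrank ℂ E)]→L[ℂ] ℂ :=
  { toMultilinearMap := (Module.finBasis ℂ E).det.toMultilinearMap
    cont := by
      change Continuous fun x : Fin (Module.finrank ℂ E) → E => (Module.finBasis ℂ E).det x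
      simp only [Module.Basis.det_apply]
      refine Continuous.matrix_det (continuous_matrix fun i j => ?_)
      have h : Continuous ((Module.finBasis ℂ E).coord i) :=
        LinearMap.continuous_of_finiteDimensional _
      exact h.comp (continuous_apply j)
    map_eq_zero_of_eq' := (Module.finBasis ℂ E).det.map_eq_zero_of_eq' }

variable (E) in
/-- The standard complex volume form on `E` as a mixed form. -/
def volForm : MForm E :=
  Pi.single (Module.finrank ℂ E) ((volC E).restrictScalars ℝ)

theorem volForm_of_ne {p : ℕ} (hp : p ≠ Module.finrank ℂ E) : volForm E p = 0 :=
  Pi.single_eq_of_ne hp _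

theorem volForm_finrank : volForm E (Module.finrank ℂ E) = (volC E).restrictScalars ℝ :=
  Pi.single_eq_same _ _

theorem volC_apply (x : Fin (Module.finrank ℂ E) → E) :
    volC E x = (Module.finBasis ℂ E).det x := rfl

theorem contr_I_volForm (v : E) :
    contr (Complex.I • v) (forget (volForm E)) = Complex.I • contr v (forget (volForm E)) := by
  funext p
  ext x
  simp only [contr_apply, forget, Pi.smul_apply, AlternatingMap.smul_apply,
    AlternatingMap.curryLeft_apply_apply]
  by_cases hp : p + 1 = Module.finrank ℂ E
  · have : ∀ (n : ℕ) (hn : n = Module.finrank ℂ E) (hp : p + 1 = n),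
        volForm E n (fun i => (Matrix.vecCons (Complex.I • v) x : Fin (p + 1) → E)
          (Fin.cast hp.symm i)) = Complex.I • volForm E n
          (fun i => (Matrix.vecCons v x : Fin (p + 1) → E) (Fin.cast hp.symm i)) := by
      intro n hn hp
      subst hn
      rw [volForm_finrank, ContinuousAlternatingMap.coe_restrictScalars]
      have h0 : (fun i => (Matrix.vecCons (Complex.I • v) x : Fin (p + 1) → E)
          (Fin.cast hp.symm i)) = Function.update
          (fun i => (Matrix.vecCons v x : Fin (p + 1) → E) (Fin.cast hp.symm i))
          (Fin.cast hp 0) (Complex.I • v) := by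
        funext i
        obtain ⟨i, rfl⟩ : ∃ i', i = Fin.cast hp i' := ⟨Fin.cast hp.symm i, by simp⟩
        refine Fin.cases ?_ (fun i => ?_) i
        · simp
        · rw [Function.update_of_ne (by simp [Fin.ext_iff])]
          simp
      rw [h0, ContinuousAlternatingMap.map_update_smul]
      congr 2
      funext i
      obtain ⟨i, rfl⟩ : ∃ i', i = Fin.cast hp i' := ⟨Fin.cast hp.symm i, by simp⟩
      refine Fin.cases ?_ (fun i => ?_) i
      · simp
      · rw [Function.update_of_ne (by simp [Fin.ext_iff])]
    exact this (p + 1) hp rfl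
  · rw [volForm_of_ne hp]
    simp

/-- The product of `ζ` with the volume form is complex alternating of degree one above the complex
dimension, hence zero. -/
theorem extMul_volForm (ζ : E →L[ℂ] ℂ) (ξ η : E →L[ℝ] ℝ)
    (h : ∀ v, ζ v = ξ v + Complex.I * η v) :
    extMul ξ (forget (volForm E)) + Complex.I • extMul η (forget (volForm E)) = 0 := by
  funext p
  ext x
  cases p with
  | zero => simp [extMul_zero]
  | succ p =>
    simp only [extMul_succ, forget, Pi.add_apply, Pi.smul_apply, AlternatingMap.add_apply,
      AlternatingMap.smul_apply, AlternatingMap.alternatizeUncurryFin_apply,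
      LinearMap.smulRight_apply, Finset.smul_sum, ← Finset.sum_add_distrib, Pi.zero_apply,
      AlternatingMap.zero_apply]
    by_cases hp : p = Module.finrank ℂ E
    · subst hp
      have h1 : AlternatingMap.alternatizeUncurryFin
          (ζ.toLinearMap.smulRight (volC E).toAlternatingMap) x = 0 := by
        refine AlternatingMap.map_linearDependent _ x fun h => ?_
        have := h.fintype_card_le_finrank
        simp at this
      rw [AlternatingMap.alternatizeUncurryFin_apply] at h1
      rw [← h1]
      refine Finset.sum_congr rfl fun i _ => ?_
      rw [volForm_finrank]
      simp [h]
      ring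
    · rw [volForm_of_ne hp]
      simp

/-- The Hermitian matrix of a real `2`-form in the standard complex basis. -/
def hermMatrix (w : Form2 E) : Matrix (Fin (Module.finrank ℂ E)) (Fin (Module.finrank ℂ E)) ℂ :=
  Matrix.of fun j k => ((w ![Module.finBasis ℂ E j, Complex.I • Module.finBasis ℂ E k] : ℝ) : ℂ) -
    Complex.I * ((w ![Module.finBasis ℂ E j, Module.finBasis ℂ E k] : ℝ) : ℂ)

theorem herm_eq_hermMatrix (w : Form2 E) (j k) :
    herm w (Module.finBasis ℂ E j) (Module.finBasis ℂ E k) = hermMatrix w j k := by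
  simp [herm, hermMatrix, flat_apply]

open scoped ComplexOrder in
theorem IsPositive.posDef {w : Form2 E} (hw : IsPositive w) : (hermMatrix w).PosDef := by
  refine Matrix.PosDef.of_dotProduct_mulVec_pos ?_ fun x hx => ?_
  · ext j k
    rw [Matrix.conjTranspose_apply, ← herm_eq_hermMatrix, ← herm_eq_hermMatrix]
    exact hw.herm_conj _ _
  -- The coefficients are conjugated because `herm` is complex linear in its first argument and
  -- conjugate linear in the second.
  · set v : E := ∑ j, star (x j) • Module.finBasis ℂ E j with hv
    have h1 : dotProduct (star x) (Matrix.mulVec (hermMatrix w) x) = herm w v v := by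
      rw [hv, herm_sum_left]
      simp only [dotProduct, Matrix.mulVec, Finset.mul_sum]
      refine Finset.sum_congr rfl fun j _ => ?_
      rw [herm_sum_right]
      refine Finset.sum_congr rfl fun k _ => ?_
      rw [hw.herm_smul_left, herm_smul_right, herm_eq_hermMatrix]
      simp
      left
      ring
    have hv0 : v ≠ 0 := by
      intro h0
      apply hx
      have := Fintype.linearIndependent_iff.mp (Module.finBasis ℂ E).linearIndependent
        (fun j => star (x j)) h0
      funext j
      simpa using this j
    rw [h1, herm, flat_self, Complex.ofReal_zero, mul_zero, sub_zero]
    exact_mod_cast (flat_apply w v _) ▸ hw.pos v hv0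

-- A positive matrix is B* B; with C the entrywise conjugate of B, the rows of C are the
-- coefficients of a unitary coframe.
open scoped MatrixOrder ComplexOrder in
theorem IsPositive.exists_hermMatrix_eq {w : Form2 E} (hw : IsPositive w) :
    ∃ C : Matrix (Fin (Module.finrank ℂ E)) (Fin (Module.finrank ℂ E)) ℂ,
      hermMatrix w = C.transpose * C.map (starRingEnd ℂ) ∧ C.det ≠ 0 := by
  obtain ⟨B, hB⟩ := CStarAlgebra.nonneg_iff_eq_star_mul_self.mp hw.posDef.posSemidef.nonneg
  refine ⟨B.map (starRingEnd ℂ), ?_, ?_⟩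
  · rw [hB, Matrix.map_map]
    congr 1
    ext i j
    simp
  · intro h
    have hd := hw.posDef.det_pos.ne'
    rw [hB, Matrix.det_mul] at hd
    apply hd
    have : B.det = 0 := by
      have h2 := RingHom.map_det (starRingEnd ℂ) B
      rw [RingHom.mapMatrix_apply, h] at h2
      simpa using h2
    rw [this, mul_zero]

theorem IsPositive.det_re_pos {w : Form2 E} (hw : IsPositive w) :
    0 < (hermMatrix w).det.re ∧ ((hermMatrix w).det.re : ℂ) = (hermMatrix w).det := by
  obtain ⟨C, hC, hC0⟩ := hw.exists_hermMatrix_eq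
  have h : (hermMatrix w).det = (Complex.normSq C.det : ℂ) := by
    rw [hC, Matrix.det_mul, Matrix.det_transpose, ← Complex.mul_conj, RingHom.map_det,
      RingHom.mapMatrix_apply]
  rw [h, Complex.ofReal_re]
  exact ⟨Complex.normSq_pos.mpr hC0, rfl⟩

/-- In a unitary coframe with coefficient matrix C, the product of the dz_l is det C times the
standard volume form. The unitary comparison applies to it, and |det C|² is the determinant of the
metric. -/
theorem IsPositive.mukai_expForm {w : Form2 E} (hw : IsPositive w) :
    mukai (2 * Module.finrank ℂ E) (expForm (complexForm 0 w))
        (conjForm (expForm (complexForm 0 w))) =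
      ((-1 : ℂ) ^ Module.finrank ℂ E * (hermMatrix w).det) •
        mukai (2 * Module.finrank ℂ E) (forget (volForm E)) (conjForm (forget (volForm E))) := by
  obtain ⟨C, hC, hC0⟩ := hw.exists_hermMatrix_eq
  let e := Module.finBasis ℂ E
  have hunit : IsUnit C.det := isUnit_iff_ne_zero.mpr hC0
  -- The unitary coframe; `F` below is the dual frame.
  let ζ : Fin (Module.finrank ℂ E) → (E →L[ℂ] ℂ) := fun l => LinearMap.toContinuousLinearMap (∑ j, C l j • e.coord j)
  have hζ : ∀ l v, ζ l v = ∑ j, C l j * e.repr v j := by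
    intro l v
    simp [ζ]
  let F : Fin (Module.finrank ℂ E) → E := fun l => ∑ j, C⁻¹ j l • e j
  have hF : ∀ l j, e.repr (F l) j = C⁻¹ j l := by
    intro l j
    simp [F, Finsupp.single_apply]
  have hζF : ∀ k l, ζ k (F l) = if k = l then 1 else 0 := by
    intro k l
    rw [hζ, ← Matrix.one_apply, ← Matrix.mul_nonsing_inv C hunit, Matrix.mul_apply]
    simp only [hF]
  have hexp : ∀ v, v = ∑ k, ζ k v • F k := by
    intro v
    apply e.repr.injective
    ext i
    simp only [map_sum, map_smul, Finsupp.coe_finsetSum, Finset.sum_apply, Finsupp.smul_apply, hF,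
      hζ, smul_eq_mul, Finset.sum_mul]
    rw [Finset.sum_comm]
    have : ∀ j, ∑ k, C k j * e.repr v j * C⁻¹ i k = (if i = j then 1 else 0) * e.repr v j := by
      intro j
      rw [← Matrix.one_apply, ← Matrix.nonsing_inv_mul C hunit, Matrix.mul_apply, Finset.sum_mul]
      exact Finset.sum_congr rfl fun k _ => by ring
    simp [this]
  have hherm : ∀ u v, herm w u v = ∑ l, ζ l u * (starRingEnd ℂ) (ζ l v) := by
    intro u v
    conv_lhs => rw [← e.sum_repr u, ← e.sum_repr v]
    rw [herm_sum_left]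
    simp only [herm_sum_right, hw.herm_smul_left, herm_smul_right]
    have : ∀ j k, herm w (e j) (e k) = ∑ l, C l j * (starRingEnd ℂ) (C l k) := by
      intro j k
      rw [herm_eq_hermMatrix, hC, Matrix.mul_apply]
      rfl
    simp only [this, hζ, map_sum, map_mul, Finset.mul_sum, Finset.sum_mul]
    rw [Finset.sum_comm]
    conv_rhs => rw [Finset.sum_comm]
    refine Finset.sum_congr rfl fun k _ => ?_
    rw [Finset.sum_comm]
    refine Finset.sum_congr rfl fun l _ => Finset.sum_congr rfl fun j _ => by ring
  have hflat : ∀ u v, flat w u v = ∑ l, ((ζ l u).re * (ζ l v).im - (ζ l u).im * (ζ l v).re) := by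
    intro u v
    have h := congrArg Complex.im (hherm u v)
    simp only [herm, Complex.sub_im, Complex.ofReal_im, Complex.mul_im, Complex.I_re,
      Complex.I_im, Complex.ofReal_re, Complex.im_sum, Complex.conj_re, Complex.conj_im] at h
    have h2 : flat w u v = -∑ l, ((ζ l u).re * -(ζ l v).im + (ζ l u).im * (ζ l v).re) := by
      rw [← h]; ring
    rw [h2, ← Finset.sum_neg_distrib]
    exact Finset.sum_congr rfl fun l _ => by ring
  let f : ℕ → E := fun n => if h : n < Module.finrank ℂ E then F ⟨n, h⟩ else 0
  let z : ℕ → (E →L[ℂ] ℂ) := fun n => if h : n < Module.finrank ℂ E then ζ ⟨n, h⟩ else 0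
  have hf : ∀ (n : ℕ) (h : n < Module.finrank ℂ E), f n = F ⟨n, h⟩ := fun n h => dif_pos h
  have hz : ∀ (n : ℕ) (h : n < Module.finrank ℂ E), z n = ζ ⟨n, h⟩ := fun n h => dif_pos h
  let dx : ℕ → (E →L[ℝ] ℝ) := fun n => Complex.reCLM.comp ((z n).restrictScalars ℝ)
  let dy : ℕ → (E →L[ℝ] ℝ) := fun n => Complex.imCLM.comp ((z n).restrictScalars ℝ)
  have hdx : ∀ n v, dx n v = (z n v).re := fun n v => rfl
  have hdy : ∀ n v, dy n v = (z n v).im := fun n v => rfl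
  have hzf : ∀ k l, k < Module.finrank ℂ E → l < Module.finrank ℂ E →
      z k (f l) = if k = l then 1 else 0 := by
    intro k l hk hl
    rw [hz k hk, hf l hl, hζF]
    simp
  have key := mukai_expForm_of_unitary (finrank_real_of_complex E) w f (fun n => Complex.I • f n)
    dx dy (C.det • forget (volForm E))
    (fun k l hk hl => by rw [hdx, hzf k l hk hl]; split_ifs <;> simp)
    (fun k l hk hl => by rw [hdx, map_smul, hzf k l hk hl]; split_ifs <;> simp)
    (fun k l hk hl => by rw [hdy, hzf k l hk hl]; split_ifs <;> simp)
    (fun k l hk hl => by rw [hdy, map_smul, hzf k l hk hl]; split_ifs <;> simp)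
    (fun v => by
      ext u
      rw [hflat, Finset.sum_range]
      simp only [FunLike.coe_sum, Finset.sum_apply, sub_apply, smul_apply,
        hdx, hdy, smul_eq_mul]
      exact Finset.sum_congr rfl fun i _ => by rw [hz i i.2])
    (fun v => by
      rw [Finset.sum_range]
      conv_lhs => rw [hexp v]
      refine Finset.sum_congr rfl fun i _ => ?_
      rw [hdx, hdy, hz i i.2, hf i i.2, ← complex_smul_eq])
    (fun p hp => by
      change C.det • forget (volForm E) p = 0
      rw [forget, volForm_of_ne hp.ne]
      exact smul_zero _)
    (by
      change C.det • volForm E (Module.finrank ℂ E) (fun i => f i) = 1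
      rw [volForm_finrank, ContinuousAlternatingMap.coe_restrictScalars, volC_apply,
        Module.Basis.det_apply]
      have : e.toMatrix (fun i : Fin (Module.finrank ℂ E) => f i) = C⁻¹ := by
        ext i j
        rw [Module.Basis.toMatrix_apply, hf j j.2, hF]
      rw [this, smul_eq_mul, ← Matrix.det_mul, Matrix.mul_nonsing_inv C hunit, Matrix.det_one])
    (fun k _ => by
      simp only [map_smul, contr_I_volForm]
      rw [smul_comm, smul_smul Complex.I, Complex.I_mul_I]
      simp)
    (fun k _ => by
      rw [map_smul, map_smul, smul_comm Complex.I, ← smul_add, extMul_volForm (z k), smul_zero]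
      intro v
      rw [hdx, hdy, mul_comm, Complex.re_add_im])
  rw [key, conjForm_smul, mukai_smul_left, mukai_smul_right, smul_smul, smul_smul, hC,
    Matrix.det_mul, Matrix.det_transpose, RingHom.map_det, RingHom.mapMatrix_apply, mul_assoc]

end Hermitian

/-! ### Nilpotent rotations of T ⊕ T* and their action on spinors. -/

section Twist

variable {E : Type*} [NormedAddCommGroup E] [NormedSpace ℝ E]

/-- The operator `1 + t x y` on mixed forms. -/
def twist (t : ℝ) (x y : GT E) : AForm E →ₗ[ℂ] AForm E :=
  LinearMap.id + (t : ℂ) • (cl x).comp (cl y)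

theorem twist_apply (t : ℝ) (x y : GT E) (α : AForm E) :
    twist t x y α = α + (t : ℂ) • cl x (cl y α) := rfl

/-- The vectors `x` and `y` span an isotropic subspace of `T ⊕ T*`. -/
structure IsIsotropicPair (x y : GT E) : Prop where
  left : x.2 x.1 = 0
  right : y.2 y.1 = 0
  mixed : y.2 x.1 + x.2 y.1 = 0

theorem cl_cl_self {x : GT E} (hx : x.2 x.1 = 0) (α : AForm E) : cl x (cl x α) = 0 := by
  have h := cl_cl x x α
  rw [hx, add_zero, Complex.ofReal_zero, zero_smul, zero_sub] at h
  have h2 : (2 : ℂ) • cl x (cl x α) = 0 := by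
    rw [two_smul]
    nth_rewrite 1 [h]
    simp
  simpa using h2

theorem IsIsotropicPair.cl_comm {x y : GT E} (h : IsIsotropicPair x y) (α : AForm E) :
    cl x (cl y α) = -cl y (cl x α) := by
  rw [cl_cl x y α, h.mixed, Complex.ofReal_zero, zero_smul, zero_sub]

/-- For an isotropic pair (xy)² = 0, so 1 + t xy is the spin element exp(t xy); the vector on the
left is the image of `e` under the rotation that it covers. -/
theorem IsIsotropicPair.cl_twist {x y : GT E} (h : IsIsotropicPair x y) (t : ℝ) (e : GT E)
    (α : AForm E) :
    cl (e + t • ((y.2 e.1 + e.2 y.1) • x - (x.2 e.1 + e.2 x.1) • y)) (twist t x y α) =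
      twist t x y (cl e α) := by
  have hx : ∀ β, cl x (cl x β) = 0 := cl_cl_self h.left
  have hy : ∀ β, cl y (cl y β) = 0 := cl_cl_self h.right
  have hyx : ∀ β, cl y (cl x β) = -cl x (cl y β) := fun β => by rw [h.cl_comm, neg_neg]
  have e1 : cl e (cl x (cl y α)) = ((x.2 e.1 + e.2 x.1 : ℝ) : ℂ) • cl y α -
      ((y.2 e.1 + e.2 y.1 : ℝ) : ℂ) • cl x α + cl x (cl y (cl e α)) := by
    rw [cl_cl e x, cl_cl e y, map_sub, map_smul]
    abel
  have hsub : ∀ a b : GT E, cl (a - b) = cl a - cl b := by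
    intro a b
    have := cl_add (a - b) b
    rw [sub_add_cancel] at this
    rw [this, add_sub_cancel_right]
  rw [twist_apply, twist_apply, cl_add, cl_smul, hsub, cl_smul, cl_smul]
  simp only [LinearMap.add_apply, LinearMap.smul_apply, LinearMap.sub_apply, map_add, map_smul, e1,
    hx, hy, hyx, map_zero, smul_zero, neg_zero, smul_add, smul_sub]
  abel

theorem IsIsotropicPair.twist_neg {x y : GT E} (h : IsIsotropicPair x y) (t : ℝ) (α : AForm E) :
    twist (-t) x y (twist t x y α) = α := by
  have hyx : ∀ β, cl y (cl x β) = -cl x (cl y β) := fun β => by rw [h.cl_comm, neg_neg]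
  simp only [twist_apply, map_add, map_smul, hyx, map_neg, cl_cl_self h.left, cl_cl_self h.right]
  simp

/-- The adjoint of xy for the pairing is yx = -xy, so the adjoint of the twist is its inverse. -/
theorem IsIsotropicPair.mukai_twist [FiniteDimensional ℝ E] {x y : GT E} (h : IsIsotropicPair x y)
    {N : ℕ} (hN : Module.finrank ℝ E = N) (hE : Even N) (t : ℝ) (α β : AForm E) :
    mukai N (twist t x y α) (twist t x y β) = mukai N α β := by
  have h1 := h.twist_neg t β
  conv_rhs => rw [← h1]
  generalize twist t x y β = γ
  rw [twist_apply, twist_apply, mukai_add_left, mukai_add_right, mukai_smul_left,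
    mukai_smul_right, mukai_cl hN hE, mukai_cl hN hE, neg_neg, h.cl_comm γ]
  congr 1
  have : ∀ γ : AForm E, mukai N α (-γ) = -mukai N α γ := by
    intro γ
    have := mukai_smul_right N (-1) α γ
    simpa using this
  rw [this]
  simp

theorem conjForm_twist (t : ℝ) (x y : GT E) (α : AForm E) :
    conjForm (twist t x y α) = twist t x y (conjForm α) := by
  rw [twist_apply, twist_apply, conjForm_add, conjForm_smul, conjForm_cl, conjForm_cl,
    Complex.conj_ofReal]

/-- The infinitesimal orthogonal transformation of `T ⊕ T*` given by the Clifford element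
`v₁ v₂ + ξ₁ ξ₂`. -/
def nilMap (v₁ v₂ : E) (ξ₁ ξ₂ : E →L[ℝ] ℝ) : GT E →L[ℝ] GT E :=
  ((((ContinuousLinearMap.apply ℝ ℝ v₂).comp (ContinuousLinearMap.snd ℝ E (E →L[ℝ] ℝ))).smulRight
      v₁) -
    (((ContinuousLinearMap.apply ℝ ℝ v₁).comp (ContinuousLinearMap.snd ℝ E (E →L[ℝ] ℝ))).smulRight
      v₂)).prod
  (((ξ₂.comp (ContinuousLinearMap.fst ℝ E (E →L[ℝ] ℝ))).smulRight ξ₁) -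
    ((ξ₁.comp (ContinuousLinearMap.fst ℝ E (E →L[ℝ] ℝ))).smulRight ξ₂))

theorem nilMap_apply (v₁ v₂ : E) (ξ₁ ξ₂ : E →L[ℝ] ℝ) (e : GT E) :
    nilMap v₁ v₂ ξ₁ ξ₂ e = (e.2 v₂ • v₁ - e.2 v₁ • v₂, ξ₂ e.1 • ξ₁ - ξ₁ e.1 • ξ₂) := rfl

/-- The orthogonal transformation of `T ⊕ T*` given by the spin group element
`exp (t (v₁ v₂ + ξ₁ ξ₂))`. -/
def rot (t : ℝ) (v₁ v₂ : E) (ξ₁ ξ₂ : E →L[ℝ] ℝ) : GT E →L[ℝ] GT E :=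
  ContinuousLinearMap.id ℝ (GT E) + t • nilMap v₁ v₂ ξ₁ ξ₂

theorem rot_apply (t : ℝ) (v₁ v₂ : E) (ξ₁ ξ₂ : E →L[ℝ] ℝ) (e : GT E) :
    rot t v₁ v₂ ξ₁ ξ₂ e = e + t • nilMap v₁ v₂ ξ₁ ξ₂ e := rfl

/-- The vectors `v₁`, `v₂` and the covectors `ξ₁`, `ξ₂` span an isotropic subspace. -/
structure IsIsotropicData (v₁ v₂ : E) (ξ₁ ξ₂ : E →L[ℝ] ℝ) : Prop where
  h11 : ξ₁ v₁ = 0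
  h12 : ξ₁ v₂ = 0
  h21 : ξ₂ v₁ = 0
  h22 : ξ₂ v₂ = 0

variable {v₁ v₂ : E} {ξ₁ ξ₂ : E →L[ℝ] ℝ}

theorem IsIsotropicData.nilMap_nilMap (h : IsIsotropicData v₁ v₂ ξ₁ ξ₂) (e : GT E) :
    nilMap v₁ v₂ ξ₁ ξ₂ (nilMap v₁ v₂ ξ₁ ξ₂ e) = 0 := by
  simp [nilMap_apply, h.h11, h.h12, h.h21, h.h22]

theorem IsIsotropicData.rot_neg (h : IsIsotropicData v₁ v₂ ξ₁ ξ₂) (t : ℝ) (e : GT E) :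
    rot (-t) v₁ v₂ ξ₁ ξ₂ (rot t v₁ v₂ ξ₁ ξ₂ e) = e := by
  simp only [rot_apply, map_add, map_smul, h.nilMap_nilMap]
  simp only [smul_zero, add_zero]
  module

theorem IsIsotropicData.rot_rot_neg (h : IsIsotropicData v₁ v₂ ξ₁ ξ₂) (t : ℝ) (e : GT E) :
    rot t v₁ v₂ ξ₁ ξ₂ (rot (-t) v₁ v₂ ξ₁ ξ₂ e) = e := by
  have := h.rot_neg (-t) e
  rwa [neg_neg] at this

theorem pairing_nilMap (e f : GT E) :
    pairing (nilMap v₁ v₂ ξ₁ ξ₂ e) f = -pairing e (nilMap v₁ v₂ ξ₁ ξ₂ f) := by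
  simp [pairing, nilMap_apply]
  ring

theorem pairing_add_left (a b c : GT E) : pairing (a + b) c = pairing a c + pairing b c := by
  simp [pairing]; ring

theorem pairing_add_right (a b c : GT E) : pairing a (b + c) = pairing a b + pairing a c := by
  simp [pairing]; ring

theorem pairing_smul_left (t : ℝ) (a b : GT E) : pairing (t • a) b = t * pairing a b := by
  simp [pairing]; ring

theorem pairing_smul_right (t : ℝ) (a b : GT E) : pairing a (t • b) = t * pairing a b := by
  simp [pairing]; ring

theorem pairing_neg_left (a b : GT E) : pairing (-a) b = -pairing a b := by
  simp [pairing]; ring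

theorem pairing_comm (a b : GT E) : pairing a b = pairing b a := by
  simp [pairing]; ring

theorem pairing_rot (t : ℝ) (e f : GT E) :
    pairing (rot t v₁ v₂ ξ₁ ξ₂ e) f = pairing e (rot (-t) v₁ v₂ ξ₁ ξ₂ f) := by
  rw [rot_apply, rot_apply, pairing_add_left, pairing_add_right, pairing_smul_left,
    pairing_smul_right, pairing_nilMap]
  ring

variable (v₁ v₂ ξ₁ ξ₂) in
/-- The action of `exp (t (v₁ v₂ + ξ₁ ξ₂))` on mixed forms. -/
def spin (t : ℝ) : AForm E →ₗ[ℂ] AForm E :=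
  (twist t (v₁, 0) (v₂, 0)).comp (twist t (0, ξ₁) (0, ξ₂))

theorem spin_apply (t : ℝ) (α : AForm E) :
    spin v₁ v₂ ξ₁ ξ₂ t α = twist t (v₁, 0) (v₂, 0) (twist t (0, ξ₁) (0, ξ₂) α) := rfl

theorem isIsotropicPair_vectors (v₁ v₂ : E) : IsIsotropicPair ((v₁, 0) : GT E) (v₂, 0) :=
  ⟨by simp, by simp, by simp⟩

theorem isIsotropicPair_covectors (ξ₁ ξ₂ : E →L[ℝ] ℝ) : IsIsotropicPair ((0, ξ₁) : GT E) (0, ξ₂) :=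
  ⟨by simp, by simp, by simp⟩

/-- Isotropy kills the cross term of the vector rotation with the covector rotation, so their
composition is again of the form 1 + tA. -/
theorem IsIsotropicData.cl_spin (h : IsIsotropicData v₁ v₂ ξ₁ ξ₂) (t : ℝ) (e : GT E)
    (α : AForm E) :
    cl (rot t v₁ v₂ ξ₁ ξ₂ e) (spin v₁ v₂ ξ₁ ξ₂ t α) = spin v₁ v₂ ξ₁ ξ₂ t (cl e α) := by
  rw [spin_apply, spin_apply, ← (isIsotropicPair_covectors ξ₁ ξ₂).cl_twist t e α,
    ← (isIsotropicPair_vectors v₁ v₂).cl_twist]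
  congr 2
  ext
  · simp [rot_apply, nilMap_apply, h.h11, h.h12, h.h21, h.h22]
  · simp [rot_apply, nilMap_apply]

theorem spin_injective (t : ℝ) : Function.Injective (spin v₁ v₂ ξ₁ ξ₂ t) := by
  have h1 : Function.Injective (twist t ((v₁, 0) : GT E) (v₂, 0)) :=
    Function.LeftInverse.injective ((isIsotropicPair_vectors v₁ v₂).twist_neg t)
  have h2 : Function.Injective (twist t ((0, ξ₁) : GT E) (0, ξ₂)) :=
    Function.LeftInverse.injective ((isIsotropicPair_covectors ξ₁ ξ₂).twist_neg t)
  exact h1.comp h2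

theorem mukai_spin [FiniteDimensional ℝ E] {N : ℕ} (hN : Module.finrank ℝ E = N) (hE : Even N)
    (t : ℝ) (α : AForm E) :
    mukai N (spin v₁ v₂ ξ₁ ξ₂ t α) (conjForm (spin v₁ v₂ ξ₁ ξ₂ t α)) =
      mukai N α (conjForm α) := by
  rw [spin_apply, conjForm_twist, conjForm_twist, (isIsotropicPair_vectors v₁ v₂).mukai_twist hN hE,
    (isIsotropicPair_covectors ξ₁ ξ₂).mukai_twist hN hE]

variable (v₁ v₂ ξ₁ ξ₂) in
/-- The action of `exp (t (v₁ v₂ + ξ₁ ξ₂))` on continuous mixed forms. -/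
def spinM (t : ℝ) (φ : MForm E) : MForm E :=
  (φ + (t : ℂ) • cliff (0, ξ₁) (cliff (0, ξ₂) φ)) +
    (t : ℂ) • cliff (v₁, 0) (cliff (v₂, 0) (φ + (t : ℂ) • cliff (0, ξ₁) (cliff (0, ξ₂) φ)))

theorem forget_spinM (t : ℝ) (φ : MForm E) :
    forget (spinM v₁ v₂ ξ₁ ξ₂ t φ) = spin v₁ v₂ ξ₁ ξ₂ t (forget φ) := by
  simp only [spinM, spin_apply, twist_apply, forget_add, forget_smul, forget_cliff]

end Twist

/-! ### The deformed complex structure and its canonical line. -/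

section Complex

variable {E : Type*} [NormedAddCommGroup E] [NormedSpace ℂ E]

theorem cplx_apply (v : E) : cplx E v = Complex.I • v := rfl

theorem ofComplex_apply (j : E →L[ℝ] E) (e : GT E) : ofComplex j e = (j e.1, -(e.2.comp j)) := rfl

theorem cplx_cplx (v : E) : cplx E (cplx E v) = -v := by
  rw [cplx_apply, cplx_apply, smul_smul, Complex.I_mul_I]; simp

theorem ofComplex_sq (e : GT E) : ofComplex (cplx E) (ofComplex (cplx E) e) = -e := by
  ext v
  · simp [ofComplex_apply, cplx_cplx]
  · simp [ofComplex_apply, cplx_cplx]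

theorem pairing_ofComplex (e f : GT E) :
    pairing (ofComplex (cplx E) e) (ofComplex (cplx E) f) = pairing e f := by
  simp [pairing, ofComplex_apply, cplx_cplx]

/-- The deformation `e^{tA} J e^{-tA}` of the complex structure, `A = v₁ v₂ + ξ₁ ξ₂`. -/
def deform (t : ℝ) (v₁ v₂ : E) (ξ₁ ξ₂ : E →L[ℝ] ℝ) : GT E →L[ℝ] GT E :=
  (rot t v₁ v₂ ξ₁ ξ₂).comp ((ofComplex (cplx E)).comp (rot (-t) v₁ v₂ ξ₁ ξ₂))

theorem deform_apply (t : ℝ) (v₁ v₂ : E) (ξ₁ ξ₂ : E →L[ℝ] ℝ) (e : GT E) :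
    deform t v₁ v₂ ξ₁ ξ₂ e =
      rot t v₁ v₂ ξ₁ ξ₂ (ofComplex (cplx E) (rot (-t) v₁ v₂ ξ₁ ξ₂ e)) := rfl

theorem deform_zero (v₁ v₂ : E) (ξ₁ ξ₂ : E →L[ℝ] ℝ) :
    deform 0 v₁ v₂ ξ₁ ξ₂ = ofComplex (cplx E) := by
  refine ContinuousLinearMap.ext fun e => ?_
  simp [deform_apply, rot_apply]

variable {v₁ v₂ : E} {ξ₁ ξ₂ : E →L[ℝ] ℝ}

theorem IsIsotropicData.deform_sq (h : IsIsotropicData v₁ v₂ ξ₁ ξ₂) (t : ℝ) (e : GT E) :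
    deform t v₁ v₂ ξ₁ ξ₂ (deform t v₁ v₂ ξ₁ ξ₂ e) = -e := by
  rw [deform_apply, deform_apply, h.rot_neg, ofComplex_sq, map_neg, h.rot_rot_neg]

theorem IsIsotropicData.pairing_deform (h : IsIsotropicData v₁ v₂ ξ₁ ξ₂) (t : ℝ) (e f : GT E) :
    pairing (deform t v₁ v₂ ξ₁ ξ₂ e) (deform t v₁ v₂ ξ₁ ξ₂ f) = pairing e f := by
  rw [deform_apply, deform_apply, pairing_rot, h.rot_neg, pairing_ofComplex, pairing_rot,
    neg_neg, h.rot_rot_neg]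

theorem IsIsotropicData.memE_deform (h : IsIsotropicData v₁ v₂ ξ₁ ξ₂) (t : ℝ) (a b : GT E) :
    MemE (deform t v₁ v₂ ξ₁ ξ₂) a b ↔
      MemE (ofComplex (cplx E)) (rot (-t) v₁ v₂ ξ₁ ξ₂ a) (rot (-t) v₁ v₂ ξ₁ ξ₂ b) := by
  have hinj : Function.Injective (rot (-t) v₁ v₂ ξ₁ ξ₂) :=
    Function.LeftInverse.injective (h.rot_rot_neg t)
  have key : ∀ a b, deform t v₁ v₂ ξ₁ ξ₂ a = b ↔
      ofComplex (cplx E) (rot (-t) v₁ v₂ ξ₁ ξ₂ a) = rot (-t) v₁ v₂ ξ₁ ξ₂ b := by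
    intro a b
    rw [deform_apply, ← hinj.eq_iff, h.rot_neg]
  unfold MemE
  rw [key, key, map_neg]

variable [FiniteDimensional ℂ E]

theorem forget_volForm_ne_zero : forget (volForm E) ≠ 0 := by
  intro h
  have h1 := congrArg (fun g => g (Module.finBasis ℂ E)) (congrFun h (Module.finrank ℂ E))
  have h2 : volForm E (Module.finrank ℂ E) (Module.finBasis ℂ E) = 0 := h1
  rw [volForm_finrank, ContinuousAlternatingMap.coe_restrictScalars, volC_apply,
    Module.Basis.det_self] at h2
  exact one_ne_zero h2

/-- Contractions of the volume form have degree n - 1 and exterior products degree n + 1, so the two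
parts vanish separately. The first says that the complexified vector is of type (0,1), the second
that the covector is of type (1,0). -/
theorem cl_volForm_eq_zero_iff (a b : GT E) :
    cl a (forget (volForm E)) + Complex.I • cl b (forget (volForm E)) = 0 ↔
      MemE (ofComplex (cplx E)) a b := by
  set ν := forget (volForm E) with hν
  have hν0 : ν ≠ 0 := forget_volForm_ne_zero
  have hνp : ∀ p, p ≠ Module.finrank ℂ E → ν p = 0 := by
    intro p hp
    rw [hν, forget, volForm_of_ne hp]
    rfl
  constructor
  · intro h
    have hsplit : ∀ p, contr a.1 ν p + Complex.I • contr b.1 ν p +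
        (extMul a.2 ν p + Complex.I • extMul b.2 ν p) = 0 := by
      intro p
      have := congrFun h p
      simp only [cl_apply, Pi.add_apply, Pi.smul_apply, smul_add, Pi.zero_apply] at this
      rw [← this]
      abel
    have hc : contr a.1 ν + Complex.I • contr b.1 ν = 0 := by
      funext p
      by_cases hp : p + 1 = Module.finrank ℂ E
      · have h1 := hsplit p
        have h2 : ∀ ξ : E →L[ℝ] ℝ, extMul ξ ν p = 0 := by
          intro ξ
          rw [extMul_apply_eq_of_forall (β := 0) fun k hk => hνp k (by omega), map_zero]
          rfl
        rw [h2, h2, smul_zero, add_zero, add_zero] at h1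
        exact h1
      · simp only [Pi.add_apply, Pi.smul_apply, contr_apply, hνp (p + 1) hp, Pi.zero_apply]
        simp
    have he : extMul a.2 ν + Complex.I • extMul b.2 ν = 0 := by
      have := h
      simp only [cl_apply, smul_add] at this
      rw [← this]
      have h3 : contr a.1 ν + extMul a.2 ν + (Complex.I • contr b.1 ν + Complex.I • extMul b.2 ν)
        = contr a.1 ν + Complex.I • contr b.1 ν + (extMul a.2 ν + Complex.I • extMul b.2 ν) := by
        abel
      rw [h3, hc, zero_add]
    have hscal : ∀ {c : ℂ}, c • ν = 0 → c = 0 := fun hcν =>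
      (smul_eq_zero.mp hcν).resolve_right hν0
    -- If `c` contracts the volume form to zero, then contracting ζ ∧ vol = 0 by `c` gives ζ(c) vol
    -- = 0 for every complex coordinate ζ.
    have h1 : a.1 + Complex.I • b.1 = 0 := by
      have hc' : contr (a.1 + Complex.I • b.1) ν = 0 := by
        rw [contr_add, LinearMap.add_apply, hν, contr_I_volForm, ← hν, hc]
      apply (Module.finBasis ℂ E).repr.injective
      ext i
      set ζ : E →L[ℂ] ℂ := LinearMap.toContinuousLinearMap ((Module.finBasis ℂ E).coord i)
      set c := a.1 + Complex.I • b.1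
      have h4 := extMul_volForm ζ (Complex.reCLM.comp (ζ.restrictScalars ℝ))
        (Complex.imCLM.comp (ζ.restrictScalars ℝ)) (fun v => by
          simp only [ContinuousLinearMap.comp_apply, Complex.reCLM_apply, Complex.imCLM_apply,
            ContinuousLinearMap.coe_restrictScalars']
          rw [mul_comm, Complex.re_add_im])
      have h5 := congrArg (contr c) h4
      rw [map_add, map_smul, contr_extMul, contr_extMul, ← hν, hc', map_zero, map_zero, sub_zero,
        sub_zero, smul_smul, ← add_smul, map_zero] at h5
      have h6 := hscal h5
      have h7 : ζ c = 0 := by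
        rw [← h6]
        simp only [ContinuousLinearMap.comp_apply, Complex.reCLM_apply, Complex.imCLM_apply,
            ContinuousLinearMap.coe_restrictScalars']
        rw [mul_comm, Complex.re_add_im]
      rw [map_zero]
      exact h7
    have h2 : ∀ x, ((a.2 (Complex.I • x) : ℝ) : ℂ) + Complex.I * (b.2 (Complex.I • x) : ℝ) =
        Complex.I * ((a.2 x : ℝ) + Complex.I * (b.2 x : ℝ)) := by
      -- Contracting the covector condition recovers the complex covector as a coefficient of the
      -- volume form; comparing `x` with `i x` shows that it is complex linear.
      have h8 : ∀ x, extMul a.2 (contr x ν) + Complex.I • extMul b.2 (contr x ν) =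
          (((a.2 x : ℝ) : ℂ) + Complex.I * (b.2 x : ℝ)) • ν := by
        intro x
        have h9 := congrArg (contr x) he
        rw [map_add, map_smul, contr_extMul, contr_extMul, map_zero] at h9
        rw [← sub_eq_zero, ← neg_eq_zero, ← h9, smul_sub, add_smul, mul_smul]
        abel
      intro x
      have h10 := h8 (Complex.I • x)
      rw [hν, contr_I_volForm, ← hν, map_smul, map_smul, smul_comm, ← smul_add, h8 x, smul_smul,
        ← sub_eq_zero, ← sub_smul] at h10
      have := hscal h10
      rw [sub_eq_zero] at this
      rw [this]
    have h3 : b.1 = Complex.I • a.1 := by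
      have := congrArg (fun v => Complex.I • v) h1
      simp only [smul_add, smul_smul, Complex.I_mul_I, neg_smul, one_smul, smul_zero] at this
      exact (sub_eq_zero.mp (by rw [sub_eq_add_neg]; exact this)).symm
    have h4 : ∀ x, b.2 x = -a.2 (Complex.I • x) := by
      intro x
      have := congrArg Complex.re (h2 x)
      simp at this
      linarith
    have h5 : ofComplex (cplx E) a = b := by
      ext x
      · simp [ofComplex_apply, cplx_apply, h3]
      · simp [ofComplex_apply, cplx_apply, h4]
    exact ⟨h5, by rw [← h5, ofComplex_sq]⟩
  · rintro ⟨rfl, -⟩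
    simp only [cl_apply, ofComplex_apply, cplx_apply]
    rw [hν, contr_I_volForm, ← hν, smul_add, smul_smul, Complex.I_mul_I]
    have := extMul_volForm (StrongDual.extendRCLike a.2) a.2 (-(a.2.comp (cplx E))) (by
      intro v
      simp [StrongDual.extendRCLike_apply, cplx_apply]
      ring)
    rw [← hν] at this
    rw [← this]
    simp
    abel

end Complex

/-! ### The symplectic structure on T ⊕ T* commutes with the rotation. -/

section SymplecticLinear

variable {E : Type*} [NormedAddCommGroup E] [NormedSpace ℝ E]

theorem ofSymplectic_apply (w : Form2 E) (e : GT E) :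
    ofSymplectic w e = (-((flat w).inverse e.2), flat w e.1) := rfl

theorem flat_zero : flat (0 : Form2 E) = 0 := by
  ext u v
  simp [flat_apply]

theorem bField_zero : bField (0 : Form2 E) = ContinuousLinearMap.id ℝ (GT E) := by
  refine ContinuousLinearMap.ext fun e => ?_
  simp [bField, flat_zero]

theorem bField_apply (B : Form2 E) (e : GT E) : bField B e = (e.1, e.2 - flat B e.1) := rfl

theorem ofSpinor_zero (w : Form2 E) : ofSpinor 0 w = ofSymplectic w := by
  simp [ofSpinor, bField_zero, ContinuousLinearMap.id_comp, ContinuousLinearMap.comp_id]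

/-- The isomorphism `v ↦ i_v w` of a nondegenerate form. -/
def flatEquiv [FiniteDimensional ℝ E] (w : Form2 E) (hw : ∀ v, flat w v = 0 → v = 0) :
    E ≃L[ℝ] (E →L[ℝ] ℝ) :=
  LinearEquiv.toContinuousLinearEquiv
    (LinearEquiv.ofInjectiveOfFinrankEq (flat w).toLinearMap
      (by
        rw [← LinearMap.ker_eq_bot, LinearMap.ker_eq_bot']
        exact hw)
      (by
        rw [← (LinearMap.toContinuousLinearMap (𝕜 := ℝ) (E := E) (F' := ℝ)).finrank_eq]
        exact (Subspace.dual_finrank_eq).symm))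

theorem coe_flatEquiv [FiniteDimensional ℝ E] (w : Form2 E) (hw : ∀ v, flat w v = 0 → v = 0) :
    (flatEquiv w hw : E →L[ℝ] (E →L[ℝ] ℝ)) = flat w := by
  ext u v
  rfl

theorem inverse_flat_flat [FiniteDimensional ℝ E] {w : Form2 E} (hw : ∀ v, flat w v = 0 → v = 0)
    (v : E) : (flat w).inverse (flat w v) = v := by
  rw [← coe_flatEquiv w hw, ContinuousLinearMap.inverse_equiv]
  simp

theorem flat_inverse_flat [FiniteDimensional ℝ E] {w : Form2 E} (hw : ∀ v, flat w v = 0 → v = 0)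
    (ξ : E →L[ℝ] ℝ) : flat w ((flat w).inverse ξ) = ξ := by
  rw [← coe_flatEquiv w hw, ContinuousLinearMap.inverse_equiv]
  simp

variable [FiniteDimensional ℝ E] {w : Form2 E} (hw : ∀ v, flat w v = 0 → v = 0)

theorem ofSymplectic_sq (hw : ∀ v, flat w v = 0 → v = 0) (e : GT E) :
    ofSymplectic w (ofSymplectic w e) = -e := by
  rw [ofSymplectic_apply, ofSymplectic_apply]
  simp only [inverse_flat_flat hw, map_neg, flat_inverse_flat hw]
  rfl

theorem pairing_ofSymplectic (hw : ∀ v, flat w v = 0 → v = 0) (e f : GT E) :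
    pairing (ofSymplectic w e) (ofSymplectic w f) = pairing e f := by
  have key : ∀ (v : E) (ξ : E →L[ℝ] ℝ), flat w v ((flat w).inverse ξ) = -ξ v := by
    intro v ξ
    rw [flat_swap, flat_inverse_flat hw]
  simp only [pairing, ofSymplectic_apply, map_neg, key]
  ring

/-- The symplectic structure exchanges `v` with `flat w v` up to sign, and so interchanges the
bivector half and the 2-form half of the rotation. This is why the 2-form ξ₁ ∧ ξ₂ is added to the
bivector. -/
theorem nilMap_ofSymplectic (hw : ∀ v, flat w v = 0 → v = 0) (v₁ v₂ : E) (e : GT E) :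
    nilMap v₁ v₂ (flat w v₁) (flat w v₂) (ofSymplectic w e) =
      ofSymplectic w (nilMap v₁ v₂ (flat w v₁) (flat w v₂) e) := by
  have key : ∀ (v : E) (ξ : E →L[ℝ] ℝ), flat w v ((flat w).inverse ξ) = -ξ v := by
    intro v ξ
    rw [flat_swap, flat_inverse_flat hw]
  rw [nilMap_apply, nilMap_apply, ofSymplectic_apply, ofSymplectic_apply]
  simp only [map_neg, key, neg_neg, map_sub, map_smul, inverse_flat_flat hw]
  refine Prod.ext ?_ rfl
  simp only [flat_swap w e.1]
  module

theorem rot_ofSymplectic (hw : ∀ v, flat w v = 0 → v = 0) (t : ℝ) (v₁ v₂ : E) (e : GT E) :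
    rot t v₁ v₂ (flat w v₁) (flat w v₂) (ofSymplectic w e) =
      ofSymplectic w (rot t v₁ v₂ (flat w v₁) (flat w v₂) e) := by
  rw [rot_apply, rot_apply, nilMap_ofSymplectic hw, map_add, map_smul]

end SymplecticLinear

/-! ### Positivity, the obstruction to being ordinary, and the spinor of the deformation. -/

section HermitianLinear

variable {E : Type*} [NormedAddCommGroup E] [NormedSpace ℂ E]

theorem IsPositive.flat_injective {w : Form2 E} (hw : IsPositive w) (v : E) (hv : flat w v = 0) :
    v = 0 := by
  by_contra h
  have := hw.pos v h
  rw [← flat_apply, hv] at this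
  simp at this

variable [FiniteDimensional ℂ E] {w : Form2 E}

theorem IsPositive.ofComplex_ofSymplectic (hw : IsPositive w) (e : GT E) :
    ofComplex (cplx E) (ofSymplectic w e) = ofSymplectic w (ofComplex (cplx E) e) := by
  have : FiniteDimensional ℝ E := FiniteDimensional.complexToReal E
  have hI : ∀ v : E, flat w (Complex.I • v) = -((flat w v).comp (cplx E)) := by
    intro v
    ext u
    rw [hw.flat_I_left]
    rfl
  simp only [ofComplex_apply, ofSymplectic_apply, map_neg, neg_neg, cplx_apply]
  refine Prod.ext ?_ ?_
  · have : flat w (Complex.I • (flat w).inverse e.2) =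
        flat w (-(flat w).inverse (e.2.comp (cplx E))) := by
      rw [hI, map_neg, flat_inverse_flat hw.flat_injective, flat_inverse_flat hw.flat_injective]
    have h2 : Complex.I • (flat w).inverse e.2 + (flat w).inverse (e.2.comp (cplx E)) = 0 := by
      apply hw.flat_injective
      rw [map_add, this, map_neg, neg_add_cancel]
    exact neg_eq_of_add_eq_zero_right h2
  · simp only [hI]

theorem IsPositive.deform_ofSymplectic (hw : IsPositive w) (t : ℝ) (v₁ v₂ : E) (e : GT E) :
    deform t v₁ v₂ (flat w v₁) (flat w v₂) (ofSymplectic w e) =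
      ofSymplectic w (deform t v₁ v₂ (flat w v₁) (flat w v₂) e) := by
  have : FiniteDimensional ℝ E := FiniteDimensional.complexToReal E
  rw [deform_apply, deform_apply, rot_ofSymplectic hw.flat_injective, hw.ofComplex_ofSymplectic,
    rot_ofSymplectic hw.flat_injective]

/-- With the covector written as i_z ω, the pairing is minus half the sum of the squared metric
lengths of the vector part and of z. -/
theorem IsPositive.pairing_ofComplex_ofSymplectic_neg (hw : IsPositive w) {u : GT E} (hu : u ≠ 0) :
    pairing (ofComplex (cplx E) (ofSymplectic w u)) u < 0 := by
  have : FiniteDimensional ℝ E := FiniteDimensional.complexToReal E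
  obtain ⟨z, hz⟩ : ∃ z, u.2 = flat w z := ⟨_, (flat_inverse_flat hw.flat_injective u.2).symm⟩
  have hval : pairing (ofComplex (cplx E) (ofSymplectic w u)) u =
      -(1 / 2) * (flat w u.1 (Complex.I • u.1) + flat w z (Complex.I • z)) := by
    simp only [pairing, ofComplex_apply, ofSymplectic_apply, hz, inverse_flat_flat hw.flat_injective]
    simp only [map_neg, cplx_apply, neg_apply, ContinuousLinearMap.comp_apply]
    ring
  have hnn : ∀ v : E, 0 ≤ flat w v (Complex.I • v) := by
    intro v
    by_cases h : v = 0
    · simp [h]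
    · rw [flat_apply]; exact (hw.pos v h).le
  have h1 := hnn u.1
  have h2 := hnn z
  rw [hval]
  by_cases h : u.1 = 0
  · have hz0 : z ≠ 0 := by
      rintro rfl
      apply hu
      exact Prod.ext h (by rw [hz, map_zero]; rfl)
    have h3 := hw.pos z hz0
    rw [← flat_apply] at h3
    linarith
  · have h3 := hw.pos u.1 h
    rw [← flat_apply] at h3
    linarith

theorem IsPositive.pairing_deform_ofSymplectic_pos (hw : IsPositive w) {v₁ v₂ : E}
    (h : IsIsotropicData v₁ v₂ (flat w v₁) (flat w v₂)) (t : ℝ) {u : GT E} (hu : u ≠ 0) :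
    0 < pairing (-(deform t v₁ v₂ (flat w v₁) (flat w v₂) (ofSymplectic w u))) u := by
  have : FiniteDimensional ℝ E := FiniteDimensional.complexToReal E
  rw [pairing_neg_left, deform_apply, pairing_rot, rot_ofSymplectic hw.flat_injective]
  have hu' : rot (-t) v₁ v₂ (flat w v₁) (flat w v₂) u ≠ 0 := by
    intro h0
    apply hu
    rw [← h.rot_rot_neg t u, h0, map_zero]
  have := hw.pairing_ofComplex_ofSymplectic_neg hu'
  linarith

/-- Applying i_{v₁}ω to the vector part of the image of `(0, ξ)` removes the terms along v₁ and v₂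
and keeps those along i v₁ and i v₂. The resulting scalar relation holds for every `ξ`, hence gives
a relation between v₁ and v₂. -/
theorem smul_eq_smul_of_deform {E : Type*} [NormedAddCommGroup E] [NormedSpace ℂ E]
    {w : Form2 E} {v₁ v₂ : E} (h12 : flat w v₁ v₂ = 0) {t : ℝ} (ht : t ≠ 0) {ξ₁ ξ₂ : E →L[ℝ] ℝ}
    (h : ∀ ξ, (deform t v₁ v₂ ξ₁ ξ₂ (0, ξ)).1 = 0) :
    flat w v₁ (Complex.I • v₁) • v₂ = flat w v₁ (Complex.I • v₂) • v₁ := by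
  have key : ∀ ξ : E →L[ℝ] ℝ, ξ v₂ * flat w v₁ (Complex.I • v₁) =
      ξ v₁ * flat w v₁ (Complex.I • v₂) := by
    intro ξ
    have h1 := h ξ
    have h2 := congrArg (flat w v₁) h1
    simp only [deform_apply, rot_apply, nilMap_apply, ofComplex_apply, cplx_apply] at h2
    simp [cplx_apply, h12, flat_self] at h2
    rw [smul_comm Complex.I t, smul_sub, smul_comm Complex.I (ξ v₂), smul_comm Complex.I (ξ v₁)] at h2
    simp only [map_sub, map_smul, smul_eq_mul] at h2
    have h3 := (mul_eq_zero.mp h2).resolve_left ht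
    linarith
  by_contra hne
  rw [← ne_eq, ← sub_ne_zero] at hne
  obtain ⟨ξ, hξ⟩ := SeparatingDual.exists_ne_zero (R := ℝ) hne
  apply hξ
  have h5 := key ξ
  simp only [map_sub, map_smul, smul_eq_mul]
  linarith

/-- The spin element intertwines Clifford multiplication by `e` and by its rotation, so the
annihilator of the volume form is rotated into the eigenspace of the deformed structure. -/
theorem IsIsotropicData.isSpinorOf_deform {v₁ v₂ : E} {ξ₁ ξ₂ : E →L[ℝ] ℝ}
    (h : IsIsotropicData v₁ v₂ ξ₁ ξ₂) (t : ℝ) :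
    IsSpinorOf (deform t v₁ v₂ ξ₁ ξ₂) (spinM v₁ v₂ ξ₁ ξ₂ t (volForm E)) := by
  intro a b
  rw [h.memE_deform, ← cl_volForm_eq_zero_iff, ← (spin_injective (v₁ := v₁) (v₂ := v₂) (ξ₁ := ξ₁)
    (ξ₂ := ξ₂) t).eq_iff, map_zero, map_add, map_smul, ← h.cl_spin, ← h.cl_spin, h.rot_rot_neg,
    h.rot_rot_neg, ← forget_spinM, ← forget_cliff, ← forget_cliff, ← forget_smul, ← forget_add]
  constructor
  · intro h0
    rw [h0]
    rfl
  · intro h0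
    exact forget_injective h0

end HermitianLinear

/-! ### Involutivity as a condition on 1-jets, and closed B-fields. -/

section Jets

variable {E : Type*} [NormedAddCommGroup E] [NormedSpace ℝ E]

/-- The pairing with a fixed element, as a linear form. -/
def pairingL (c : GT E) : GT E →L[ℝ] ℝ :=
  (1 / 2 : ℝ) • ((ContinuousLinearMap.apply ℝ ℝ c.1).comp (ContinuousLinearMap.snd ℝ E (E →L[ℝ] ℝ)) +
    c.2.comp (ContinuousLinearMap.fst ℝ E (E →L[ℝ] ℝ)))

theorem pairingL_apply (c a : GT E) : pairingL c a = pairing a c := by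
  simp [pairingL, pairing]
  ring

/-- The Courant bracket of two sections at a point, in terms of their values `a`, `c` and
derivatives `A`, `C` there. -/
def jetBracket (a : GT E) (A : E →L[ℝ] GT E) (c : GT E) (C : E →L[ℝ] GT E) : GT E :=
  C a.1 - A c.1 + (0, (pairingL c).comp A - (pairingL a).comp C)

theorem courant_eq_jetBracket {a c : E → GT E} {A C : E →L[ℝ] GT E} {z : E}
    (ha : HasFDerivAt a A z) (hc : HasFDerivAt c C z) :
    courant a c z = jetBracket (a z) A (c z) C := by
  have ha1 := (hasFDerivAt_fst.comp z ha)
  have ha2 := (hasFDerivAt_snd.comp z ha)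
  have hc1 := (hasFDerivAt_fst.comp z hc)
  have hc2 := (hasFDerivAt_snd.comp z hc)
  have e := (hc2.clm_apply ha1).sub (ha2.clm_apply hc1)
  have e1 : fderiv ℝ (fun z => (a z).1) z = (ContinuousLinearMap.fst ℝ E (E →L[ℝ] ℝ)).comp A :=
    ha1.fderiv
  have e2 : fderiv ℝ (fun z => (a z).2) z = (ContinuousLinearMap.snd ℝ E (E →L[ℝ] ℝ)).comp A :=
    ha2.fderiv
  have e3 : fderiv ℝ (fun z => (c z).1) z = (ContinuousLinearMap.fst ℝ E (E →L[ℝ] ℝ)).comp C :=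
    hc1.fderiv
  have e4 : fderiv ℝ (fun z => (c z).2) z = (ContinuousLinearMap.snd ℝ E (E →L[ℝ] ℝ)).comp C :=
    hc2.fderiv
  have e5 : fderiv ℝ (fun z => (c z).2 (a z).1 - (a z).2 (c z).1) z = _ := e.fderiv
  unfold courant jetBracket lieOne
  rw [e5, VectorField.lieBracket, e1, e2, e3, e4]
  refine Prod.ext ?_ ?_
  · simp
  · ext x
    simp [pairingL_apply, pairing]
    ring

/-- The Nijenhuis condition on an endomorphism field with value `K` and derivative `K'` at a
point. -/
def NijenhuisAt (K : GT E →L[ℝ] GT E) (K' : E →L[ℝ] GT E →L[ℝ] GT E) : Prop :=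
  ∀ a c : GT E, K' a.1 c - K' c.1 a + (0, (pairingL c).comp (K'.flip a) - (pairingL a).comp (K'.flip c)) =
    K (K' (K c).1 a - K' (K a).1 c +
      (0, (pairingL (K a)).comp (K'.flip c) - (pairingL (K c)).comp (K'.flip a)))

/-- The derivatives `A`, `C` of the sections drop out by K² = -1 and skewness of K; the rest
involves only the derivative of K and is the Nijenhuis condition. -/
theorem NijenhuisAt.jetBracket_eq {K : GT E →L[ℝ] GT E} {K' : E →L[ℝ] GT E →L[ℝ] GT E}
    (hN : NijenhuisAt K K') (hsq : ∀ u, K (K u) = -u)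
    (horth : ∀ u v, pairing (K u) (K v) = pairing u v) (a c : GT E) (A C : E →L[ℝ] GT E) :
    K (jetBracket a A c C - jetBracket (K a) (K'.flip a + K.comp A) (K c) (K'.flip c + K.comp C)) =
      jetBracket a A (K c) (K'.flip c + K.comp C) + jetBracket (K a) (K'.flip a + K.comp A) c C := by
  have hskew : ∀ u v, pairing (K u) v = -pairing u (K v) := by
    intro u v
    rw [← horth u (K v), hsq, pairing_comm _ (-v), pairing_neg_left, pairing_comm, neg_neg]
  have h := hN a c
  have e1 : jetBracket a A c C - jetBracket (K a) (K'.flip a + K.comp A) (K c) (K'.flip c + K.comp C)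
      = (C a.1 - A c.1 - K (C (K a).1) + K (A (K c).1)) + (K' (K c).1 a - K' (K a).1 c +
      (0, (pairingL (K a)).comp (K'.flip c) - (pairingL (K c)).comp (K'.flip a))) := by
    unfold jetBracket
    refine Prod.ext ?_ ?_
    · simp
      abel
    · ext x
      simp [pairingL_apply, horth]
      ring
  have e2 : jetBracket a A (K c) (K'.flip c + K.comp C) + jetBracket (K a) (K'.flip a + K.comp A) c C
      = (K (C a.1) - K (A c.1) + C (K a).1 - A (K c).1) + (K' a.1 c - K' c.1 a +
        (0, (pairingL c).comp (K'.flip a) - (pairingL a).comp (K'.flip c))) := by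
    unfold jetBracket
    refine Prod.ext ?_ ?_
    · simp
      abel
    · ext x
      simp [pairingL_apply, hskew]
      ring
  rw [e1, e2, h, map_add]
  congr 1
  simp only [map_add, map_sub, hsq]
  abel

/-- In a section `a + i b` of the eigenbundle, b = K a on an open set, so the jet of `b` is given by
those of `a` and K. Involutivity becomes a pointwise identity. -/
theorem involutive_of_nijenhuisAt {K : E → (GT E →L[ℝ] GT E)} {U : Set E}
    (hK : ∀ z ∈ U, ∃ K', HasFDerivAt K K' z ∧ NijenhuisAt (K z) K')
    (hsq : ∀ z ∈ U, ∀ u, K z (K z u) = -u)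
    (horth : ∀ z ∈ U, ∀ u v, pairing (K z u) (K z v) = pairing u v) : Involutive K U := by
  intro W hW hWU a b c d ha hb hc hd hab hcd z hz
  have hda := (((ha.contDiffAt (hW.mem_nhds hz)).differentiableAt (by simp))).hasFDerivAt
  have hdc := (((hc.contDiffAt (hW.mem_nhds hz)).differentiableAt (by simp))).hasFDerivAt
  obtain ⟨K', hK', hN⟩ := hK z (hWU hz)
  have hdb : HasFDerivAt b (K'.flip (a z) + (K z).comp (fderiv ℝ a z)) z := by
    have := hK'.clm_apply hda
    rw [add_comm] at this
    refine this.congr_of_eventuallyEq ?_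
    filter_upwards [hW.mem_nhds hz] with y hy
    exact (hab y hy).1.symm
  have hdd : HasFDerivAt d (K'.flip (c z) + (K z).comp (fderiv ℝ c z)) z := by
    have := hK'.clm_apply hdc
    rw [add_comm] at this
    refine this.congr_of_eventuallyEq ?_
    filter_upwards [hW.mem_nhds hz] with y hy
    exact (hcd y hy).1.symm
  have key : K z (courant a c z - courant b d z) = courant a d z + courant b c z := by
    rw [courant_eq_jetBracket hda hdc, courant_eq_jetBracket hdb hdd, courant_eq_jetBracket hda hdd,
      courant_eq_jetBracket hdb hdc, ← (hab z hz).1, ← (hcd z hz).1]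
    exact hN.jetBracket_eq (hsq z (hWU hz)) (horth z (hWU hz)) _ _ _ _
  exact ⟨key, by rw [← key, hsq z (hWU hz)]⟩

/-- The transform `v + ξ ↦ v + (ξ + B v)`. -/
def shear (B : E →L[ℝ] E →L[ℝ] ℝ) : GT E →L[ℝ] GT E :=
  (ContinuousLinearMap.fst ℝ E (E →L[ℝ] ℝ)).prod
    (ContinuousLinearMap.snd ℝ E (E →L[ℝ] ℝ) + B.comp (ContinuousLinearMap.fst ℝ E (E →L[ℝ] ℝ)))

theorem shear_apply (B : E →L[ℝ] E →L[ℝ] ℝ) (e : GT E) : shear B e = (e.1, e.2 + B e.1) := rfl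

/-- A field of skew bilinear forms that is closed as a `2`-form at the points of `U`. -/
structure IsClosedField (B : E → (E →L[ℝ] E →L[ℝ] ℝ)) (U : Set E) : Prop where
  smooth : ContDiffOn ℝ ∞ B U
  skew : ∀ z ∈ U, ∀ u v, B z u v = -B z v u
  closed : ∀ z ∈ U, ∀ u v w, fderiv ℝ B z u v w + fderiv ℝ B z v w u + fderiv ℝ B z w u v = 0

/-- The defect of compatibility with the bracket is the cyclic sum of derivatives of `B`, that is,
its exterior derivative. -/
theorem courant_shear {B : E → (E →L[ℝ] E →L[ℝ] ℝ)} {U : Set E} (hU : IsOpen U)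
    (hB : IsClosedField B U) {z : E} (hz : z ∈ U) {a c : E → GT E} (ha : DifferentiableAt ℝ a z)
    (hc : DifferentiableAt ℝ c z) :
    courant (fun y => shear (B y) (a y)) (fun y => shear (B y) (c y)) z =
      shear (B z) (courant a c z) := by
  have hdB := ((hB.smooth.contDiffAt (hU.mem_nhds hz)).differentiableAt (by simp)).hasFDerivAt
  have hsh : ∀ {a : E → GT E}, DifferentiableAt ℝ a z → HasFDerivAt (fun y => shear (B y) (a y))
      ((shear (B z)).comp (fderiv ℝ a z) + (ContinuousLinearMap.inr ℝ E (E →L[ℝ] ℝ)).comp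
        ((fderiv ℝ B z).flip (a z).1)) z := by
    intro a ha
    have h1 := (hasFDerivAt_fst.comp z ha.hasFDerivAt)
    have h2 := (hasFDerivAt_snd.comp z ha.hasFDerivAt)
    have h3 := h1.prodMk (h2.add (hdB.clm_apply h1))
    refine h3.congr_fderiv ?_
    refine ContinuousLinearMap.ext fun x => ?_
    refine Prod.ext ?_ ?_
    · simp [shear_apply]
    · simp [shear_apply]
      abel
  rw [courant_eq_jetBracket (hsh ha) (hsh hc), courant_eq_jetBracket ha.hasFDerivAt hc.hasFDerivAt]
  unfold jetBracket
  have hskew' : ∀ u v w, fderiv ℝ B z u v w = -fderiv ℝ B z u w v := by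
    intro u v w
    have h1 : HasFDerivAt (fun y => B y v w) _ z :=
      (hdB.clm_apply (hasFDerivAt_const v z)).clm_apply (hasFDerivAt_const w z)
    have h2 : HasFDerivAt (fun y => B y w v) _ z :=
      (hdB.clm_apply (hasFDerivAt_const w z)).clm_apply (hasFDerivAt_const v z)
    have h3 : (fun y => B y v w) =ᶠ[nhds z] fun y => -B y w v := by
      filter_upwards [hU.mem_nhds hz] with y hy using hB.skew y hy v w
    have h4 := (h1.unique (h2.neg.congr_of_eventuallyEq h3))
    have h5 := congrArg (fun L : E →L[ℝ] ℝ => L u) h4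
    simpa using h5
  refine Prod.ext ?_ ?_
  · simp [shear_apply]
  · ext x
    simp [shear_apply, pairingL_apply, pairing]
    have h1 := hB.closed z hz (a z).1 (c z).1 x
    have h2 := hskew' (c z).1 x (a z).1
    have h3 := hskew' x (a z).1 (c z).1
    have h4 := hB.skew z hz (c z).1 (fderiv ℝ a z x).1
    have h5 := hB.skew z hz (a z).1 (fderiv ℝ c z x).1
    linarith

theorem shear_neg_shear (B : E →L[ℝ] E →L[ℝ] ℝ) (e : GT E) : shear (-B) (shear B e) = e := by
  simp [shear_apply]

theorem shear_shear_neg (B : E →L[ℝ] E →L[ℝ] ℝ) (e : GT E) : shear B (shear (-B) e) = e := by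
  simp [shear_apply]

theorem Involutive.shear {K : E → (GT E →L[ℝ] GT E)} {U : Set E} (hU : IsOpen U)
    (hK : Involutive K U) {B : E → (E →L[ℝ] E →L[ℝ] ℝ)} (hB : IsClosedField B U) :
    Involutive (fun z => (shear (B z)).comp ((K z).comp (shear (-B z)))) U := by
  intro W hW hWU a b c d ha hb hc hd hab hcd z hz
  have hsm : ∀ {a : E → GT E}, ContDiffOn ℝ ∞ a W →
      ContDiffOn ℝ ∞ (fun y => GKE.shear (-B y) (a y)) W := by
    intro a ha
    have hBW := hB.smooth.mono hWU
    exact ha.fst.prodMk (ha.snd.add ((hBW.neg).clm_apply ha.fst))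
  have hmem : ∀ (y : E) (a b : GT E),
      MemE ((GKE.shear (B y)).comp ((K y).comp (GKE.shear (-B y)))) a b ↔
        MemE (K y) (GKE.shear (-B y) a) (GKE.shear (-B y) b) := by
    intro y a b
    have key : ∀ a b, (GKE.shear (B y)).comp ((K y).comp (GKE.shear (-B y))) a = b ↔
        K y (GKE.shear (-B y) a) = GKE.shear (-B y) b := by
      intro a b
      rw [ContinuousLinearMap.comp_apply, ContinuousLinearMap.comp_apply]
      constructor
      · rintro rfl
        rw [shear_neg_shear]
      · intro h
        rw [h, shear_shear_neg]
    unfold MemE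
    rw [key, key, map_neg]
  have hco : ∀ {a c : E → GT E}, ContDiffOn ℝ ∞ a W → ContDiffOn ℝ ∞ c W →
      GKE.shear (-B z) (courant a c z) =
        courant (fun y => GKE.shear (-B y) (a y)) (fun y => GKE.shear (-B y) (c y)) z := by
    intro a c ha hc
    have h1 := courant_shear hU hB (hWU hz)
      (((hsm ha).contDiffAt (hW.mem_nhds hz)).differentiableAt (by simp))
      (((hsm hc).contDiffAt (hW.mem_nhds hz)).differentiableAt (by simp))
    simp only [shear_shear_neg] at h1
    rw [h1, shear_neg_shear]
  rw [hmem, map_sub, map_add, hco ha hc, hco hb hd, hco ha hd, hco hb hc]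
  exact hK W hW hWU _ _ _ _ (hsm ha) (hsm hb) (hsm hc) (hsm hd)
    (fun y hy => (hmem y _ _).1 (hab y hy)) (fun y hy => (hmem y _ _).1 (hcd y hy)) z hz

end Jets

/-! ### Involutivity for a closed nondegenerate 2-form. -/

section Symplectic

variable {E : Type*} [NormedAddCommGroup E] [NormedSpace ℝ E]

/-- `b ↦ (v ↦ i_v b)` as a continuous linear map. -/
def flatL : Form2 E →L[ℝ] (E →L[ℝ] (E →L[ℝ] ℝ)) :=
  (ContinuousLinearMap.compL ℝ E _ _
    ((ContinuousAlternatingMap.ofSubsingletonLIE (𝕜 := ℝ) (E := E) (F := ℝ) (0 : Fin 1)).symm :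
      (E [⋀^Fin 1]→L[ℝ] ℝ) →L[ℝ] (E →L[ℝ] ℝ))).comp
    (ContinuousAlternatingMap.curryLeftLI (𝕜 := ℝ) (E := E) (F := ℝ) (n := 1)).toContinuousLinearMap

theorem flatL_apply (b : Form2 E) : flatL b = flat b := rfl

theorem fderiv_flat {w : E → Form2 E} {y : E} (hw : DifferentiableAt ℝ w y) (u a b : E) :
    fderiv ℝ (fun z => flat (w z)) y u a b = fderiv ℝ w y u ![a, b] := by
  have h : HasFDerivAt (fun z => flatL (w z)) _ y := flatL.hasFDerivAt.comp y hw.hasFDerivAt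
  change fderiv ℝ (fun z => flatL (w z)) y u a b = _
  rw [h.fderiv, ContinuousLinearMap.comp_apply, flatL_apply, flat_apply]

theorem isClosedField_flat {w : E → Form2 E} {U : Set E} (hU : IsOpen U) (hw : ContDiffOn ℝ ∞ w U)
    (hcl : ∀ y ∈ U, extDeriv w y = 0) : IsClosedField (fun z => flat (w z)) U where
  smooth := (flatL (E := E)).contDiff.comp_contDiffOn hw
  skew z _ u v := flat_swap (w z) u v
  closed z hz u v x := by
    have hd := ((hw.contDiffAt (hU.mem_nhds hz)).differentiableAt (by simp))
    rw [fderiv_flat hd, fderiv_flat hd, fderiv_flat hd]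
    have h := congrArg (fun f => f ![u, v, x]) (hcl z hz)
    simp only [extDeriv] at h
    rw [ContinuousAlternatingMap.alternatizeUncurryFin_apply] at h
    simp [Fin.sum_univ_three] at h
    have e0 : Matrix.vecCons v ![x] = ![v, x] := rfl
    have e1 : (Fin.removeNth 1 ![u, v, x] : Fin 2 → E) = ![u, x] := by
      funext i; fin_cases i <;> rfl
    have e2 : (Fin.removeNth 2 ![u, v, x] : Fin 2 → E) = ![u, v] := by
      funext i; fin_cases i <;> rfl
    have e3 : fderiv ℝ w z v ![u, x] = -fderiv ℝ w z v ![x, u] := by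
      rw [← flat_apply, ← flat_apply, flat_swap]
    rw [e1, e2, e3] at h
    simp at h
    linarith

/-- The part of the Courant bracket of `u + ξ` and `v + η` that involves `u` and `η`. -/
def courantPart (u : E → E) (η : E → (E →L[ℝ] ℝ)) (y : E) : E →L[ℝ] ℝ :=
  lieOne u η y - (1 / 2 : ℝ) • fderiv ℝ (fun z => η z (u z)) y

theorem courantPart_neg (u : E → E) (η : E → (E →L[ℝ] ℝ)) (y : E) :
    courantPart u (fun z => -η z) y = -courantPart u η y := by
  simp only [courantPart, lieOne, neg_apply]
  rw [fderiv_fun_neg, fderiv_fun_neg]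
  ext x
  simp
  ring

theorem courant_snd {u v : E → E} {ξ η : E → (E →L[ℝ] ℝ)} {y : E} (hu : DifferentiableAt ℝ u y)
    (hv : DifferentiableAt ℝ v y) (hξ : DifferentiableAt ℝ ξ y) (hη : DifferentiableAt ℝ η y) :
    (courant (fun z => (u z, ξ z)) (fun z => (v z, η z)) y).2 =
      courantPart u η y - courantPart v ξ y := by
  simp only [courant, courantPart]
  rw [fderiv_fun_sub (hη.clm_apply hu) (hξ.clm_apply hv)]
  module

/-- An instance of `courant_shear` for sections without covector part, whose bracket before the
transform is purely a vector field. -/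
theorem courantPart_flat_sub {w : E → Form2 E} {U : Set E} (hU : IsOpen U)
    (hw : IsClosedField (fun z => flat (w z)) U) {y : E} (hy : y ∈ U) {u v : E → E}
    (hu : DifferentiableAt ℝ u y) (hv : DifferentiableAt ℝ v y) :
    courantPart u (fun z => flat (w z) (v z)) y - courantPart v (fun z => flat (w z) (u z)) y =
      flat (w y) (VectorField.lieBracket ℝ u v y) := by
  have hd := ((hw.smooth.contDiffAt (hU.mem_nhds hy)).differentiableAt (by simp))
  rw [← courant_snd hu hv (hd.clm_apply hu) (hd.clm_apply hv)]
  have h := courant_shear hU hw hy (a := fun z => (u z, 0)) (c := fun z => (v z, 0))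
    (hu.prodMk (differentiableAt_const _)) (hv.prodMk (differentiableAt_const _))
  simp only [shear_apply, zero_add] at h
  rw [h]
  have h2 := courant_snd (ξ := fun _ => 0) (η := fun _ => 0) hu hv (differentiableAt_const _)
    (differentiableAt_const _)
  have h3 : ∀ u : E → E, courantPart u (fun _ => 0) y = 0 := by
    intro u
    simp [courantPart, lieOne]
  rw [h3, h3, sub_zero] at h2
  simp only [h2, zero_add]
  rfl

variable [FiniteDimensional ℝ E]

theorem memE_ofSymplectic {w : Form2 E} (hw : ∀ v, flat w v = 0 → v = 0) (a b : GT E) :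
    MemE (ofSymplectic w) a b ↔ a.2 = -flat w b.1 ∧ b.2 = flat w a.1 := by
  unfold MemE
  rw [ofSymplectic_apply, ofSymplectic_apply]
  constructor
  · rintro ⟨h1, h2⟩
    constructor
    · have := congrArg Prod.fst h1
      simp only at this
      rw [← this, map_neg, flat_inverse_flat hw, neg_neg]
    · exact (congrArg Prod.snd h1).symm
  · rintro ⟨h1, h2⟩
    rw [h1, h2]
    refine ⟨Prod.ext ?_ ?_, Prod.ext ?_ ?_⟩
    · simp [inverse_flat_flat hw]
    · simp [h2]
    · simp [inverse_flat_flat hw]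
    · simp [h1]

/-- The eigenbundle is the graph X ↦ X + i i_X ω over complexified vectors, and the graph of a
closed 2-form is involutive. `S1` to `S4` are the real components of this statement. -/
theorem involutive_ofSymplectic {w : E → Form2 E} {U : Set E} (hU : IsOpen U)
    (hsm : ContDiffOn ℝ ∞ w U) (hcl : ∀ y ∈ U, extDeriv w y = 0)
    (hnd : ∀ y ∈ U, ∀ v, flat (w y) v = 0 → v = 0) : Involutive (fun y => ofSymplectic (w y)) U := by
  intro W hW hWU a b c d ha hb hc hd hab hcd z hz
  have hcf := isClosedField_flat hU hsm hcl
  have hdw := ((hcf.smooth.contDiffAt (hU.mem_nhds (hWU hz))).differentiableAt (by simp))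
  rw [memE_ofSymplectic (hnd z (hWU hz))]
  have hdf : ∀ {a : E → GT E}, ContDiffOn ℝ ∞ a W → DifferentiableAt ℝ a z := fun ha =>
    ((ha.contDiffAt (hW.mem_nhds hz)).differentiableAt (by simp))
  -- The bracket depends only on germs, so sections may be replaced by their graph expressions.
  have hgerm : ∀ {a a' c c' : E → GT E}, a =ᶠ[nhds z] a' → c =ᶠ[nhds z] c' →
      courant a c z = courant a' c' z := by
    intro a a' c c' h1 h2
    have e1 : (fun z => (a z).1) =ᶠ[nhds z] fun z => (a' z).1 := h1.fun_comp Prod.fst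
    have e2 : (fun z => (a z).2) =ᶠ[nhds z] fun z => (a' z).2 := h1.fun_comp Prod.snd
    have e3 : (fun z => (c z).1) =ᶠ[nhds z] fun z => (c' z).1 := h2.fun_comp Prod.fst
    have e4 : (fun z => (c z).2) =ᶠ[nhds z] fun z => (c' z).2 := h2.fun_comp Prod.snd
    have e5 : (fun z => (c z).2 (a z).1 - (a z).2 (c z).1) =ᶠ[nhds z]
        (fun z => (c' z).2 (a' z).1 - (a' z).2 (c' z).1) := by
      filter_upwards [h1, h2] with y h1 h2
      rw [h1, h2]
    simp only [courant, lieOne, VectorField.lieBracket, e1.fderiv_eq, e2.fderiv_eq, e3.fderiv_eq,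
      e4.fderiv_eq, e5.fderiv_eq, h1.eq_of_nhds, h2.eq_of_nhds]
  have hev : ∀ {a b : E → GT E}, (∀ z ∈ W, MemE (ofSymplectic (w z)) (a z) (b z)) →
      a =ᶠ[nhds z] (fun y => ((a y).1, -flat (w y) (b y).1)) ∧
      b =ᶠ[nhds z] (fun y => ((b y).1, flat (w y) (a y).1)) := by
    intro a b hab
    constructor
    · filter_upwards [hW.mem_nhds hz] with y hy
      exact Prod.ext rfl ((memE_ofSymplectic (hnd y (hWU hy)) _ _).1 (hab y hy)).1
    · filter_upwards [hW.mem_nhds hz] with y hy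
      exact Prod.ext rfl ((memE_ofSymplectic (hnd y (hWU hy)) _ _).1 (hab y hy)).2
  obtain ⟨hA, hB⟩ := hev hab
  obtain ⟨hC, hD⟩ := hev hcd
  have da := (hdf ha).fst
  have db := (hdf hb).fst
  have dc := (hdf hc).fst
  have dd := (hdf hd).fst
  rw [hgerm hA hC, hgerm hB hD, hgerm hA hD, hgerm hB hC]
  have S1 := courantPart_flat_sub hU hcf (hWU hz) da dd
  have S2 := courantPart_flat_sub hU hcf (hWU hz) db dc
  have S3 := courantPart_flat_sub hU hcf (hWU hz) da dc
  have S4 := courantPart_flat_sub hU hcf (hWU hz) db dd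
  have wa := hdw.clm_apply da
  have wb := hdw.clm_apply db
  have wc := hdw.clm_apply dc
  have wd := hdw.clm_apply dd
  have fst_eq : ∀ (u v : E → E) (ξ η : E → (E →L[ℝ] ℝ)),
      (courant (fun z => (u z, ξ z)) (fun z => (v z, η z)) z).1 = VectorField.lieBracket ℝ u v z :=
    fun _ _ _ _ => rfl
  constructor
  · rw [Prod.snd_sub, Prod.fst_add, fst_eq, fst_eq, courant_snd da dc wb.fun_neg wd.fun_neg,
      courant_snd db dd wa wc, map_add, ← S1, ← S2, courantPart_neg, courantPart_neg]
    abel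
  · rw [Prod.snd_add, Prod.fst_sub, fst_eq, fst_eq, courant_snd da dd wb.fun_neg wc,
      courant_snd db dc wa wd.fun_neg, map_sub, ← S3, ← S4, courantPart_neg, courantPart_neg]
    abel

end Symplectic

/-! ### The holomorphic Poisson bivector. -/

section Poisson

variable {E : Type*} [NormedAddCommGroup E] [NormedSpace ℂ E]

/-- The complex linear extension `ξ - i (ξ ∘ J)` of a real form. -/
def hat (ξ : E →L[ℝ] ℝ) : E →L[ℂ] ℂ := StrongDual.extendRCLike ξ

theorem hat_apply (ξ : E →L[ℝ] ℝ) (x : E) : hat ξ x = ξ x - Complex.I * ξ (Complex.I • x) := by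
  simp [hat, StrongDual.extendRCLike_apply]

/-- `(v, w) ↦ (ξ ↦ ξ(w) v)`. -/
def tensorL : E →L[ℝ] E →L[ℝ] ((E →L[ℝ] ℝ) →L[ℝ] E) :=
  ((ContinuousLinearMap.smulRightL ℝ (E →L[ℝ] ℝ) E).comp (ContinuousLinearMap.apply ℝ ℝ)).flip

/-- The bivector `v ∧ i w + i v ∧ w` as a map from covectors to vectors, bilinear in `v` and
`w`. -/
def poissonL : E →L[ℝ] E →L[ℝ] ((E →L[ℝ] ℝ) →L[ℝ] E) :=
  ((ContinuousLinearMap.compL ℝ E E ((E →L[ℝ] ℝ) →L[ℝ] E)).flip (cplx E)).comp tensorL +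
    tensorL.comp (cplx E) - (tensorL.comp (cplx E) +
      ((ContinuousLinearMap.compL ℝ E E ((E →L[ℝ] ℝ) →L[ℝ] E)).flip (cplx E)).comp tensorL).flip

theorem poissonL_apply_real (v w : E) (ξ : E →L[ℝ] ℝ) :
    poissonL v w ξ = ξ (cplx E w) • v + ξ w • cplx E v - (ξ v • cplx E w + ξ (cplx E v) • w) := rfl

/-- In this form the bivector is manifestly complex bilinear in `v` and `w`, which reduces the
Jacobi identity to algebra over ℂ. -/
theorem poissonL_apply (v w : E) (ξ : E →L[ℝ] ℝ) :
    poissonL v w ξ = Complex.I • (hat ξ w • v - hat ξ v • w) := by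
  rw [poissonL_apply_real, hat_apply, hat_apply, cplx_apply, cplx_apply]
  simp only [← Complex.coe_smul]
  match_scalars
  · linear_combination (ξ (Complex.I • w) : ℂ) * Complex.I_sq
  · linear_combination (-(ξ (Complex.I • v) : ℂ)) * Complex.I_sq

theorem pairing_poisson_skew (v w : E) (ξ η : E →L[ℝ] ℝ) :
    η (poissonL v w ξ) = -ξ (poissonL v w η) := by
  simp [poissonL_apply_real]
  ring

theorem hat_comp (η : E →L[ℝ] ℝ) (A : E →L[ℝ] E) (hA : ∀ x, A (Complex.I • x) = Complex.I • A x) (x : E) :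
    hat (η.comp A) x = hat η (A x) := by
  simp [hat_apply, hA]

theorem map_complex_smul {F : Type*} [NormedAddCommGroup F] [NormedSpace ℂ F] {A : E →L[ℝ] F}
    (hA : ∀ x, A (Complex.I • x) = Complex.I • A x) (c : ℂ) (x : E) : A (c • x) = c • A x := by
  rw [complex_smul_eq, map_add, map_smul, map_smul, hA, ← complex_smul_eq]

/-- The derivative of `poissonL V W` for vector fields with derivatives `V'`, `W'`. -/
def poissonDeriv (v w : E) (V' W' : E →L[ℝ] E) : E →L[ℝ] ((E →L[ℝ] ℝ) →L[ℝ] E) :=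
  (poissonL v).comp W' + (poissonL.flip w).comp V'

theorem poissonDeriv_apply (v w : E) (V' W' : E →L[ℝ] E) (x : E) (ξ : E →L[ℝ] ℝ) :
    poissonDeriv v w V' W' x ξ = poissonL v (W' x) ξ + poissonL (V' x) w ξ := rfl

theorem poissonDeriv_I (v w : E) {V' W' : E →L[ℝ] E} (hV : ∀ x, V' (Complex.I • x) = Complex.I • V' x)
    (hW : ∀ x, W' (Complex.I • x) = Complex.I • W' x) (x : E) (ξ : E →L[ℝ] ℝ) :
    poissonDeriv v w V' W' (Complex.I • x) ξ = Complex.I • poissonDeriv v w V' W' x ξ := by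
  rw [poissonDeriv_apply, poissonDeriv_apply, hV, hW]
  simp only [poissonL_apply, map_smul, smul_eq_mul]
  module

/-- The terms of the Schouten bracket of v ∧ w with itself are proportional to [v, w], which is zero
by `hVW`; holomorphy lets complex scalars pass through the derivatives. -/
theorem poisson_jacobi (v w : E) {V' W' : E →L[ℝ] E}
    (hV : ∀ x, V' (Complex.I • x) = Complex.I • V' x)
    (hW : ∀ x, W' (Complex.I • x) = Complex.I • W' x) (hVW : V' w = W' v) (ξ η : E →L[ℝ] ℝ) :
    poissonDeriv v w V' W' (poissonL v w ξ) η - poissonDeriv v w V' W' (poissonL v w η) ξ =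
      poissonL v w (η.comp ((poissonDeriv v w V' W').flip ξ)) := by
  have h1 : ∀ x, hat (η.comp ((poissonDeriv v w V' W').flip ξ)) x =
      hat η (poissonDeriv v w V' W' x ξ) := fun x =>
    hat_comp η _ (fun x => poissonDeriv_I v w hV hW x ξ) x
  rw [poissonL_apply v w (η.comp _), h1, h1]
  simp only [poissonDeriv_apply, poissonL_apply, map_complex_smul hV, map_complex_smul hW, map_sub,
    hVW, map_smul, map_add, smul_eq_mul]
  match_scalars <;> ring

end Poisson

/-! ### Deformation by a Poisson bivector and integrability of the family. -/

section Beta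

variable {E : Type*} [NormedAddCommGroup E] [NormedSpace ℂ E]

/-- `P ↦ (v + ξ ↦ P ξ)`. -/
def inclL : ((E →L[ℝ] ℝ) →L[ℝ] E) →L[ℝ] (GT E →L[ℝ] GT E) :=
  (ContinuousLinearMap.compL ℝ (GT E) E (GT E) (ContinuousLinearMap.inl ℝ E (E →L[ℝ] ℝ))).comp
    ((ContinuousLinearMap.compL ℝ (GT E) (E →L[ℝ] ℝ) E).flip (ContinuousLinearMap.snd ℝ E (E →L[ℝ] ℝ)))

theorem inclL_apply (P : (E →L[ℝ] ℝ) →L[ℝ] E) (e : GT E) : inclL P e = (P e.2, 0) := rfl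

/-- `v + ξ ↦ (J v + P ξ) - ξ ∘ J`. -/
def betaMap (P : (E →L[ℝ] ℝ) →L[ℝ] E) : GT E →L[ℝ] GT E := ofComplex (cplx E) + inclL P

theorem betaMap_apply (P : (E →L[ℝ] ℝ) →L[ℝ] E) (e : GT E) :
    betaMap P e = (cplx E e.1 + P e.2, -(e.2.comp (cplx E))) := by
  rw [betaMap, add_apply, inclL_apply, ofComplex_apply]
  simp

theorem poissonL_comp (v w : E) (ξ : E →L[ℝ] ℝ) :
    poissonL v w (ξ.comp (cplx E)) = cplx E (poissonL v w ξ) := by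
  simp only [poissonL_apply_real, ContinuousLinearMap.comp_apply, cplx_cplx, map_sub, map_add,
    map_smul, map_neg]
  module

theorem betaMap_sq (v w : E) (e : GT E) :
    betaMap (poissonL v w) (betaMap (poissonL v w) e) = -e := by
  rw [betaMap_apply, betaMap_apply]
  refine Prod.ext ?_ ?_
  · simp [cplx_cplx, poissonL_comp]
  · ext x
    simp [cplx_cplx]

theorem pairing_betaMap (v w : E) (e f : GT E) :
    pairing (betaMap (poissonL v w) e) (betaMap (poissonL v w) f) = pairing e f := by
  have h := pairing_poisson_skew v w (f.2.comp (cplx E)) e.2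
  rw [poissonL_comp, ContinuousLinearMap.comp_apply] at h
  simp only [pairing, betaMap_apply, map_add, neg_apply, ContinuousLinearMap.comp_apply, cplx_cplx,
    map_neg]
  linarith

/-- The vector component amounts to the Jacobi identity, the covector component to skewness and
holomorphy of the bivector. -/
theorem nijenhuisAt_betaMap (v w : E) {V' W' : E →L[ℝ] E}
    (hV : ∀ x, V' (Complex.I • x) = Complex.I • V' x)
    (hW : ∀ x, W' (Complex.I • x) = Complex.I • W' x) (hVW : V' w = W' v) :
    NijenhuisAt (betaMap (poissonL v w)) (inclL.comp (poissonDeriv v w V' W')) := by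
  intro a c
  have hskew : ∀ x (ξ η : E →L[ℝ] ℝ), η (poissonDeriv v w V' W' x ξ) =
      -ξ (poissonDeriv v w V' W' x η) := by
    intro x ξ η
    rw [poissonDeriv_apply, poissonDeriv_apply, map_add, map_add, pairing_poisson_skew _ _ ξ η,
      pairing_poisson_skew _ _ ξ η]
    ring
  have hI : ∀ x (ξ : E →L[ℝ] ℝ), poissonDeriv v w V' W' (cplx E x) ξ =
    cplx E (poissonDeriv v w V' W' x ξ) := fun x ξ => poissonDeriv_I v w hV hW x ξ
  set D := poissonDeriv v w V' W' with hD
  have hZ : (0 : E →L[ℝ] ℝ) + ((pairingL (betaMap (poissonL v w) a)).comp ((inclL.comp D).flip c) -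
      (pairingL (betaMap (poissonL v w) c)).comp ((inclL.comp D).flip a)) =
      (c.2.comp (D.flip a.2)).comp (cplx E) := by
    ext x
    have h := hskew (cplx E x) a.2 c.2
    simp [pairingL_apply, pairing, inclL_apply, betaMap_apply, hI] at h ⊢
    linarith
  have hj := poisson_jacobi v w hV hW hVW a.2 c.2
  rw [← hD] at hj
  refine Prod.ext ?_ ?_
  · rw [betaMap_apply]
    simp only [Prod.fst_add, Prod.snd_add, Prod.fst_sub, Prod.snd_sub, ContinuousLinearMap.comp_apply,
      inclL_apply, sub_zero, add_zero]
    rw [hZ, poissonL_comp, ← hj, betaMap_apply, betaMap_apply]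
    simp only [map_add, map_sub, hI, add_apply, cplx_cplx]
    abel
  · ext x
    rw [betaMap_apply]
    simp only [Prod.snd_add, Prod.snd_sub, ContinuousLinearMap.comp_apply,
      inclL_apply, sub_zero]
    rw [hZ]
    have h := hskew x a.2 c.2
    simp [pairingL_apply, pairing, inclL_apply, cplx_cplx] at h ⊢
    linarith

/-- By isotropy e^{tA} factors as a shear times a bivector rotation. Conjugating the complex
structure by the latter adds only the bivector term of `betaMap`, and the shear remains outside. -/
theorem deform_eq_shear {v₁ v₂ : E} {ξ₁ ξ₂ : E →L[ℝ] ℝ} (h : IsIsotropicData v₁ v₂ ξ₁ ξ₂) (t : ℝ) :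
    deform t v₁ v₂ ξ₁ ξ₂ = (shear (t • (ξ₂.smulRight ξ₁ - ξ₁.smulRight ξ₂))).comp
      ((betaMap (poissonL ((-t) • v₁) v₂)).comp
        (shear (-(t • (ξ₂.smulRight ξ₁ - ξ₁.smulRight ξ₂))))) := by
  refine ContinuousLinearMap.ext fun e => ?_
  have h1 : rot (-t) v₁ v₂ ξ₁ ξ₂ e = (e.1 - t • ((shear (-(t • (ξ₂.smulRight ξ₁ - ξ₁.smulRight ξ₂))) e).2 v₂ • v₁ -
    (shear (-(t • (ξ₂.smulRight ξ₁ - ξ₁.smulRight ξ₂))) e).2 v₁ • v₂), (shear (-(t • (ξ₂.smulRight ξ₁ - ξ₁.smulRight ξ₂))) e).2) := by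
    refine Prod.ext ?_ ?_
    · simp [rot_apply, nilMap_apply, shear_apply, h.h11, h.h12, h.h21, h.h22]
      module
    · simp [rot_apply, nilMap_apply, shear_apply]
  rw [deform_apply, ContinuousLinearMap.comp_apply, ContinuousLinearMap.comp_apply, h1]
  have h2 : (shear (-(t • (ξ₂.smulRight ξ₁ - ξ₁.smulRight ξ₂))) e).1 = e.1 := rfl
  generalize shear (-(t • (ξ₂.smulRight ξ₁ - ξ₁.smulRight ξ₂))) e = f at h2 ⊢
  rw [← h2]
  have h3 : rot t v₁ v₂ ξ₁ ξ₂ (ofComplex (cplx E) (f.1 - t • (f.2 v₂ • v₁ - f.2 v₁ • v₂), f.2)) =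
    shear (t • (ξ₂.smulRight ξ₁ - ξ₁.smulRight ξ₂)) (ofComplex (cplx E) (f.1 - t • (f.2 v₂ • v₁ - f.2 v₁ • v₂), f.2) +
      t • ((ofComplex (cplx E) f).2 v₂ • v₁ - (ofComplex (cplx E) f).2 v₁ • v₂, 0)) := by
    rw [rot_apply, nilMap_apply, shear_apply]
    refine Prod.ext ?_ ?_
    · simp [ofComplex_apply]
    · simp [ofComplex_apply, h.h11, h.h12, h.h21, h.h22]
  rw [h3]
  congr 1
  rw [betaMap_apply]
  refine Prod.ext ?_ ?_
  · simp [ofComplex_apply, poissonL_apply_real]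
    module
  · simp [ofComplex_apply]

theorem involutive_deform {V W : E → E} {θ τ : E → (E →L[ℝ] ℝ)} {U : Set E} (hU : IsOpen U)
    (hV : ContDiffOn ℝ ∞ V U) (hW : ContDiffOn ℝ ∞ W U) (hθ : ContDiffOn ℝ ∞ θ U)
    (hτ : ContDiffOn ℝ ∞ τ U)
    (hVI : ∀ y ∈ U, ∀ x, fderiv ℝ V y (Complex.I • x) = Complex.I • fderiv ℝ V y x)
    (hWI : ∀ y ∈ U, ∀ x, fderiv ℝ W y (Complex.I • x) = Complex.I • fderiv ℝ W y x)
    (hVW : ∀ y ∈ U, fderiv ℝ V y (W y) = fderiv ℝ W y (V y))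
    (hθc : ∀ y ∈ U, ∀ u v, fderiv ℝ θ y u v = fderiv ℝ θ y v u)
    (hτc : ∀ y ∈ U, ∀ u v, fderiv ℝ τ y u v = fderiv ℝ τ y v u)
    (hiso : ∀ y ∈ U, IsIsotropicData (V y) (W y) (θ y) (τ y)) (t : ℝ) :
    Involutive (fun y => deform t (V y) (W y) (θ y) (τ y)) U := by
  have hβ : Involutive (fun y => betaMap (poissonL ((-t) • V y) (W y))) U := by
    refine involutive_of_nijenhuisAt (fun z hz => ?_) (fun z _ u => betaMap_sq _ _ u)
      (fun z _ u v => pairing_betaMap _ _ u v)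
    have dV := ((hV.contDiffAt (hU.mem_nhds hz)).differentiableAt (by simp)).hasFDerivAt
    have dW := ((hW.contDiffAt (hU.mem_nhds hz)).differentiableAt (by simp)).hasFDerivAt
    have hd : HasFDerivAt (fun y => betaMap (poissonL ((-t) • V y) (W y)))
        (inclL.comp (poissonDeriv ((-t) • V z) (W z) ((-t) • fderiv ℝ V z) (fderiv ℝ W z))) z := by
      have h1 := poissonL.hasFDerivAt_of_bilinear (dV.const_smul (-t)) dW
      have h2 := ((inclL (E := E)).hasFDerivAt.comp z h1).const_add (ofComplex (cplx E))
      exact h2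
    refine ⟨_, hd, nijenhuisAt_betaMap _ _ ?_ (hWI z hz) ?_⟩
    · intro x
      rw [smul_apply, hVI z hz, smul_apply, smul_comm]
    · rw [smul_apply, map_smul, hVW z hz]
  -- A multiple of θ ∧ τ; it is closed because the derivatives of θ and τ are symmetric.
  have hB : IsClosedField (fun y => t • ((τ y).smulRight (θ y) - (θ y).smulRight (τ y))) U := by
    have hsm : ContDiffOn ℝ ∞ (fun y => t • ((τ y).smulRight (θ y) - (θ y).smulRight (τ y))) U :=
      ((hτ.smulRight hθ).sub (hθ.smulRight hτ)).const_smul t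
    refine ⟨hsm, fun z _ u v => ?_, fun z hz u v x => ?_⟩
    · simp
      ring
    · have dθ := ((hθ.contDiffAt (hU.mem_nhds hz)).differentiableAt (by simp)).hasFDerivAt
      have dτ := ((hτ.contDiffAt (hU.mem_nhds hz)).differentiableAt (by simp)).hasFDerivAt
      have hdB := ((hsm.contDiffAt (hU.mem_nhds hz)).differentiableAt (by simp)).hasFDerivAt
      have key : ∀ u v x, fderiv ℝ (fun y => t • ((τ y).smulRight (θ y) - (θ y).smulRight (τ y))) z u v x
          = t * (fderiv ℝ τ z u v * θ z x + τ z v * fderiv ℝ θ z u x -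
            (fderiv ℝ θ z u v * τ z x + θ z v * fderiv ℝ τ z u x)) := by
        intro u v x
        have h1 := (hdB.clm_apply (hasFDerivAt_const v z)).clm_apply (hasFDerivAt_const x z)
        have h2 := (((dτ.clm_apply (hasFDerivAt_const v z)).mul (dθ.clm_apply (hasFDerivAt_const x z))).sub
          ((dθ.clm_apply (hasFDerivAt_const v z)).mul (dτ.clm_apply (hasFDerivAt_const x z)))).const_mul t
        have h3 := congrArg (fun L : E →L[ℝ] ℝ => L u) (h1.unique h2)
        simp at h3
        rw [h3]
        ring
      rw [key, key, key, hθc z hz v u, hθc z hz x u, hθc z hz x v, hτc z hz v u, hτc z hz x u,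
        hτc z hz x v]
      ring
  have := hβ.shear hU hB
  intro S hS hSU a b c d ha hb hc hd hab hcd z hz
  have heq : ∀ y ∈ U, deform t (V y) (W y) (θ y) (τ y) =
    (shear (t • ((τ y).smulRight (θ y) - (θ y).smulRight (τ y)))).comp
      ((betaMap (poissonL ((-t) • V y) (W y))).comp
        (shear (-(t • ((τ y).smulRight (θ y) - (θ y).smulRight (τ y)))))) :=
    fun y hy => deform_eq_shear (hiso y hy) t
  simp only [heq z (hSU hz)]
  refine this S hS hSU a b c d ha hb hc hd (fun y hy => ?_) (fun y hy => ?_) z hz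
  · have := hab y hy
    simp only [heq y (hSU hy)] at this
    exact this
  · have := hcd y hy
    simp only [heq y (hSU hy)] at this
    exact this

end Beta

/-! ### Differentiating mixed forms by means of Clifford operators. -/

section MixedForms

variable {E : Type*} [NormedAddCommGroup E] [NormedSpace ℝ E]

/-- The mixed form `Φ` is differentiable at `z` with directional derivatives `Φ'`. -/
def HasMDeriv (Φ Φ' : E → MForm E) (z : E) : Prop :=
  ∀ p, ∃ L : E →L[ℝ] (E [⋀^Fin p]→L[ℝ] ℂ), HasFDerivAt (fun y => Φ y p) L z ∧ ∀ x, L x = Φ' x p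

theorem hasMDeriv_const (φ : MForm E) (z : E) : HasMDeriv (fun _ => φ) (fun _ => 0) z :=
  fun _ => ⟨0, hasFDerivAt_const _ _, fun _ => rfl⟩

theorem HasMDeriv.add {Φ Φ' Ψ Ψ' : E → MForm E} {z : E} (h : HasMDeriv Φ Φ' z)
    (h' : HasMDeriv Ψ Ψ' z) : HasMDeriv (fun y => Φ y + Ψ y) (fun x => Φ' x + Ψ' x) z := by
  intro p
  obtain ⟨L, hL, hL'⟩ := h p
  obtain ⟨L2, hL2, hL2'⟩ := h' p
  exact ⟨L + L2, hL.add hL2, fun x => by rw [add_apply, hL', hL2']; rfl⟩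

theorem HasMDeriv.const_smul {Φ Φ' : E → MForm E} {z : E} (h : HasMDeriv Φ Φ' z) (c : ℂ) :
    HasMDeriv (fun y => c • Φ y) (fun x => c • Φ' x) z := by
  intro p
  obtain ⟨L, hL, hL'⟩ := h p
  exact ⟨c • L, hL.const_smul c, fun x => by rw [smul_apply, hL']; rfl⟩

theorem wedgeOne_eq (ξ : E →L[ℝ] ℝ) {p : ℕ} (α : E [⋀^Fin p]→L[ℝ] ℂ) :
    wedgeOne ξ α = ContinuousAlternatingMap.alternatizeUncurryFinCLM ℝ E ℂ
      (ContinuousLinearMap.smulRightL ℝ E (E [⋀^Fin p]→L[ℝ] ℂ) ξ α) := rfl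

theorem HasMDeriv.cliff {Φ Φ' : E → MForm E} {z : E} (h : HasMDeriv Φ Φ' z) {e : E → GT E}
    {e' : E →L[ℝ] GT E} (he : HasFDerivAt e e' z) :
    HasMDeriv (fun y => cliff (e y) (Φ y)) (fun x => cliff (e' x) (Φ z) + cliff (e z) (Φ' x)) z := by
  have h1 : ∀ p, ∃ L : E →L[ℝ] (E [⋀^Fin p]→L[ℝ] ℂ),
      HasFDerivAt (fun y => (Φ y (p + 1)).curryLeft (e y).1) L z ∧
      ∀ x, L x = (Φ z (p + 1)).curryLeft (e' x).1 + (Φ' x (p + 1)).curryLeft (e z).1 := by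
    intro p
    obtain ⟨L, hL, hL'⟩ := h (p + 1)
    have hc := ((ContinuousAlternatingMap.curryLeftLI (𝕜 := ℝ) (E := E) (F := ℂ)
      (n := p)).toContinuousLinearMap.hasFDerivAt.comp z hL).clm_apply (hasFDerivAt_fst.comp z he)
    refine ⟨_, hc, fun x => ?_⟩
    simp [hL']
  have h2 : ∀ p, ∃ L : E →L[ℝ] (E [⋀^Fin (p + 1)]→L[ℝ] ℂ),
      HasFDerivAt (fun y => wedgeOne (e y).2 (Φ y p)) L z ∧
      ∀ x, L x = wedgeOne (e' x).2 (Φ z p) + wedgeOne (e z).2 (Φ' x p) := by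
    intro p
    obtain ⟨L, hL, hL'⟩ := h p
    have hs := (ContinuousLinearMap.smulRightL ℝ E (E [⋀^Fin p]→L[ℝ] ℂ)).hasFDerivAt_of_bilinear
      (hasFDerivAt_snd.comp z he) hL
    have hc := (ContinuousAlternatingMap.alternatizeUncurryFinCLM ℝ E ℂ).hasFDerivAt.comp z hs
    refine ⟨_, hc, fun x => ?_⟩
    rw [wedgeOne_eq, wedgeOne_eq, ← map_add, ContinuousLinearMap.comp_apply]
    congr 1
    simp [hL']
    abel
  intro p
  cases p with
  | zero =>
    obtain ⟨L, hL, hL'⟩ := h1 0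
    exact ⟨L, hL, fun x => by rw [hL']; rfl⟩
  | succ p =>
    obtain ⟨L, hL, hL'⟩ := h1 (p + 1)
    obtain ⟨L2, hL2, hL2'⟩ := h2 p
    refine ⟨L + L2, hL.add hL2, fun x => ?_⟩
    rw [add_apply, hL', hL2']
    simp only [GKE.cliff, Pi.add_apply]
    abel

/-- A mixed form is smooth on a set. -/
def SmoothM (Φ : E → MForm E) (U : Set E) : Prop := ∀ p, ContDiffOn ℝ ∞ (fun y => Φ y p) U

theorem SmoothM.add {Φ Ψ : E → MForm E} {U : Set E} (h : SmoothM Φ U) (h' : SmoothM Ψ U) :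
    SmoothM (fun y => Φ y + Ψ y) U := fun p => (h p).add (h' p)

theorem SmoothM.const_smul {Φ : E → MForm E} {U : Set E} (h : SmoothM Φ U) (c : ℂ) :
    SmoothM (fun y => c • Φ y) U := fun p => contDiffOn_const.smul (h p)

theorem SmoothM.cliff {Φ : E → MForm E} {U : Set E} (h : SmoothM Φ U) {e : E → GT E}
    (he : ContDiffOn ℝ ∞ e U) : SmoothM (fun y => cliff (e y) (Φ y)) U := by
  have h1 : ∀ p, ContDiffOn ℝ ∞ (fun y => (Φ y (p + 1)).curryLeft (e y).1) U := fun p =>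
    ((ContinuousAlternatingMap.curryLeftLI (𝕜 := ℝ) (E := E) (F := ℂ)
      (n := p)).toContinuousLinearMap.contDiff.comp_contDiffOn (h (p + 1))).clm_apply he.fst
  have h2 : ∀ p, ContDiffOn ℝ ∞ (fun y => wedgeOne (e y).2 (Φ y p)) U := fun p =>
    (ContinuousAlternatingMap.alternatizeUncurryFinCLM ℝ E ℂ).contDiff.comp_contDiffOn
      (he.snd.smulRight (h p))
  intro p
  cases p with
  | zero => exact h1 0
  | succ p => exact (h1 (p + 1)).add (h2 p)

theorem cl_cov_cov (ξ η : E →L[ℝ] ℝ) (γ : AForm E) :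
    cl (0, ξ) (cl (0, η) γ) = -cl (0, η) (cl (0, ξ) γ) := by
  rw [cl_cl]; simp

theorem cl_vec_vec (u v : E) (γ : AForm E) :
    cl (u, 0) (cl (v, 0) γ) = -cl (v, 0) (cl (u, 0) γ) := by
  rw [cl_cl]; simp

theorem cl_cov_vec (ξ : E →L[ℝ] ℝ) (u : E) (γ : AForm E) :
    cl (0, ξ) (cl (u, 0) γ) = (ξ u : ℂ) • γ - cl (u, 0) (cl (0, ξ) γ) := by
  rw [cl_cl]; simp

theorem cl_vec_cov (u : E) (ξ : E →L[ℝ] ℝ) (γ : AForm E) :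
    cl (u, 0) (cl (0, ξ) γ) = (ξ u : ℂ) • γ - cl (0, ξ) (cl (u, 0) γ) := by
  rw [cl_cl]; simp

/-- `u ↦ i_u` as a real linear map with values in operators on a fixed form. -/
def clVec (γ : AForm E) : E →ₗ[ℝ] AForm E where
  toFun u := cl (u, 0) γ
  map_add' u v := by
    rw [← LinearMap.add_apply, ← cl_add]; simp
  map_smul' c u := by
    have h := cl_smul c ((u, 0) : GT E)
    rw [Prod.smul_mk, smul_zero] at h
    rw [h, LinearMap.smul_apply, Complex.coe_smul]
    rfl

theorem clVec_apply (γ : AForm E) (u : E) : clVec γ u = cl (u, 0) γ := rfl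

/-- `ξ ↦ ξ ∧ γ`. -/
def clCov (γ : AForm E) : (E →L[ℝ] ℝ) →ₗ[ℝ] AForm E where
  toFun ξ := cl (0, ξ) γ
  map_add' u v := by
    rw [← LinearMap.add_apply, ← cl_add]; simp
  map_smul' c u := by
    have h := cl_smul c ((0, u) : GT E)
    rw [Prod.smul_mk, smul_zero] at h
    rw [h, LinearMap.smul_apply, Complex.coe_smul]
    rfl

theorem clCov_apply (γ : AForm E) (ξ : E →L[ℝ] ℝ) : clCov γ ξ = cl (0, ξ) γ := rfl

variable [FiniteDimensional ℝ E]

/-- The dual of the standard basis of `E`. -/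
def dualB (k : Fin (Module.finrank ℝ E)) : E →L[ℝ] ℝ :=
  LinearMap.toContinuousLinearMap ((Module.finBasis ℝ E).coord k)

theorem sum_dualB (x : E) : ∑ k, dualB k x • Module.finBasis ℝ E k = x :=
  (Module.finBasis ℝ E).sum_repr x

theorem sum_dualB_smul {F : Type*} [AddCommGroup F] [Module ℝ F] (L : E →ₗ[ℝ] F) (x : E) :
    ∑ k, dualB k x • L (Module.finBasis ℝ E k) = L x := by
  conv_rhs => rw [← sum_dualB x, map_sum]
  simp only [map_smul]

theorem sum_smul_dualB (ξ : E →L[ℝ] ℝ) : ∑ k, ξ (Module.finBasis ℝ E k) • dualB k = ξ := by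
  ext x
  have := sum_dualB_smul ξ.toLinearMap x
  simp only [ContinuousLinearMap.coe_coe, smul_eq_mul] at this
  rw [FunLike.coe_sum, Finset.sum_apply, ← this]
  exact Finset.sum_congr rfl fun k _ => by rw [smul_apply, smul_eq_mul, mul_comm]

/-- This is d = ∑ e^k ∧ ∂_k, which makes the exterior derivative accessible to the Clifford
relations. -/
theorem HasMDeriv.forget_dForm {Φ Φ' : E → MForm E} {z : E} (h : HasMDeriv Φ Φ' z) :
    forget (dForm Φ z) = ∑ k, cl (0, dualB k) (forget (Φ' (Module.finBasis ℝ E k))) := by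
  funext p
  cases p with
  | zero =>
    ext x
    simp [forget, dForm, cl_apply, extMul_zero, contr_apply]
  | succ p =>
    obtain ⟨L, hL, hL'⟩ := h p
    have hL2 : L = ∑ k, (dualB k).smulRight (Φ' (Module.finBasis ℝ E k) p) := by
      ext1 x
      rw [FunLike.coe_sum, Finset.sum_apply, ← ContinuousLinearMap.coe_coe L, ← sum_dualB_smul]
      exact Finset.sum_congr rfl fun k _ => by
        rw [ContinuousLinearMap.smulRight_apply, ContinuousLinearMap.coe_coe, hL']
    have hd : dForm Φ z (p + 1) = ContinuousAlternatingMap.alternatizeUncurryFin L := by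
      rw [← hL.fderiv]
      rfl
    have hd2 : dForm Φ z (p + 1) = ∑ k, wedgeOne (dualB k) (Φ' (Module.finBasis ℝ E k) p) := by
      rw [hd, hL2, ← ContinuousAlternatingMap.alternatizeUncurryFinCLM_apply, map_sum]
      rfl
    change ContinuousAlternatingMap.toAlternatingMapLinear (R := ℝ) (dForm Φ z (p + 1)) = _
    rw [hd2, map_sum, Finset.sum_apply]
    refine Finset.sum_congr rfl fun k _ => ?_
    rw [← forget_cliff]
    simp only [forget, GKE.cliff, map_zero, zero_add]
    rfl

/-- The derivation `∑ e^k ∧ i_{A e_k}` of the algebra of forms. -/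
def derivOp (A : E →L[ℝ] E) : AForm E →ₗ[ℂ] AForm E :=
  ∑ k, (cl (0, dualB k)).comp (cl (A (Module.finBasis ℝ E k), 0))

theorem derivOp_apply (A : E →L[ℝ] E) (γ : AForm E) :
    derivOp A γ = ∑ k, cl (0, dualB k) (cl (A (Module.finBasis ℝ E k), 0) γ) := by
  rw [derivOp, LinearMap.sum_apply]
  rfl

/-- With `derivOp_cov`, the commutators that move the derivation past Clifford products. -/
theorem derivOp_vec (A : E →L[ℝ] E) (u : E) (γ : AForm E) :
    derivOp A (cl (u, 0) γ) = cl (u, 0) (derivOp A γ) - cl (A u, 0) γ := by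
  have h := sum_dualB_smul ((clVec γ).comp A.toLinearMap) u
  simp only [LinearMap.comp_apply, ContinuousLinearMap.coe_coe, clVec_apply] at h
  rw [derivOp_apply, derivOp_apply, map_sum, ← h, ← Finset.sum_sub_distrib]
  refine Finset.sum_congr rfl fun k _ => ?_
  rw [cl_vec_vec, map_neg, cl_cov_vec, Complex.coe_smul]
  abel

theorem derivOp_cov (A : E →L[ℝ] E) (ξ : E →L[ℝ] ℝ) (γ : AForm E) :
    derivOp A (cl (0, ξ) γ) = cl (0, ξ) (derivOp A γ) + cl (0, ξ.comp A) γ := by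
  have h : cl (0, ξ.comp A) γ = ∑ k, (ξ.comp A) (Module.finBasis ℝ E k) • cl (0, dualB k) γ := by
    conv_lhs => rw [← clCov_apply, ← sum_smul_dualB (ξ.comp A), map_sum]
    simp only [map_smul, clCov_apply]
  rw [derivOp_apply, derivOp_apply, map_sum, h, ← Finset.sum_add_distrib]
  refine Finset.sum_congr rfl fun k _ => ?_
  rw [cl_vec_cov, map_sub, map_smul, cl_cov_cov _ ξ, sub_neg_eq_add, Complex.coe_smul,
    ContinuousLinearMap.comp_apply, add_comm]

/-- Symmetric coefficients are contracted with the antisymmetric e^k ∧ e^l; with S the derivative of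
a 1-form this expresses its closedness. -/
theorem sum_cov_symmetric {S : E →L[ℝ] (E →L[ℝ] ℝ)} (hS : ∀ u v, S u v = S v u) (γ : AForm E) :
    ∑ k, cl (0, dualB k) (cl (0, S (Module.finBasis ℝ E k)) γ) = 0 := by
  have h : ∀ k, cl (0, dualB k) (cl (0, S (Module.finBasis ℝ E k)) γ) =
      ∑ l, S (Module.finBasis ℝ E k) (Module.finBasis ℝ E l) •
        cl (0, dualB k) (cl (0, dualB l) γ) := by
    intro k
    conv_lhs => rw [← clCov_apply γ, ← sum_smul_dualB (S _), map_sum, map_sum]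
    refine Finset.sum_congr rfl fun l _ => ?_
    rw [map_smul, clCov_apply, ← Complex.coe_smul, map_smul, Complex.coe_smul]
  have h2 : ∑ k, cl (0, dualB k) (cl (0, S (Module.finBasis ℝ E k)) γ) =
      -∑ k, cl (0, dualB k) (cl (0, S (Module.finBasis ℝ E k)) γ) := by
    conv_lhs => rw [Finset.sum_congr rfl fun k _ => h k, Finset.sum_comm]
    rw [← Finset.sum_neg_distrib]
    refine Finset.sum_congr rfl fun k _ => ?_
    rw [h k, ← Finset.sum_neg_distrib]
    refine Finset.sum_congr rfl fun l _ => ?_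
    rw [hS, cl_cov_cov, smul_neg]
  generalize ∑ k, cl (0, dualB k) (cl (0, S (Module.finBasis ℝ E k)) γ) = x at h2
  have h3 : (2 : ℂ) • x = 0 := by
    rw [two_smul]
    nth_rewrite 1 [h2]
    simp
  simpa using h3

end MixedForms

/-! ### Traces and the exterior derivative of the deformed spinor. -/

section Trace

theorem sum_det_updateCol {n : Type*} [Fintype n] [DecidableEq n] {R : Type*} [CommRing R]
    (M N : Matrix n n R) :
    ∑ i, (M.updateCol i (fun k => N k i)).det = (M.adjugate * N).trace := by
  rw [Matrix.trace]
  refine Finset.sum_congr rfl fun i _ => ?_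
  rw [← Matrix.cramer_apply, Matrix.cramer_eq_adjugate_mulVec]
  rfl

variable {E : Type*} [NormedAddCommGroup E] [NormedSpace ℂ E] [FiniteDimensional ℂ E]

/-- The complex trace of a complex linear map, as a linear form on real linear maps. -/
def ctrace : (E →L[ℝ] E) →L[ℝ] ℂ :=
  ∑ i, ((LinearMap.toContinuousLinearMap ((Module.finBasis ℂ E).coord i)).restrictScalars ℝ).comp
    (ContinuousLinearMap.apply ℝ E (Module.finBasis ℂ E i))

theorem ctrace_apply (A : E →L[ℝ] E) :
    ctrace A = ∑ i, (Module.finBasis ℂ E).repr (A (Module.finBasis ℂ E i)) i := by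
  rw [ctrace, FunLike.coe_sum, Finset.sum_apply]
  rfl

/-- The matrix of a complex linear map in the standard complex basis. -/
def cmatrix (A : E →L[ℝ] E) : Matrix (Fin (Module.finrank ℂ E)) (Fin (Module.finrank ℂ E)) ℂ :=
  Matrix.of fun i j => (Module.finBasis ℂ E).repr (A (Module.finBasis ℂ E j)) i

theorem trace_cmatrix (A : E →L[ℝ] E) : (cmatrix A).trace = ctrace A := by
  rw [ctrace_apply]
  rfl

theorem map_eq_sum_cmatrix {A : E →L[ℝ] E} (hA : ∀ x, A (Complex.I • x) = Complex.I • A x) (x : E) :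
    (A x) = ∑ j, (Module.finBasis ℂ E).repr x j • A (Module.finBasis ℂ E j) := by
  conv_lhs => rw [← (Module.finBasis ℂ E).sum_repr x, map_sum]
  exact Finset.sum_congr rfl fun j _ => map_complex_smul hA _ _

/-- With M the matrix of `x`, the sum is tr(adj(M) A M) = tr(A M adj(M)) = tr(A) det(M). -/
theorem sum_volC_update {A : E →L[ℝ] E} (hA : ∀ x, A (Complex.I • x) = Complex.I • A x)
    (x : Fin (Module.finrank ℂ E) → E) :
    ∑ i, volC E (Function.update x i (A (x i))) = ctrace A * volC E x := by
  simp only [volC_apply, Module.Basis.det_apply, Module.Basis.toMatrix_update]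
  set M := (Module.finBasis ℂ E).toMatrix x with hM
  have h : ∀ i, (fun k => (cmatrix A * M) k i) = (Module.finBasis ℂ E).repr (A (x i)) := by
    intro i
    funext k
    rw [Matrix.mul_apply, map_eq_sum_cmatrix hA (x i), map_sum, Finsupp.finsetSum_apply]
    refine Finset.sum_congr rfl fun j _ => ?_
    rw [map_smul, Finsupp.smul_apply, smul_eq_mul, mul_comm]
    rfl
  simp only [← h]
  rw [sum_det_updateCol, Matrix.trace_mul_comm, Matrix.mul_assoc, Matrix.mul_adjugate,
    Matrix.mul_smul, Matrix.mul_one, Matrix.trace_smul, trace_cmatrix, smul_eq_mul, mul_comm]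

theorem sum_volForm_update {A : E →L[ℝ] E} (hA : ∀ x, A (Complex.I • x) = Complex.I • A x) (p : ℕ)
    (x : Fin p → E) :
    ∑ i, volForm E p (Function.update x i (A (x i))) = ctrace A * volForm E p x := by
  by_cases hp : p = Module.finrank ℂ E
  · subst hp
    rw [volForm_finrank]
    exact sum_volC_update hA x
  · simp [volForm_of_ne hp]

theorem derivOp_forget_zero {E : Type*} [NormedAddCommGroup E] [NormedSpace ℝ E]
    [FiniteDimensional ℝ E] (A : E →L[ℝ] E) (φ : MForm E) : derivOp A (forget φ) 0 = 0 := by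
  rw [derivOp_apply, Finset.sum_apply]
  refine Finset.sum_eq_zero fun k _ => ?_
  ext x
  simp [cl_apply, extMul_zero, contr_apply]

theorem derivOp_forget_succ {E : Type*} [NormedAddCommGroup E] [NormedSpace ℝ E]
    [FiniteDimensional ℝ E] (A : E →L[ℝ] E) (φ : MForm E) (p : ℕ) :
    derivOp A (forget φ) (p + 1) = (ContinuousAlternatingMap.alternatizeUncurryFin
      ((φ (p + 1)).curryLeft.comp A)).toAlternatingMap := by
  have hL : (φ (p + 1)).curryLeft.comp A =
      ∑ k, (dualB k).smulRight ((φ (p + 1)).curryLeft (A (Module.finBasis ℝ E k))) := by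
    ext1 x
    rw [FunLike.coe_sum, Finset.sum_apply]
    exact (sum_dualB_smul ((φ (p + 1)).curryLeft.comp A).toLinearMap x).symm
  rw [hL, ← ContinuousAlternatingMap.alternatizeUncurryFinCLM_apply, map_sum]
  change _ = ContinuousAlternatingMap.toAlternatingMapLinear (R := ℝ) _
  rw [map_sum, derivOp_apply, Finset.sum_apply]
  refine Finset.sum_congr rfl fun k _ => ?_
  rw [← forget_cliff, ← forget_cliff]
  have h1 : ∀ q, cliff (A (Module.finBasis ℝ E k), 0) φ q =
      (φ (q + 1)).curryLeft (A (Module.finBasis ℝ E k)) := by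
    intro q
    cases q with
    | zero => rfl
    | succ q =>
      have : wedgeOne (0 : E →L[ℝ] ℝ) (φ q) = 0 := by
        rw [wedgeOne_eq, map_zero, zero_apply, map_zero]
      simp only [cliff, this, add_zero]
  generalize cliff (A (Module.finBasis ℝ E k), 0) φ = ψ at h1 ⊢
  simp only [forget, cliff, map_zero, zero_add, h1]
  rfl

theorem derivOp_volForm {A : E →L[ℝ] E} (hA : ∀ x, A (Complex.I • x) = Complex.I • A x) :
    derivOp A (forget (volForm E)) = ctrace A • forget (volForm E) := by
  have : FiniteDimensional ℝ E := FiniteDimensional.complexToReal E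
  funext p
  ext x
  change derivOp A (forget (volForm E)) p x = ctrace A * volForm E p x
  rw [← sum_volForm_update hA p x]
  cases p with
  | zero => rw [derivOp_forget_zero]; simp
  | succ p =>
    rw [derivOp_forget_succ, ContinuousAlternatingMap.coe_toAlternatingMap,
      ContinuousAlternatingMap.alternatizeUncurryFin_apply]
    refine Finset.sum_congr rfl fun i _ => ?_
    rw [← Fin.insertNth_removeNth, ContinuousAlternatingMap.map_insertNth]
    rfl

theorem cl_vec_self {E : Type*} [NormedAddCommGroup E] [NormedSpace ℂ E]
    (u : E) (γ : AForm E) : cl (u, 0) (cl (u, 0) γ) = 0 :=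
  cl_cl_self (by simp) γ

/-- Moving i_u in front of the sum costs the Clifford anticommutators, which add up to `L u`. -/
theorem sum_cov_vec {E : Type*} [NormedAddCommGroup E] [NormedSpace ℝ E] [FiniteDimensional ℝ E]
    (u : E) (L : E →ₗ[ℝ] AForm E) :
    ∑ k, cl (0, dualB k) (cl (u, 0) (L (Module.finBasis ℝ E k))) =
      L u - cl (u, 0) (∑ k, cl (0, dualB k) (L (Module.finBasis ℝ E k))) := by
  rw [← sum_dualB_smul L u, map_sum, ← Finset.sum_sub_distrib]
  exact Finset.sum_congr rfl fun k _ => by rw [cl_cov_vec, Complex.coe_smul]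

/-- Derivatives of θ and τ alone contribute nothing, as these forms are closed. Derivatives of V and
W enter through `derivOp` and through V' W - W' V = 0. Invariance of θ and τ cancels the action of
`derivOp` on θ ∧ τ ∧ vol, so only the traces on vol survive. -/
theorem forget_dForm_spinM {V W : E → E} {θ τ : E → (E →L[ℝ] ℝ)} {V' W' : E →L[ℝ] E}
    {θ' τ' : E →L[ℝ] (E →L[ℝ] ℝ)} {z : E} (dV : HasFDerivAt V V' z) (dW : HasFDerivAt W W' z)
    (dθ : HasFDerivAt θ θ' z) (dτ : HasFDerivAt τ τ' z)
    (hV : ∀ x, V' (Complex.I • x) = Complex.I • V' x)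
    (hW : ∀ x, W' (Complex.I • x) = Complex.I • W' x) (hVW : V' (W z) = W' (V z))
    (hθ : ∀ u v, θ' u v = θ' v u) (hτ : ∀ u v, τ' u v = τ' v u)
    (hθV : θ' (V z) = -(θ z).comp V') (hθW : θ' (W z) = -(θ z).comp W')
    (hτV : τ' (V z) = -(τ z).comp V') (hτW : τ' (W z) = -(τ z).comp W') (t : ℝ) :
    forget (dForm (fun y => spinM (V y) (W y) (θ y) (τ y) t (volForm E)) z) =
      (t : ℂ) • (ctrace V' • cl (W z, 0) (forget (spinM (V z) (W z) (θ z) (τ z) t (volForm E))) -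
        ctrace W' • cl (V z, 0) (forget (spinM (V z) (W z) (θ z) (τ z) t (volForm E)))) := by
  have : FiniteDimensional ℝ E := FiniteDimensional.complexToReal E
  have eV : HasFDerivAt (fun y => ((V y, 0) : GT E)) ((ContinuousLinearMap.inl ℝ E (E →L[ℝ] ℝ)).comp V') z :=
    (ContinuousLinearMap.inl ℝ E (E →L[ℝ] ℝ)).hasFDerivAt.comp z dV
  have eW : HasFDerivAt (fun y => ((W y, 0) : GT E)) ((ContinuousLinearMap.inl ℝ E (E →L[ℝ] ℝ)).comp W') z :=
    (ContinuousLinearMap.inl ℝ E (E →L[ℝ] ℝ)).hasFDerivAt.comp z dW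
  have eθ : HasFDerivAt (fun y => ((0, θ y) : GT E)) ((ContinuousLinearMap.inr ℝ E (E →L[ℝ] ℝ)).comp θ') z :=
    (ContinuousLinearMap.inr ℝ E (E →L[ℝ] ℝ)).hasFDerivAt.comp z dθ
  have eτ : HasFDerivAt (fun y => ((0, τ y) : GT E)) ((ContinuousLinearMap.inr ℝ E (E →L[ℝ] ℝ)).comp τ') z :=
    (ContinuousLinearMap.inr ℝ E (E →L[ℝ] ℝ)).hasFDerivAt.comp z dτ
  have hα := (hasMDeriv_const (volForm E) z).add
    ((((hasMDeriv_const (volForm E) z).cliff eτ).cliff eθ).const_smul (t : ℂ))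
  have hΦ := hα.add (((hα.cliff eW).cliff eV).const_smul (t : ℂ))
  have h0 : forget (0 : MForm E) = 0 := rfl
  have h1 := hΦ.forget_dForm
  simp only [forget_add, forget_smul, forget_cliff, h0, map_zero, add_zero, zero_add,
    ContinuousLinearMap.comp_apply, ContinuousLinearMap.inl_apply,
    ContinuousLinearMap.inr_apply] at h1
  have hspin : ∀ y, spinM (V y) (W y) (θ y) (τ y) t (volForm E) =
    (volForm E + (t : ℂ) • cliff (0, θ y) (cliff (0, τ y) (volForm E))) +
    (t : ℂ) • cliff (V y, 0) (cliff (W y, 0)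
      (volForm E + (t : ℂ) • cliff (0, θ y) (cliff (0, τ y) (volForm E)))) := fun y => rfl
  simp only [hspin]
  rw [h1]
  simp only [forget_add, forget_smul, forget_cliff]
  generalize hν : forget (volForm E) = ν
  have hf : derivOp V' ν = ctrace V' • ν := by rw [← hν, derivOp_volForm hV]
  have hh : derivOp W' ν = ctrace W' • ν := by rw [← hν, derivOp_volForm hW]
  generalize ctrace V' = f at hf ⊢
  generalize ctrace W' = h at hh ⊢
  -- `β x` is the directional derivative of ν + t θ ∧ τ ∧ ν along `x`, where ν is the constant
  -- volume form.
  set β : E →ₗ[ℝ] AForm E := t • ((clCov (cl (0, τ z) ν)).comp θ'.toLinearMap +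
    ((cl (0, θ z)).restrictScalars ℝ).comp ((clCov ν).comp τ'.toLinearMap)) with hβ
  have hβa : ∀ x, β x = (t : ℂ) • (cl (0, θ' x) (cl (0, τ z) ν) + cl (0, θ z) (cl (0, τ' x) ν)) := by
    intro x
    rw [Complex.coe_smul]
    rfl
  simp only [← hβa]
  set κ := cl (0, θ z) (cl (0, τ z) ν) with hκ
  set α := ν + (t : ℂ) • κ with hα'
  -- Along a field that preserves θ and τ, the derivative of θ ∧ τ ∧ ν is minus the derivation,
  -- corrected by the trace that it produces on ν.
  have hκD : ∀ (A : E →L[ℝ] E) (c : ℂ) (u : E), derivOp A ν = c • ν → θ' u = -(θ z).comp A →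
      τ' u = -(τ z).comp A → β u = -((t : ℂ) • (derivOp A κ - c • κ)) := by
    intro A c u hA hθu hτu
    have hneg : ∀ (ξ : E →L[ℝ] ℝ) γ, cl (0, -ξ) γ = -cl (0, ξ) γ := fun ξ γ => by
      rw [← clCov_apply, map_neg, clCov_apply]
    rw [hβa, hθu, hτu, hκ, derivOp_cov, derivOp_cov, hA, hneg, hneg, map_neg, map_add, map_smul,
      map_smul]
    module
  have hβV := hκD V' f (V z) hf hθV hτV
  have hβW := hκD W' h (W z) hh hθW hτW
  have hsumβ : ∑ k, cl (0, dualB k) (β (Module.finBasis ℝ E k)) = 0 := by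
    simp only [hβa, map_smul, map_add]
    rw [← Finset.smul_sum, Finset.sum_add_distrib, sum_cov_symmetric hθ, zero_add]
    have : ∀ k, cl (0, dualB k) (cl (0, θ z) (cl (0, τ' (Module.finBasis ℝ E k)) ν)) =
        -cl (0, θ z) (cl (0, dualB k) (cl (0, τ' (Module.finBasis ℝ E k)) ν)) := fun k =>
      cl_cov_cov _ _ _
    simp only [this]
    rw [Finset.sum_neg_distrib, ← map_sum, sum_cov_symmetric hτ, map_zero, neg_zero, smul_zero]
  have hsum3 : ∑ k, cl (0, dualB k) (cl (V z, 0) (cl (W z, 0) (β (Module.finBasis ℝ E k)))) =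
      cl (W z, 0) (β (V z)) - cl (V z, 0) (β (W z)) := by
    have h2 := sum_cov_vec (V z) (((cl (W z, 0)).restrictScalars ℝ).comp β)
    have h3 := sum_cov_vec (W z) β
    simp only [LinearMap.comp_apply, LinearMap.restrictScalars_apply] at h2
    rw [h2, h3, hsumβ, map_zero, sub_zero]
  have hsum2 : ∑ k, cl (0, dualB k) (cl (V z, 0) (cl (W' (Module.finBasis ℝ E k), 0) α)) =
      cl (W' (V z), 0) α - cl (V z, 0) (derivOp W' α) := by
    have h2 := sum_cov_vec (V z) ((clVec α).comp W'.toLinearMap)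
    simp only [LinearMap.comp_apply, ContinuousLinearMap.coe_coe, clVec_apply] at h2
    rw [h2, derivOp_apply]
  simp only [map_add, map_smul, Finset.sum_add_distrib, ← Finset.smul_sum]
  rw [hsumβ, zero_add, hsum3, hsum2, ← derivOp_apply, derivOp_vec, hVW, hβV, hβW]
  have hDV : derivOp V' α = f • ν + (t : ℂ) • derivOp V' κ := by rw [hα', map_add, hf, map_smul]
  have hDW : derivOp W' α = h • ν + (t : ℂ) • derivOp W' κ := by rw [hα', map_add, hh, map_smul]
  -- Since W V W = 0 and V V = 0 as Clifford products, `α` and the full spinor agree under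
  -- multiplication by V and by W.
  have hz1 : cl (W z, 0) (cl (V z, 0) (cl (W z, 0) α)) = 0 := by
    rw [cl_vec_vec, cl_vec_self, map_zero, neg_zero]
  rw [hDV, hDW, cl_vec_self, hz1]
  rw [hα']
  simp only [map_add, map_smul, map_neg, map_sub, smul_zero]
  module

/-- The element -K b + i b lies in the -i-eigenspace and annihilates φ, so i b acts on φ as the real
element K b. -/
theorem dForm_eq_cliff {E : Type*} [NormedAddCommGroup E] [NormedSpace ℂ E]
    {K : GT E →L[ℝ] GT E} (hsq : ∀ u, K (K u) = -u) {φ δ : MForm E}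
    (hφ : IsSpinorOf K φ) {a b : GT E} (h : δ = cliff a φ + Complex.I • cliff b φ) :
    δ = cliff (a + K b) φ := by
  have h1 := (hφ (-(K b)) b).2 ⟨by rw [map_neg, hsq, neg_neg], by rw [neg_neg]⟩
  apply forget_injective
  have h2 := congrArg forget h1
  rw [forget_add, forget_smul, forget_cliff, forget_cliff] at h2
  have h0 : forget (0 : MForm E) = 0 := rfl
  have h3 : cl (-(K b)) (forget φ) = -cl (K b) (forget φ) := by
    have := cl_smul (-1) (K b)
    rw [neg_one_smul] at this
    rw [this]
    simp
  rw [h0, h3] at h2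
  rw [h, forget_add, forget_smul, forget_cliff, forget_cliff, forget_cliff, cl_add,
    LinearMap.add_apply, add_right_inj]
  exact (neg_add_eq_zero.mp h2).symm

end Trace

/-! ### Local consequences of two commuting holomorphic Hamiltonian fields. -/

section LocalModel

variable {E : Type*} [NormedAddCommGroup E] [NormedSpace ℂ E]

/-- A Kähler form `w` and two commuting holomorphic Hamiltonian vector fields on an open set. -/
structure LocalData (w : E → Form2 E) (V W : E → E) (U : Set E) : Prop where
  isOpen : IsOpen U
  smooth_w : ContDiffOn ℝ ∞ w U
  closed_w : ∀ y ∈ U, extDeriv w y = 0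
  positive : ∀ y ∈ U, IsPositive (w y)
  smooth_V : ContDiffOn ℝ ∞ V U
  smooth_W : ContDiffOn ℝ ∞ W U
  holomorphic_V : ∀ y ∈ U, ∀ x, fderiv ℝ V y (Complex.I • x) = Complex.I • fderiv ℝ V y x
  holomorphic_W : ∀ y ∈ U, ∀ x, fderiv ℝ W y (Complex.I • x) = Complex.I • fderiv ℝ W y x
  hamiltonian_V : ∀ y ∈ U, ∀ u v, fderiv ℝ (fun z => flat (w z) (V z)) y u v =
    fderiv ℝ (fun z => flat (w z) (V z)) y v u
  hamiltonian_W : ∀ y ∈ U, ∀ u v, fderiv ℝ (fun z => flat (w z) (W z)) y u v =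
    fderiv ℝ (fun z => flat (w z) (W z)) y v u
  isotropic : ∀ y ∈ U, flat (w y) (V y) (W y) = 0

theorem LocalData.symm {w : E → Form2 E} {V W : E → E} {U : Set E} (h : LocalData w V W U) :
    LocalData w W V U :=
  { h with
    smooth_V := h.smooth_W
    smooth_W := h.smooth_V
    holomorphic_V := h.holomorphic_W
    holomorphic_W := h.holomorphic_V
    hamiltonian_V := h.hamiltonian_W
    hamiltonian_W := h.hamiltonian_V
    isotropic := fun y hy => by rw [flat_swap, h.isotropic y hy, neg_zero] }

theorem _root_.ContDiffOn.hasFDerivAt_of_isOpen {F G : Type*} [NormedAddCommGroup F]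
    [NormedSpace ℝ F] [NormedAddCommGroup G] [NormedSpace ℝ G] {f : F → G} {U : Set F}
    (hf : ContDiffOn ℝ ∞ f U) (hU : IsOpen U) {y : F} (hy : y ∈ U) :
    HasFDerivAt f (fderiv ℝ f y) y :=
  ((hf.contDiffAt (hU.mem_nhds hy)).differentiableAt (by simp)).hasFDerivAt

theorem _root_.ContDiffOn.fderiv_infty {F G : Type*} [NormedAddCommGroup F]
    [NormedSpace ℝ F] [NormedAddCommGroup G] [NormedSpace ℝ G] {f : F → G} {U : Set F}
    (hf : ContDiffOn ℝ ∞ f U) (hU : IsOpen U) : ContDiffOn ℝ ∞ (fderiv ℝ f) U :=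
  hf.fderiv_of_isOpen hU le_rfl

variable {w : E → Form2 E} {V W : E → E} {U : Set E}

theorem LocalData.closedField (h : LocalData w V W U) : IsClosedField (fun z => flat (w z)) U :=
  isClosedField_flat h.isOpen h.smooth_w h.closed_w

theorem LocalData.smooth_flat_V (h : LocalData w V W U) :
    ContDiffOn ℝ ∞ (fun z => flat (w z) (V z)) U := h.closedField.smooth.clm_apply h.smooth_V

theorem LocalData.isIsotropicData (h : LocalData w V W U) {y : E} (hy : y ∈ U) :
    IsIsotropicData (V y) (W y) (flat (w y) (V y)) (flat (w y) (W y)) :=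
  ⟨flat_self _ _, h.isotropic y hy, h.symm.isotropic y hy, flat_self _ _⟩

theorem LocalData.fderiv_flat_apply (h : LocalData w V W U) {y : E} (hy : y ∈ U) (u v : E) :
    fderiv ℝ (fun z => flat (w z) (V z)) y u v =
      fderiv ℝ (fun z => flat (w z)) y u (V y) v + flat (w y) (fderiv ℝ V y u) v := by
  have h1 := (h.closedField.smooth.hasFDerivAt_of_isOpen h.isOpen hy).clm_apply
    (h.smooth_V.hasFDerivAt_of_isOpen h.isOpen hy)
  rw [h1.fderiv]
  simp
  ring

theorem LocalData.fderiv_flat_swap (h : LocalData w V W U) {y : E} (hy : y ∈ U) (x u v : E) :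
    fderiv ℝ (fun z => flat (w z)) y x u v = -fderiv ℝ (fun z => flat (w z)) y x v u := by
  have hd := ((h.smooth_w.contDiffAt (h.isOpen.mem_nhds hy)).differentiableAt (by simp))
  rw [fderiv_flat hd, fderiv_flat hd, ← flat_apply, ← flat_apply, flat_swap]

/-- The Lie derivative of `w` along `V` vanishes. -/
theorem LocalData.lie_w (h : LocalData w V W U) {y : E} (hy : y ∈ U) (u v : E) :
    fderiv ℝ (fun z => flat (w z)) y (V y) u v =
      -(flat (w y) (fderiv ℝ V y u) v + flat (w y) u (fderiv ℝ V y v)) := by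
  have h1 := h.hamiltonian_V y hy u v
  rw [h.fderiv_flat_apply hy, h.fderiv_flat_apply hy] at h1
  have h2 := h.closedField.closed y hy u v (V y)
  have h3 := h.fderiv_flat_swap hy u v (V y)
  have h4 := flat_swap (w y) u (fderiv ℝ V y v)
  linarith

/-- If a closed `1`-form `ξ` is constant on `X`, then `L_X ξ = 0`. -/
theorem fderiv_eq_neg_comp {ξ : E → (E →L[ℝ] ℝ)} {X : E → E} {U : Set E} (hU : IsOpen U)
    (hξ : ContDiffOn ℝ ∞ ξ U) (hX : ContDiffOn ℝ ∞ X U)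
    (hcl : ∀ y ∈ U, ∀ u v, fderiv ℝ ξ y u v = fderiv ℝ ξ y v u) (h0 : ∀ y ∈ U, ξ y (X y) = 0) {y : E}
    (hy : y ∈ U) : fderiv ℝ ξ y (X y) = -(ξ y).comp (fderiv ℝ X y) := by
  have h1 := (hξ.hasFDerivAt_of_isOpen hU hy).clm_apply (hX.hasFDerivAt_of_isOpen hU hy)
  have h2 : HasFDerivAt (fun z => ξ z (X z)) (0 : E →L[ℝ] ℝ) y := by
    refine (hasFDerivAt_const (0 : ℝ) y).congr_of_eventuallyEq ?_
    filter_upwards [hU.mem_nhds hy] with z hz using h0 z hz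
  ext x
  have h3 := congrArg (fun L : E →L[ℝ] ℝ => L x) (h1.unique h2)
  simp at h3
  rw [hcl y hy, neg_apply, ContinuousLinearMap.comp_apply]
  linarith

/-- i_{[V,W]} ω = L_V i_W ω - i_W L_V ω, and both terms vanish; ω is nondegenerate. -/
theorem LocalData.commute (h : LocalData w V W U) {y : E} (hy : y ∈ U) :
    fderiv ℝ V y (W y) = fderiv ℝ W y (V y) := by
  rw [← sub_eq_zero]
  apply (h.positive y hy).flat_injective
  ext x
  have h1 := h.lie_w hy (W y) x
  have h2 := congrArg (fun L : E →L[ℝ] ℝ => L x) (fderiv_eq_neg_comp h.isOpen h.symm.smooth_flat_V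
    h.smooth_V h.hamiltonian_W h.symm.isotropic hy)
  simp only [h.symm.fderiv_flat_apply hy, neg_apply, ContinuousLinearMap.comp_apply] at h2
  rw [map_sub, sub_apply, zero_apply]
  linarith

variable [FiniteDimensional ℂ E]

/-- Jacobi's formula. The transposes appear because `Matrix.detRowAlternating` is multilinear in
rows while the trace identity replaces columns. -/
theorem hasFDerivAt_det {E : Type*} [NormedAddCommGroup E] [NormedSpace ℂ E]
    {n : Type*} [Fintype n] [DecidableEq n] {H : E → Matrix n n ℂ} {y : E}
    {H' : n → n → E →L[ℝ] ℂ} (hH : ∀ i j, HasFDerivAt (fun z => H z i j) (H' i j) y) :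
    ∃ L : E →L[ℝ] ℂ, HasFDerivAt (fun z => (H z).det) L y ∧
      ∀ x, L x = ((H y).adjugate * Matrix.of fun i j => H' i j x).trace := by
  let D : ContinuousMultilinearMap ℝ (fun _ : n => n → ℂ) ℂ :=
    { toMultilinearMap := (Matrix.detRowAlternating (n := n) (R := ℂ)).toMultilinearMap.restrictScalars ℝ
      cont := by
        change Continuous fun M : n → n → ℂ => Matrix.det M
        exact Continuous.matrix_det continuous_id }
  have hT : HasFDerivAt (fun z => fun j i => H z i j)
      (ContinuousLinearMap.pi fun j => ContinuousLinearMap.pi fun i => H' i j) y :=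
    hasFDerivAt_pi.2 fun j => hasFDerivAt_pi.2 fun i => hH i j
  have hD := (D.hasFDerivAt (fun j i => H y i j)).comp y hT
  have hval : ∀ z, (H z).det = D (fun j i => H z i j) := fun z => (Matrix.det_transpose _).symm
  refine ⟨_, hD.congr_of_eventuallyEq (Filter.Eventually.of_forall hval), fun x => ?_⟩
  rw [ContinuousLinearMap.comp_apply, ContinuousMultilinearMap.linearDeriv_apply,
    ← sum_det_updateCol]
  refine Finset.sum_congr rfl fun j _ => ?_
  rw [← Matrix.det_transpose]
  have e : (Function.update (fun j i => H y i j) j (fun i => H' i j x) : n → n → ℂ) =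
      ((H y).updateCol j fun i => H' i j x).transpose := by
    funext a b
    by_cases hab : a = j
    · subst hab
      simp
    · simp [hab]
  exact congrArg Matrix.det e

theorem smooth_det {E : Type*} [NormedAddCommGroup E] [NormedSpace ℂ E]
    {n : Type*} [Fintype n] [DecidableEq n] {H : E → Matrix n n ℂ} {U : Set E}
    (hH : ∀ i j, ContDiffOn ℝ ∞ (fun z => H z i j) U) : ContDiffOn ℝ ∞ (fun z => (H z).det) U := by
  simp only [Matrix.det_apply]
  refine ContDiffOn.sum fun σ _ => ?_
  refine ContDiffOn.const_smul _ ?_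
  exact contDiffOn_prod fun i _ => hH _ _

theorem LocalData.smooth_hermMatrix (h : LocalData w V W U) (i j) :
    ContDiffOn ℝ ∞ (fun z => hermMatrix (w z) i j) U := by
  have h1 : ∀ u v : E, ContDiffOn ℝ ∞ (fun z => ((flat (w z) u v : ℝ) : ℂ)) U := fun u v =>
    Complex.ofRealCLM.contDiff.comp_contDiffOn
      ((h.closedField.smooth.clm_apply contDiffOn_const).clm_apply contDiffOn_const)
  simp only [← herm_eq_hermMatrix, herm]
  exact (h1 _ _).sub (contDiffOn_const.mul (h1 _ _))

/-- Invariance of ω under V makes the derivative of the Hermitian matrix H equal to -(Aᵀ H + H Ā),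
with A the complex matrix of the derivative of V; Jacobi's formula then leaves the two traces. -/
theorem LocalData.fderiv_det (h : LocalData w V W U) {y : E} (hy : y ∈ U) :
    fderiv ℝ (fun z => (hermMatrix (w z)).det) y (V y) =
      -(ctrace (fderiv ℝ V y) + starRingEnd ℂ (ctrace (fderiv ℝ V y))) * (hermMatrix (w y)).det := by
  obtain ⟨L, hL, hLx⟩ := hasFDerivAt_det fun i j =>
    (h.smooth_hermMatrix i j).hasFDerivAt_of_isOpen h.isOpen hy
  rw [hL.fderiv, hLx]
  set A := cmatrix (fderiv ℝ V y) with hA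
  have hherm : ∀ i j, fderiv ℝ (fun z => hermMatrix (w z) i j) y (V y) =
      -(herm (w y) (fderiv ℝ V y (Module.finBasis ℂ E i)) (Module.finBasis ℂ E j) +
        herm (w y) (Module.finBasis ℂ E i) (fderiv ℝ V y (Module.finBasis ℂ E j))) := by
    intro i j
    have d1 : ∀ u v : E, HasFDerivAt (fun z => ((flat (w z) u v : ℝ) : ℂ)) _ y := fun u v =>
      Complex.ofRealCLM.hasFDerivAt.comp y
        (((h.closedField.smooth.hasFDerivAt_of_isOpen h.isOpen hy).clm_apply
          (hasFDerivAt_const u y)).clm_apply (hasFDerivAt_const v y))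
    simp only [← herm_eq_hermMatrix, herm]
    rw [((d1 _ _).fun_sub ((d1 _ _).const_mul Complex.I)).fderiv]
    simp [h.lie_w hy, h.holomorphic_V y hy]
    ring
  have hB : (Matrix.of fun i j => fderiv ℝ (fun z => hermMatrix (w z) i j) y (V y)) =
      -(A.transpose * hermMatrix (w y) + hermMatrix (w y) * A.map (starRingEnd ℂ)) := by
    ext i j
    rw [Matrix.of_apply, hherm, Matrix.neg_apply, Matrix.add_apply, Matrix.mul_apply,
      Matrix.mul_apply, ← (Module.finBasis ℂ E).sum_repr (fderiv ℝ V y (Module.finBasis ℂ E i)),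
      ← (Module.finBasis ℂ E).sum_repr (fderiv ℝ V y (Module.finBasis ℂ E j)), herm_sum_left,
      herm_sum_right]
    congr 2
    · refine Finset.sum_congr rfl fun k _ => ?_
      rw [(h.positive y hy).herm_smul_left, herm_eq_hermMatrix]
      rfl
    · refine Finset.sum_congr rfl fun k _ => ?_
      rw [herm_smul_right, herm_eq_hermMatrix, mul_comm]
      rfl
  rw [hB, Matrix.mul_neg, Matrix.trace_neg, Matrix.mul_add, Matrix.trace_add, ← Matrix.mul_assoc,
    ← Matrix.mul_assoc, Matrix.adjugate_mul, Matrix.trace_mul_cycle, Matrix.mul_adjugate,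
    Matrix.smul_mul, Matrix.one_mul, Matrix.smul_mul, Matrix.one_mul, Matrix.trace_smul,
    Matrix.trace_smul, Matrix.trace_transpose, hA, trace_cmatrix]
  have h5 : ((cmatrix (fderiv ℝ V y)).map (starRingEnd ℂ)).trace =
      starRingEnd ℂ (ctrace (fderiv ℝ V y)) := by
    rw [← trace_cmatrix, Matrix.trace, Matrix.trace, map_sum]
    rfl
  rw [h5, smul_eq_mul, smul_eq_mul]
  ring

/-- The logarithm of the determinant of the metric. -/
def logDet (w : E → Form2 E) (y : E) : ℝ := Real.log (hermMatrix (w y)).det.re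

theorem LocalData.hasFDerivAt_re_det (h : LocalData w V W U) {y : E} (hy : y ∈ U) :
    HasFDerivAt (fun z => (hermMatrix (w z)).det.re)
      (Complex.reCLM.comp (fderiv ℝ (fun z => (hermMatrix (w z)).det) y)) y :=
  Complex.reCLM.hasFDerivAt.comp y
    ((smooth_det h.smooth_hermMatrix).hasFDerivAt_of_isOpen h.isOpen hy)

theorem LocalData.smooth_re_det (h : LocalData w V W U) :
    ContDiffOn ℝ ∞ (fun z => (hermMatrix (w z)).det.re) U :=
  Complex.reCLM.contDiff.comp_contDiffOn (smooth_det h.smooth_hermMatrix)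

theorem LocalData.hasFDerivAt_logDet (h : LocalData w V W U) {y : E} (hy : y ∈ U) :
    HasFDerivAt (logDet w) (((hermMatrix (w y)).det.re)⁻¹ •
      Complex.reCLM.comp (fderiv ℝ (fun z => (hermMatrix (w z)).det) y)) y :=
  (h.hasFDerivAt_re_det hy).log ((h.positive y hy).det_re_pos.1.ne')

theorem LocalData.fderiv_logDet (h : LocalData w V W U) {y : E} (hy : y ∈ U) :
    fderiv ℝ (logDet w) y (V y) = -2 * (ctrace (fderiv ℝ V y)).re := by
  obtain ⟨hpos, hre⟩ := (h.positive y hy).det_re_pos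
  rw [(h.hasFDerivAt_logDet hy).fderiv, smul_apply, ContinuousLinearMap.comp_apply, h.fderiv_det hy,
    ← hre, Complex.reCLM_apply, Complex.re_mul_ofReal, smul_eq_mul]
  have : (hermMatrix (w y)).det.re ≠ 0 := hpos.ne'
  rw [Complex.ofReal_re, mul_comm, mul_assoc, mul_inv_cancel₀ this, mul_one]
  simp
  ring

end LocalModel

/-! ### Smooth dependence of the structures on parameters. -/

section Smoothness

variable {X : Type*} [NormedAddCommGroup X] [NormedSpace ℝ X] {S : Set X}

theorem contDiffOn_nilMap {E : Type*} [NormedAddCommGroup E] [NormedSpace ℝ E] {V W : X → E}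
    {θ τ : X → (E →L[ℝ] ℝ)} {e : X → GT E} (hV : ContDiffOn ℝ ∞ V S) (hW : ContDiffOn ℝ ∞ W S)
    (hθ : ContDiffOn ℝ ∞ θ S) (hτ : ContDiffOn ℝ ∞ τ S) (he : ContDiffOn ℝ ∞ e S) :
    ContDiffOn ℝ ∞ (fun x => nilMap (V x) (W x) (θ x) (τ x) (e x)) S := by
  simp only [nilMap_apply]
  exact (((he.snd.clm_apply hW).smul hV).sub ((he.snd.clm_apply hV).smul hW)).prodMk
    (((hτ.clm_apply he.fst).smul hθ).sub ((hθ.clm_apply he.fst).smul hτ))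

theorem contDiffOn_rot {E : Type*} [NormedAddCommGroup E] [NormedSpace ℝ E] {V W : X → E}
    {θ τ : X → (E →L[ℝ] ℝ)} {e : X → GT E} {t : X → ℝ} (ht : ContDiffOn ℝ ∞ t S)
    (hV : ContDiffOn ℝ ∞ V S) (hW : ContDiffOn ℝ ∞ W S)
    (hθ : ContDiffOn ℝ ∞ θ S) (hτ : ContDiffOn ℝ ∞ τ S) (he : ContDiffOn ℝ ∞ e S) :
    ContDiffOn ℝ ∞ (fun x => rot (t x) (V x) (W x) (θ x) (τ x) (e x)) S := by
  simp only [rot_apply]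
  exact he.add (ht.smul (contDiffOn_nilMap hV hW hθ hτ he))

variable {E : Type*} [NormedAddCommGroup E] [NormedSpace ℂ E]

theorem contDiffOn_deform_apply {V W : X → E} {θ τ : X → (E →L[ℝ] ℝ)} {e : X → GT E} {t : X → ℝ}
    (ht : ContDiffOn ℝ ∞ t S) (hV : ContDiffOn ℝ ∞ V S) (hW : ContDiffOn ℝ ∞ W S)
    (hθ : ContDiffOn ℝ ∞ θ S) (hτ : ContDiffOn ℝ ∞ τ S) (he : ContDiffOn ℝ ∞ e S) :
    ContDiffOn ℝ ∞ (fun x => deform (t x) (V x) (W x) (θ x) (τ x) (e x)) S := by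
  simp only [deform_apply]
  exact contDiffOn_rot ht hV hW hθ hτ ((ofComplex (cplx E)).contDiff.comp_contDiffOn
    (contDiffOn_rot ht.neg hV hW hθ hτ he))

variable [FiniteDimensional ℂ E]

theorem contDiffOn_deform {V W : X → E} {θ τ : X → (E →L[ℝ] ℝ)} {t : X → ℝ}
    (ht : ContDiffOn ℝ ∞ t S) (hV : ContDiffOn ℝ ∞ V S) (hW : ContDiffOn ℝ ∞ W S)
    (hθ : ContDiffOn ℝ ∞ θ S) (hτ : ContDiffOn ℝ ∞ τ S) :
    ContDiffOn ℝ ∞ (fun x => deform (t x) (V x) (W x) (θ x) (τ x)) S :=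
  contDiffOn_clm_apply.2 fun _ => contDiffOn_deform_apply ht hV hW hθ hτ contDiffOn_const

theorem contDiffOn_ofSymplectic {w : X → Form2 E} (hw : ContDiffOn ℝ ∞ w S)
    (hnd : ∀ x ∈ S, ∀ v, flat (w x) v = 0 → v = 0) :
    ContDiffOn ℝ ∞ (fun x => ofSymplectic (w x)) S := by
  have : CompleteSpace E := FiniteDimensional.complete ℝ E
  have hf : ContDiffOn ℝ ∞ (fun x => flat (w x)) S := (flatL (E := E)).contDiff.comp_contDiffOn hw
  have hi : ContDiffOn ℝ ∞ (fun x => (flat (w x)).inverse) S := by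
    intro x hx
    have h1 := contDiffAt_map_inverse (n := ∞) (𝕜 := ℝ) (flatEquiv (w x) (hnd x hx))
    rw [coe_flatEquiv] at h1
    exact h1.comp_contDiffWithinAt x (hf x hx)
  refine contDiffOn_clm_apply.2 fun e => ?_
  simp only [ofSymplectic_apply]
  exact ((hi.clm_apply contDiffOn_const).neg).prodMk (hf.clm_apply contDiffOn_const)

end Smoothness

/-! ### The trivialization of the canonical line and the Ricci section. -/

section Trivialization

variable {E : Type*} [NormedAddCommGroup E] [NormedSpace ℂ E] [FiniteDimensional ℂ E]

/-- The real section `η` with `dφ = η · φ` for the deformed volume form `φ`. -/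
def etaField (V W : E → E) (K : E → (GT E →L[ℝ] GT E)) (t : ℝ) (y : E) : GT E :=
  (t • ((ctrace (fderiv ℝ V y)).re • W y - (ctrace (fderiv ℝ W y)).re • V y), 0) +
    K y (t • ((ctrace (fderiv ℝ V y)).im • W y - (ctrace (fderiv ℝ W y)).im • V y), 0)

/-- The ratio of the norms of the deformed volume form and `exp (i w)`. -/
def rhoField (w : E → Form2 E) (y : E) : ℝ :=
  (-1) ^ Module.finrank ℂ E * ((hermMatrix (w y)).det.re)⁻¹

variable {w : E → Form2 E} {V W : E → E} {U : Set E}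

theorem LocalData.isTrivialization (h : LocalData w V W U) (t : ℝ) {K : E → (GT E →L[ℝ] GT E)}
    (hK : ∀ y ∈ U, K y = deform t (V y) (W y) (flat (w y) (V y)) (flat (w y) (W y))) :
    IsTrivialization (2 * Module.finrank ℂ E) K (fun _ => 0) w U
      (fun y => spinM (V y) (W y) (flat (w y) (V y)) (flat (w y) (W y)) t (volForm E))
      (etaField V W K t) (rhoField w) where
  smooth_φ := by
    have e1 : ∀ {V : E → E}, ContDiffOn ℝ ∞ V U → ContDiffOn ℝ ∞ (fun y => ((V y, 0) : GT E)) U :=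
      fun h => h.prodMk contDiffOn_const
    have e2 : ∀ {θ : E → (E →L[ℝ] ℝ)}, ContDiffOn ℝ ∞ θ U →
      ContDiffOn ℝ ∞ (fun y => ((0, θ y) : GT E)) U := fun h => contDiffOn_const.prodMk h
    have h0 : SmoothM (fun _ : E => volForm E) U := fun p => contDiffOn_const
    have hα := h0.add (((h0.cliff (e2 h.symm.smooth_flat_V)).cliff (e2 h.smooth_flat_V)).const_smul (t : ℂ))
    exact hα.add (((hα.cliff (e1 h.smooth_W)).cliff (e1 h.smooth_V)).const_smul (t : ℂ))
  smooth_η := by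
    have tr : ∀ {V : E → E}, ContDiffOn ℝ ∞ V U → ContDiffOn ℝ ∞ (fun y => ctrace (fderiv ℝ V y)) U :=
      fun hV => (ctrace (E := E)).contDiff.comp_contDiffOn (hV.fderiv_infty h.isOpen)
    have re : ∀ {V : E → E}, ContDiffOn ℝ ∞ V U →
        ContDiffOn ℝ ∞ (fun y => (ctrace (fderiv ℝ V y)).re) U :=
      fun hV => Complex.reCLM.contDiff.comp_contDiffOn (tr hV)
    have im : ∀ {V : E → E}, ContDiffOn ℝ ∞ V U →
        ContDiffOn ℝ ∞ (fun y => (ctrace (fderiv ℝ V y)).im) U :=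
      fun hV => Complex.imCLM.contDiff.comp_contDiffOn (tr hV)
    have hV := h.smooth_V
    have hW := h.smooth_W
    have h1 : ContDiffOn ℝ ∞ (fun y => ((t • ((ctrace (fderiv ℝ V y)).re • W y -
        (ctrace (fderiv ℝ W y)).re • V y), 0) : GT E)) U :=
      ((((re hV).smul hW).sub ((re hW).smul hV)).const_smul t).prodMk contDiffOn_const
    have h2 : ContDiffOn ℝ ∞ (fun y => ((t • ((ctrace (fderiv ℝ V y)).im • W y -
        (ctrace (fderiv ℝ W y)).im • V y), 0) : GT E)) U :=
      ((((im hV).smul hW).sub ((im hW).smul hV)).const_smul t).prodMk contDiffOn_const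
    have hKs : ContDiffOn ℝ ∞ K U := (contDiffOn_deform (contDiffOn_const (c := t)) hV hW
      h.smooth_flat_V h.symm.smooth_flat_V).congr hK
    exact h1.add (hKs.clm_apply h2)
  smooth_ρ := contDiffOn_const.mul
    (h.smooth_re_det.inv fun y hy => ((h.positive y hy).det_re_pos.1.ne'))
  spinor y hy := by
    rw [hK y hy]
    exact (h.isIsotropicData hy).isSpinorOf_deform t
  dφ y hy := by
    have hiso := h.isIsotropicData hy
    have dV := h.smooth_V.hasFDerivAt_of_isOpen h.isOpen hy
    have dW := h.smooth_W.hasFDerivAt_of_isOpen h.isOpen hy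
    have dθ := h.smooth_flat_V.hasFDerivAt_of_isOpen h.isOpen hy
    have dτ := h.symm.smooth_flat_V.hasFDerivAt_of_isOpen h.isOpen hy
    have hd := forget_dForm_spinM dV dW dθ dτ (h.holomorphic_V y hy) (h.holomorphic_W y hy)
      (h.commute hy) (h.hamiltonian_V y hy) (h.hamiltonian_W y hy)
      (fderiv_eq_neg_comp h.isOpen h.smooth_flat_V h.smooth_V h.hamiltonian_V
        (fun z _ => flat_self _ _) hy)
      (fderiv_eq_neg_comp h.isOpen h.smooth_flat_V h.smooth_W h.hamiltonian_V h.isotropic hy)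
      (fderiv_eq_neg_comp h.isOpen h.symm.smooth_flat_V h.smooth_V h.hamiltonian_W
        h.symm.isotropic hy)
      (fderiv_eq_neg_comp h.isOpen h.symm.smooth_flat_V h.smooth_W h.hamiltonian_W
        (fun z _ => flat_self _ _) hy) t
    refine dForm_eq_cliff ?_ (φ := spinM (V y) (W y) (flat (w y) (V y)) (flat (w y) (W y)) t (volForm E))
      ?_ ?_
    · rw [hK y hy]
      exact hiso.deform_sq t
    · rw [hK y hy]
      exact hiso.isSpinorOf_deform t
    -- The coefficients of W and V in dφ are complex traces; their real and imaginary parts give the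
    -- two real sections combined in `etaField`.
    · apply forget_injective
      rw [hd, forget_add, forget_smul, forget_cliff, forget_cliff, ← clVec_apply, ← clVec_apply,
        ← clVec_apply, ← clVec_apply]
      rw [map_smul, map_smul, map_sub, map_sub, map_smul, map_smul, map_smul, map_smul]
      simp only [← Complex.coe_smul]
      conv_lhs => rw [← Complex.re_add_im (ctrace (fderiv ℝ V y)), ← Complex.re_add_im (ctrace (fderiv ℝ W y))]
      module
  ρ_ne y hy := mul_ne_zero (pow_ne_zero _ (by norm_num))
    (inv_ne_zero (h.positive y hy).det_re_pos.1.ne')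
  ρ_eq y hy := by
    obtain ⟨hpos, hre⟩ := (h.positive y hy).det_re_pos
    rw [forget_spinM, mukai_spin (finrank_real_of_complex E) (even_two_mul _),
      (h.positive y hy).mukai_expForm, ← Complex.coe_smul, smul_smul]
    -- The spin action leaves the pairing of the volume form unchanged, so ρ is the inverse of the
    -- factor in `IsPositive.mukai_expForm` for every `t`.
    have : ((rhoField w y : ℝ) : ℂ) * ((-1) ^ Module.finrank ℂ E * (hermMatrix (w y)).det) = 1 := by
      have hne : (hermMatrix (w y)).det ≠ 0 := by
        rw [← hre]
        exact_mod_cast hpos.ne'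
      rw [rhoField]
      push_cast
      rw [hre]
      field_simp
      rw [← pow_mul, mul_comm, pow_mul]
      simp
    rw [this, one_smul]

/-- Put μ = d log det h and u = t (Re tr V' · W - Re tr W' · V). The imaginary part of η contributes
only a vector, as K² = -1. The covector part of K(0, -μ) is μ ∘ J plus a term in θ, τ linear in t
(μ(W) V - μ(V) W); by μ(V) = -2 Re tr V', and likewise for W, this argument is 2u. That term cancels
the covector part of -2 K(u, 0). -/
theorem LocalData.ricciSection_snd (h : LocalData w V W U) (t : ℝ) {K : E → (GT E →L[ℝ] GT E)}
    (hK : ∀ y ∈ U, K y = deform t (V y) (W y) (flat (w y) (V y)) (flat (w y) (W y))) {y : E}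
    (hy : y ∈ U) :
    (ricciSection K (etaField V W K t) (rhoField w) y).2 = (fderiv ℝ (logDet w) y).comp (cplx E) := by
  have hiso := h.isIsotropicData hy
  have hpos := (h.positive y hy).det_re_pos.1
  have hρ : (rhoField w y)⁻¹ • fderiv ℝ (rhoField w) y = -fderiv ℝ (logDet w) y := by
    have h1 := ((hasDerivAt_inv hpos.ne').comp_hasFDerivAt y (h.hasFDerivAt_re_det hy)).const_mul
      ((-1 : ℝ) ^ Module.finrank ℂ E)
    have h2 : HasFDerivAt (rhoField w) _ y := h1
    rw [h2.fderiv, (h.hasFDerivAt_logDet hy).fderiv, rhoField, smul_smul, smul_smul, ← neg_smul]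
    congr 1
    have h3 : ((-1 : ℝ) ^ Module.finrank ℂ E) ≠ 0 := pow_ne_zero _ (by norm_num)
    field_simp
  have hV := h.fderiv_logDet hy
  have hW := h.symm.fderiv_logDet hy
  have hsq : ∀ u, K y (K y u) = -u := by
    rw [hK y hy]
    exact hiso.deform_sq t
  rw [ricciSection, hρ, etaField, map_add, hsq]
  generalize fderiv ℝ (logDet w) y = μ at hV hW ⊢
  generalize (ctrace (fderiv ℝ V y)).re = f at hV ⊢
  generalize (ctrace (fderiv ℝ W y)).re = g at hW ⊢
  rw [hK y hy]
  generalize flat (w y) (V y) = θ at hiso ⊢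
  generalize flat (w y) (W y) = τ at hiso ⊢
  ext x
  simp [deform_apply, rot_apply, nilMap_apply, ofComplex_apply, hiso.h11, hiso.h12, hiso.h21,
    hiso.h22, hV, hW, cplx_apply, smul_comm Complex.I, smul_sub]
  ring

theorem LocalData.formP_eq (h : LocalData w V W U) (t : ℝ) {K : E → (GT E →L[ℝ] GT E)}
    (hK : ∀ y ∈ U, K y = deform t (V y) (W y) (flat (w y) (V y)) (flat (w y) (W y))) {y : E}
    (hy : y ∈ U) (u v : E) :
    formP K (fun _ => 0) (etaField V W K t) (rhoField w) y u v =
      dOne (fun z => (fderiv ℝ (logDet w) z).comp (cplx E)) y u v := by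
  have : (fun z => flat ((fun _ => 0 : E → Form2 E) z) (ricciSection K (etaField V W K t) (rhoField w) z).1 +
      (ricciSection K (etaField V W K t) (rhoField w) z).2) =ᶠ[nhds y]
      fun z => (fderiv ℝ (logDet w) z).comp (cplx E) := by
    filter_upwards [h.isOpen.mem_nhds hy] with z hz
    rw [flat_zero, zero_apply, zero_add, h.ricciSection_snd t hK hz]
  rw [formP, dOne, dOne, this.fderiv_eq]

end Trivialization

/-! ### Behaviour under holomorphic charts. -/

section Charts

theorem Involutive.congr {E : Type*} [NormedAddCommGroup E] [NormedSpace ℝ E]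
    {K K' : E → (GT E →L[ℝ] GT E)} {U : Set E} (hK : Involutive K U) (h : ∀ y ∈ U, K' y = K y) :
    Involutive K' U := by
  intro S hS hSU a b c d ha hb hc hd hab hcd z hz
  rw [h z (hSU hz)]
  refine hK S hS hSU a b c d ha hb hc hd (fun y hy => ?_) (fun y hy => ?_) z hz
  · rw [← h y (hSU hy)]
    exact hab y hy
  · rw [← h y (hSU hy)]
    exact hcd y hy

variable {E : Type*} [NormedAddCommGroup E] [NormedSpace ℂ E]
  {M : Type*} [TopologicalSpace M] [ChartedSpace E M]

/-- A complex manifold is a smooth real manifold. -/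
theorem isManifold_real [IsManifold 𝓘(ℂ, E) ω M] : IsManifold 𝓘(ℝ, E) ∞ M := by
  refine isManifold_of_contDiffOn 𝓘(ℝ, E) ∞ M fun e e' he he' => ?_
  have h := (contDiffGroupoid ω 𝓘(ℂ, E)).compatible he he'
  rw [contDiffGroupoid, mem_groupoid_of_pregroupoid] at h
  have h1 : ContDiffOn ℂ ω (𝓘(ℂ, E) ∘ e.symm ≫ₕ e' ∘ 𝓘(ℂ, E).symm)
    (𝓘(ℂ, E).symm ⁻¹' (e.symm ≫ₕ e').source ∩ range 𝓘(ℂ, E)) := h.1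
  exact (h1.restrict_scalars ℝ).of_le le_top

theorem hasMFDerivAt_restrictScalars {E' : Type*} [NormedAddCommGroup E'] [NormedSpace ℂ E']
    {M' : Type*} [TopologicalSpace M'] [ChartedSpace E' M'] {f : M → M'} {x : M} {f' : E →L[ℂ] E'}
    (h : HasMFDerivAt 𝓘(ℂ, E) 𝓘(ℂ, E') f x f') :
    HasMFDerivAt 𝓘(ℝ, E) 𝓘(ℝ, E') f x (f'.restrictScalars ℝ) :=
  ⟨h.1, h.2.restrictScalars ℝ⟩

variable [IsManifold 𝓘(ℂ, E) ω M] {e : OpenPartialHomeomorph M E}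

theorem toChart_I (he : e ∈ atlas E M) {y : E} (hy : y ∈ e.target) (v : E) :
    toChart e y (Complex.I • v) = Complex.I • toChart e y v := by
  have : IsManifold 𝓘(ℂ, E) 1 M := IsManifold.of_le (n := ω) le_top
  have h := (mdifferentiableAt_atlas (I := 𝓘(ℂ, E)) he (e.map_target hy)).hasMFDerivAt
  have h2 : toChart e y = ContinuousLinearMap.restrictScalars ℝ
      (mfderiv 𝓘(ℂ, E) 𝓘(ℂ, E) e (e.symm y) : E →L[ℂ] E) :=
    (hasMFDerivAt_restrictScalars h).mfderiv
  rw [h2]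
  exact map_smul (mfderiv 𝓘(ℂ, E) 𝓘(ℂ, E) e (e.symm y) : E →L[ℂ] E) _ _

theorem fromChart_I (he : e ∈ atlas E M) {y : E} (hy : y ∈ e.target) (v : E) :
    fromChart e y (Complex.I • v) = Complex.I • fromChart e y v := by
  have : IsManifold 𝓘(ℂ, E) 1 M := IsManifold.of_le (n := ω) le_top
  have h := (mdifferentiableAt_atlas_symm (I := 𝓘(ℂ, E)) he hy).hasMFDerivAt
  have h2 : fromChart e y = ContinuousLinearMap.restrictScalars ℝ
      (mfderiv 𝓘(ℂ, E) 𝓘(ℂ, E) e.symm y : E →L[ℂ] E) :=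
    (hasMFDerivAt_restrictScalars h).mfderiv
  rw [h2]
  exact map_smul (mfderiv 𝓘(ℂ, E) 𝓘(ℂ, E) e.symm y : E →L[ℂ] E) _ _

theorem toChart_fromChart (he : e ∈ atlas E M) {y : E} (hy : y ∈ e.target) (v : E) :
    toChart e y (fromChart e y v) = v := by
  have := isManifold_real (E := E) (M := M)
  have : IsManifold 𝓘(ℝ, E) 1 M := IsManifold.of_le (n := ∞) (by simp)
  have h := (mdifferentiable_of_mem_atlas (I := 𝓘(ℝ, E)) he).comp_symm_deriv hy
  exact congrArg (fun L : E →L[ℝ] E => L v) h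

theorem fromChart_toChart (he : e ∈ atlas E M) {y : E} (hy : y ∈ e.target) (v : E) :
    fromChart e y (toChart e y v) = v := by
  have := isManifold_real (E := E) (M := M)
  have : IsManifold 𝓘(ℝ, E) 1 M := IsManifold.of_le (n := ∞) (by simp)
  have h := (mdifferentiable_of_mem_atlas (I := 𝓘(ℝ, E)) he).symm_comp_deriv (e.map_target hy)
  rw [e.right_inv hy] at h
  exact congrArg (fun L : E →L[ℝ] E => L v) h

theorem genMap_apply (A A' : E →L[ℝ] E) (u : GT E) : genMap A A' u = (A u.1, u.2.comp A') := rfl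

/-- The change of coordinates by mutually inverse complex linear maps. -/
structure IsChartChange (A A' : E →L[ℝ] E) : Prop where
  left : ∀ v, A (A' v) = v
  right : ∀ v, A' (A v) = v
  map_I : ∀ v, A (Complex.I • v) = Complex.I • A v
  map_I' : ∀ v, A' (Complex.I • v) = Complex.I • A' v

theorem isChartChange (he : e ∈ atlas E M) {y : E} (hy : y ∈ e.target) :
    IsChartChange (toChart e y) (fromChart e y) :=
  ⟨toChart_fromChart he hy, fromChart_toChart he hy, toChart_I he hy, fromChart_I he hy⟩

namespace IsChartChange

variable {A A' : E →L[ℝ] E}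

theorem flat_comp (h : IsChartChange A A') (w : Form2 E) (v : E) :
    flat (w.compContinuousLinearMap A') (A v) = (flat w v).comp A' := by
  ext u
  rw [flat_apply, ContinuousAlternatingMap.compContinuousLinearMap_apply,
    ContinuousLinearMap.comp_apply, flat_apply]
  congr 1
  funext i
  fin_cases i
  · exact h.right v
  · rfl

theorem nilMap_conj (A A' : E →L[ℝ] E) (v₁ v₂ : E) (ξ₁ ξ₂ : E →L[ℝ] ℝ) (u : GT E) :
    genMap A A' (nilMap v₁ v₂ ξ₁ ξ₂ (genMap A' A u)) =
      nilMap (A v₁) (A v₂) (ξ₁.comp A') (ξ₂.comp A') u := by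
  simp only [genMap_apply, nilMap_apply]
  refine Prod.ext ?_ ?_
  · simp
  · ext x
    simp

theorem genMap_genMap (h : IsChartChange A A') (u : GT E) : genMap A A' (genMap A' A u) = u := by
  simp only [genMap_apply]
  refine Prod.ext (h.left _) ?_
  ext x
  simp [h.left]

theorem genMap_genMap' (h : IsChartChange A A') (u : GT E) : genMap A' A (genMap A A' u) = u := by
  simp only [genMap_apply]
  refine Prod.ext (h.right _) ?_
  ext x
  simp [h.right]

theorem rot_conj (h : IsChartChange A A') (t : ℝ) (v₁ v₂ : E) (ξ₁ ξ₂ : E →L[ℝ] ℝ) (u : GT E) :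
    genMap A A' (rot t v₁ v₂ ξ₁ ξ₂ (genMap A' A u)) =
      rot t (A v₁) (A v₂) (ξ₁.comp A') (ξ₂.comp A') u := by
  rw [rot_apply, rot_apply, map_add, map_smul, h.genMap_genMap, nilMap_conj]

theorem ofComplex_conj (h : IsChartChange A A') (u : GT E) :
    genMap A A' (ofComplex (cplx E) (genMap A' A u)) = ofComplex (cplx E) u := by
  simp only [genMap_apply, ofComplex_apply]
  refine Prod.ext ?_ ?_
  · simp [cplx_apply, h.map_I, h.left]
  · ext x
    simp [cplx_apply, h.map_I, h.left]

/-- The rotation is natural in its data and a complex linear change of coordinates commutes with J,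
so the field defined on M has the same expression in every chart. -/
theorem deform_conj (h : IsChartChange A A') (t : ℝ) (v₁ v₂ : E) (ξ₁ ξ₂ : E →L[ℝ] ℝ) :
    (genMap A A').comp ((deform t v₁ v₂ ξ₁ ξ₂).comp (genMap A' A)) =
      deform t (A v₁) (A v₂) (ξ₁.comp A') (ξ₂.comp A') := by
  refine ContinuousLinearMap.ext fun u => ?_
  rw [ContinuousLinearMap.comp_apply, ContinuousLinearMap.comp_apply, deform_apply, deform_apply]
  conv_rhs => rw [← h.rot_conj, ← h.rot_conj, ← h.ofComplex_conj, h.genMap_genMap', h.genMap_genMap']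

theorem ofSymplectic_conj [FiniteDimensional ℂ E] (h : IsChartChange A A') {w : Form2 E}
    (hw : ∀ v, flat w v = 0 → v = 0)
    (hw' : ∀ v, flat (w.compContinuousLinearMap A') v = 0 → v = 0) :
    (genMap A A').comp ((ofSymplectic w).comp (genMap A' A)) =
      ofSymplectic (w.compContinuousLinearMap A') := by
  refine ContinuousLinearMap.ext fun u => ?_
  rw [ContinuousLinearMap.comp_apply, ContinuousLinearMap.comp_apply]
  simp only [genMap_apply, ofSymplectic_apply]
  refine Prod.ext ?_ ?_
  · rw [← sub_eq_zero]
    apply hw'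
    simp only [map_sub, map_neg, h.flat_comp, flat_inverse_flat hw, flat_inverse_flat hw']
    ext x
    simp [h.left]
  · simp only
    rw [← h.flat_comp, h.left]

theorem isPositive (h : IsChartChange A A') {w : Form2 E} (hw : IsPositive w) :
    IsPositive (w.compContinuousLinearMap A') := by
  have key : ∀ u v, w.compContinuousLinearMap A' ![u, v] = w ![A' u, A' v] := by
    intro u v
    rw [ContinuousAlternatingMap.compContinuousLinearMap_apply]
    congr 1
    funext i
    fin_cases i <;> rfl
  constructor
  · intro u v
    rw [key, key, h.map_I', h.map_I', hw.invariant]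
  · intro v hv
    rw [key, h.map_I']
    apply hw.pos
    intro h0
    apply hv
    rw [← h.left v, h0, map_zero]

end IsChartChange

end Charts

/-! ### The torus flow in a chart. -/

section TorusAction

variable {E : Type*} [NormedAddCommGroup E]
  {M : Type*} [TopologicalSpace M] {e : OpenPartialHomeomorph M E} {m : ℕ}
  [MulAction (Fin m → Circle) M]

/-- The one-parameter group generated by the `i`-th basis vector, in a chart. -/
def flowIn (e : OpenPartialHomeomorph M E) (i : Fin m) (p : ℝ × E) : E :=
  e (torusExp (Pi.single i p.1 : Fin m → ℝ) • e.symm p.2)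

/-- The domain of the flow in a chart. -/
def flowDomain (e : OpenPartialHomeomorph M E) (i : Fin m) : Set (ℝ × E) :=
  (univ ×ˢ e.target) ∩ {p | torusExp (Pi.single i p.1 : Fin m → ℝ) • e.symm p.2 ∈ e.source}

theorem torusExp_zero : torusExp (0 : Fin m → ℝ) = 1 := by
  funext i
  simp [torusExp]

theorem torusExp_add (s t : Fin m → ℝ) : torusExp (s + t) = torusExp s * torusExp t := by
  funext i
  simp [torusExp, Circle.exp_add]

theorem torusExp_single_zero_smul {M : Type*} [MulAction (Fin m → Circle) M] (i : Fin m) (x : M) :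
    torusExp (Pi.single i (0 : ℝ) : Fin m → ℝ) • x = x := by
  rw [Pi.single_zero, torusExp_zero, one_smul]

theorem zero_mem_flowDomain (i : Fin m) {y : E} (hy : y ∈ e.target) :
    ((0 : ℝ), y) ∈ flowDomain e i := by
  refine ⟨⟨mem_univ _, hy⟩, ?_⟩
  change torusExp (Pi.single i (0 : ℝ) : Fin m → ℝ) • e.symm y ∈ e.source
  rw [torusExp_single_zero_smul]
  exact e.map_target hy

theorem flowIn_zero (i : Fin m) {y : E} (hy : y ∈ e.target) : flowIn e i (0, y) = y := by
  rw [flowIn]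
  change e (torusExp (Pi.single i (0 : ℝ) : Fin m → ℝ) • e.symm y) = y
  rw [torusExp_single_zero_smul, e.right_inv hy]

variable [NormedSpace ℂ E] [ChartedSpace E M] {w : M → Form2 E} {μ : M → (Fin m → ℝ)}

/-- The generating vector field in a chart. -/
def generatorIn (e : OpenPartialHomeomorph M E) (i : Fin m) (y : E) : E :=
  toChart e y (generator i (e.symm y))

variable [IsManifold 𝓘(ℂ, E) ω M]

theorem IsHamiltonianTorusAction.contMDiffOn_flow (h : IsHamiltonianTorusAction m w μ)
    (he : e ∈ atlas E M) (i : Fin m) :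
    ContMDiffOn 𝓘(ℝ, ℝ × E) 𝓘(ℝ, E) ∞
      (fun p : ℝ × E => torusExp (Pi.single i p.1 : Fin m → ℝ) • e.symm p.2)
      (univ ×ˢ e.target) := by
  have := isManifold_real (E := E) (M := M)
  have h1 : ContMDiffOn 𝓘(ℝ, ℝ × E) 𝓘(ℝ, Fin m → ℝ) ∞
      (fun p : ℝ × E => (Pi.single i p.1 : Fin m → ℝ)) (univ ×ˢ e.target) := by
    refine ContDiffOn.contMDiffOn ?_
    exact ((ContinuousLinearMap.single ℝ (fun _ : Fin m => ℝ) i).contDiff.comp contDiff_fst).contDiffOn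
  have h2 : ContMDiffOn 𝓘(ℝ, ℝ × E) 𝓘(ℝ, E) ∞ (fun p : ℝ × E => e.symm p.2) (univ ×ˢ e.target) :=
    (contMDiffOn_symm_of_mem_maximalAtlas (I := 𝓘(ℝ, E)) (n := ∞)
      (IsManifold.subset_maximalAtlas he)).comp (contDiff_snd.contMDiff.contMDiffOn) (fun p hp => hp.2)
  exact h.smooth.comp_contMDiffOn (h1.prodMk h2)

theorem IsHamiltonianTorusAction.isOpen_flowDomain (h : IsHamiltonianTorusAction m w μ)
    (he : e ∈ atlas E M) (i : Fin m) : IsOpen (flowDomain e i) :=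
  (h.contMDiffOn_flow he i).continuousOn.isOpen_inter_preimage (isOpen_univ.prod e.open_target)
    e.open_source

theorem IsHamiltonianTorusAction.smooth_flowIn (h : IsHamiltonianTorusAction m w μ)
    (he : e ∈ atlas E M) (i : Fin m) : ContDiffOn ℝ ∞ (flowIn e i) (flowDomain e i) := by
  have := isManifold_real (E := E) (M := M)
  rw [← contMDiffOn_iff_contDiffOn]
  exact (contMDiffOn_of_mem_maximalAtlas (I := 𝓘(ℝ, E)) (n := ∞)
      (IsManifold.subset_maximalAtlas he)).comp
    ((h.contMDiffOn_flow he i).mono inter_subset_left) (fun p hp => hp.2)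

end TorusAction

/-! ### Generating fields: holomorphy, moment map and isotropy. -/

section TorusInCharts

variable {E : Type*} [NormedAddCommGroup E] [NormedSpace ℂ E]
  {M : Type*} [TopologicalSpace M] [ChartedSpace E M]
  {e : OpenPartialHomeomorph M E} {m : ℕ} [MulAction (Fin m → Circle) M]
  {w : M → Form2 E} {μ : M → (Fin m → ℝ)}

theorem IsKahler.isPositive (h : IsKahler w) (x : M) : IsPositive (w x) :=
  ⟨h.invariant x, h.pos x⟩

/-- The derivative at the identity of the orbit map of `x`. -/
def orbitDeriv (m : ℕ) [MulAction (Fin m → Circle) M] (x : M) : (Fin m → ℝ) →L[ℝ] E :=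
  (mfderiv 𝓘(ℝ, Fin m → ℝ) 𝓘(ℝ, E) (fun s : Fin m → ℝ => torusExp s • x) 0 : (Fin m → ℝ) →L[ℝ] E)

theorem IsHamiltonianTorusAction.hasMFDerivAt_orbit (h : IsHamiltonianTorusAction m w μ) (x : M) :
    HasMFDerivAt 𝓘(ℝ, Fin m → ℝ) 𝓘(ℝ, E) (fun s : Fin m → ℝ => torusExp s • x) 0
      (orbitDeriv (E := E) m x) := by
  have h1 : ContMDiff 𝓘(ℝ, Fin m → ℝ) 𝓘(ℝ, E) ∞ (fun s : Fin m → ℝ => torusExp s • x) :=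
    h.smooth.comp (contMDiff_id.prodMk contMDiff_const)
  exact (h1.mdifferentiable (by simp) 0).hasMFDerivAt

theorem IsHamiltonianTorusAction.hasMFDerivAt_smul (h : IsHamiltonianTorusAction m w μ)
    (s : Fin m → ℝ) (x : M) : HasMFDerivAt 𝓘(ℝ, E) 𝓘(ℝ, E) (fun z : M => torusExp s • z) x
      (dAct (E := E) (torusExp s) x) := by
  have h1 : ContMDiff 𝓘(ℝ, E) 𝓘(ℝ, E) ∞ (fun z : M => torusExp s • z) :=
    h.smooth.comp (contMDiff_const.prodMk contMDiff_id)
  exact (h1.mdifferentiable (by simp) x).hasMFDerivAt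

namespace IsHamiltonianTorusAction

theorem hasMFDerivAt_curve (h : IsHamiltonianTorusAction m w μ) (a : Fin m → ℝ) (x : M) :
    HasMFDerivAt 𝓘(ℝ, ℝ) 𝓘(ℝ, E) (fun s : ℝ => torusExp (s • a) • x) 0
      ((orbitDeriv (E := E) m x).comp ((1 : ℝ →L[ℝ] ℝ).smulRight a)) := by
  have h1 : HasMFDerivAt 𝓘(ℝ, ℝ) 𝓘(ℝ, Fin m → ℝ) (fun s : ℝ => s • a) 0
      ((1 : ℝ →L[ℝ] ℝ).smulRight a) :=
    ((1 : ℝ →L[ℝ] ℝ).smulRight a).hasFDerivAt.hasMFDerivAt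
  have h2 := h.hasMFDerivAt_orbit x
  rw [← zero_smul ℝ a] at h2
  exact HasMFDerivAt.comp (0 : ℝ) h2 h1

theorem generator_eq (h : IsHamiltonianTorusAction m w μ) (i : Fin m) (x : M) :
    generator (E := E) i x = orbitDeriv (E := E) m x (Pi.single i 1) := by
  have h1 := h.hasMFDerivAt_curve (Pi.single i 1) x
  have h2 : (fun s : ℝ => torusExp (s • (Pi.single i 1 : Fin m → ℝ)) • x) =
      fun s : ℝ => torusExp (Pi.single i s : Fin m → ℝ) • x := by
    funext s
    rw [← Pi.single_smul, smul_eq_mul, mul_one]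
  rw [h2] at h1
  have h3 : generator (E := E) i x =
      ((orbitDeriv (E := E) m x).comp ((1 : ℝ →L[ℝ] ℝ).smulRight (Pi.single i 1))) 1 :=
    congrArg (fun L : ℝ →L[ℝ] E => L 1) h1.mfderiv
  rw [h3]
  simp

theorem hasMFDerivAt_generator (h : IsHamiltonianTorusAction m w μ) (i : Fin m) (x : M) :
    HasMFDerivAt 𝓘(ℝ, ℝ) 𝓘(ℝ, E) (fun s : ℝ => torusExp (Pi.single i s : Fin m → ℝ) • x) 0
      ((1 : ℝ →L[ℝ] ℝ).smulRight (generator (E := E) i x)) := by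
  have h1 := h.hasMFDerivAt_curve (Pi.single i 1) x
  have h2 : (fun s : ℝ => torusExp (s • (Pi.single i 1 : Fin m → ℝ)) • x) =
      fun s : ℝ => torusExp (Pi.single i s : Fin m → ℝ) • x := by
    funext s
    rw [← Pi.single_smul, smul_eq_mul, mul_one]
  rw [h2] at h1
  have h3 : (1 : ℝ →L[ℝ] ℝ).smulRight (generator (E := E) i x) =
      (orbitDeriv (E := E) m x).comp ((1 : ℝ →L[ℝ] ℝ).smulRight (Pi.single i 1)) := by
    rw [h.generator_eq]
    refine ContinuousLinearMap.ext fun s => ?_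
    simp
  exact (congrArg _ h3).mpr h1

end IsHamiltonianTorusAction

variable [IsManifold 𝓘(ℂ, E) ω M]

theorem hasMFDerivAt_chart (he : e ∈ atlas E M) {x : M} (hx : x ∈ e.source) :
    HasMFDerivAt 𝓘(ℝ, E) 𝓘(ℝ, E) e x (toChart (E := E) e (e x)) := by
  have := isManifold_real (E := E) (M := M)
  have : IsManifold 𝓘(ℝ, E) 1 M := IsManifold.of_le (n := ∞) (by simp)
  have h := (mdifferentiableAt_atlas (I := 𝓘(ℝ, E)) he hx).hasMFDerivAt
  have h2 : toChart e (e x) = (mfderiv 𝓘(ℝ, E) 𝓘(ℝ, E) e x : E →L[ℝ] E) := by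
    rw [toChart, e.left_inv hx]
  rw [h2]
  exact h

theorem hasMFDerivAt_chart_symm (he : e ∈ atlas E M) {y : E} (hy : y ∈ e.target) :
    HasMFDerivAt 𝓘(ℝ, E) 𝓘(ℝ, E) e.symm y (fromChart (E := E) e y) := by
  have := isManifold_real (E := E) (M := M)
  have : IsManifold 𝓘(ℝ, E) 1 M := IsManifold.of_le (n := ∞) (by simp)
  exact (mdifferentiableAt_atlas_symm (I := 𝓘(ℝ, E)) he hy).hasMFDerivAt

namespace IsHamiltonianTorusAction

theorem fderiv_flowIn (h : IsHamiltonianTorusAction m w μ) (he : e ∈ atlas E M) (i : Fin m) {y : E}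
    (hy : y ∈ e.target) : fderiv ℝ (flowIn e i) (0, y) (1, 0) = generatorIn e i y := by
  have h1 := (h.smooth_flowIn he i).hasFDerivAt_of_isOpen (h.isOpen_flowDomain he i)
    (zero_mem_flowDomain i hy)
  have hc : HasFDerivAt (fun s : ℝ => (s, y)) (ContinuousLinearMap.inl ℝ ℝ E) 0 :=
    hasFDerivAt_prodMk_left (0 : ℝ) y
  have h2 := h1.comp (0 : ℝ) hc
  have h3 := hasMFDerivAt_chart he (e.map_target hy)
  rw [e.right_inv hy, ← torusExp_single_zero_smul i (e.symm y)] at h3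
  have h4 := HasMFDerivAt.comp (0 : ℝ) h3 (h.hasMFDerivAt_generator i (e.symm y))
  have h5 := h2.unique h4.hasFDerivAt
  have h6 := congrArg (fun L : ℝ →L[ℝ] E => L 1) h5
  rw [generatorIn]
  refine Eq.trans ?_ (h6.trans ?_)
  · rfl
  · change toChart e y ((1 : ℝ) • generator i (e.symm y)) = _
    rw [one_smul]

theorem smooth_generatorIn (h : IsHamiltonianTorusAction m w μ) (he : e ∈ atlas E M) (i : Fin m) :
    ContDiffOn ℝ ∞ (generatorIn e i) e.target := by
  have h1 := (h.smooth_flowIn he i).fderiv_infty (h.isOpen_flowDomain he i)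
  have h2 : ContDiffOn ℝ ∞ (fun y : E => fderiv ℝ (flowIn e i) (0, y) (1, 0)) e.target :=
    (h1.comp (contDiff_prodMk_right (0 : ℝ)).contDiffOn
      (fun y hy => zero_mem_flowDomain i hy)).clm_apply contDiffOn_const
  exact h2.congr fun y hy => (h.fderiv_flowIn he i hy).symm

/-- At a fixed time the map is a composition of charts with the action of a group element, all of
which have complex linear derivative. -/
theorem fderiv_flowIn_I (h : IsHamiltonianTorusAction m w μ) (he : e ∈ atlas E M) (i : Fin m)
    {p : ℝ × E} (hp : p ∈ flowDomain e i) (v : E) :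
    fderiv ℝ (flowIn e i) p (0, Complex.I • v) = Complex.I • fderiv ℝ (flowIn e i) p (0, v) := by
  obtain ⟨s, y⟩ := p
  have hy : y ∈ e.target := hp.1.2
  have h1 := (h.smooth_flowIn he i).hasFDerivAt_of_isOpen (h.isOpen_flowDomain he i) hp
  have h2 := h1.comp y (hasFDerivAt_prodMk_right s y)
  have h3 := HasMFDerivAt.comp y
    (h.hasMFDerivAt_smul (Pi.single i s) (e.symm y)) (hasMFDerivAt_chart_symm he hy)
  have h4 := HasMFDerivAt.comp y (hasMFDerivAt_chart he hp.2) h3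
  have h5 : ∀ u, fderiv ℝ (flowIn e i) (s, y) (0, u) =
      toChart e (e (torusExp (Pi.single i s : Fin m → ℝ) • e.symm y))
        (dAct (torusExp (Pi.single i s : Fin m → ℝ)) (e.symm y) (fromChart e y u)) := fun u =>
    congrArg (fun L : E →L[ℝ] E => L u) (h2.unique h4.hasFDerivAt)
  rw [h5, h5, fromChart_I he hy, h.preserves_J, toChart_I he (e.map_source hp.2)]

/-- The generator is the time derivative of the flow. By symmetry of second derivatives its spatial
derivative is the time derivative of complex linear maps. -/
theorem holomorphic_generatorIn (h : IsHamiltonianTorusAction m w μ) (he : e ∈ atlas E M)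
    (i : Fin m) {y : E} (hy : y ∈ e.target) (v : E) :
    fderiv ℝ (generatorIn e i) y (Complex.I • v) = Complex.I • fderiv ℝ (generatorIn e i) y v := by
  have hF := h.smooth_flowIn he i
  have hD := h.isOpen_flowDomain he i
  have h0 := zero_mem_flowDomain i hy
  have h1 := (hF.fderiv_infty hD).hasFDerivAt_of_isOpen hD h0
  have hsymm : ∀ a b, fderiv ℝ (fderiv ℝ (flowIn e i)) (0, y) a b =
      fderiv ℝ (fderiv ℝ (flowIn e i)) (0, y) b a := by
    have := (hF.contDiffAt (hD.mem_nhds h0)).isSymmSndFDerivAt (by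
      rw [minSmoothness_of_isRCLikeNormedField]; exact WithTop.coe_le_coe.2 le_top)
    exact fun a b => this.eq a b
  have h2 : ∀ u, fderiv ℝ (generatorIn e i) y u =
      fderiv ℝ (fderiv ℝ (flowIn e i)) (0, y) (1, 0) (0, u) := by
    intro u
    have h3 := (h1.comp y (hasFDerivAt_prodMk_right (0 : ℝ) y)).clm_apply
      (hasFDerivAt_const ((1 : ℝ), (0 : E)) y)
    have h4 : HasFDerivAt (generatorIn e i) _ y := h3.congr_of_eventuallyEq (by
      filter_upwards [e.open_target.mem_nhds hy] with z hz using (h.fderiv_flowIn he i hz).symm)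
    rw [h4.fderiv, hsymm (1, 0)]
    simp
  have h5 : ∀ u, HasFDerivAt (fun p => fderiv ℝ (flowIn e i) p (0, u))
      ((fderiv ℝ (fderiv ℝ (flowIn e i)) (0, y)).flip (0, u)) (0, y) := by
    intro u
    have := h1.clm_apply (hasFDerivAt_const ((0 : ℝ), u) ((0 : ℝ), y))
    simpa using this
  have h6 : HasFDerivAt (fun p => fderiv ℝ (flowIn e i) p (0, Complex.I • v))
      ((cplx E).comp ((fderiv ℝ (fderiv ℝ (flowIn e i)) (0, y)).flip (0, v))) (0, y) := by
    refine ((cplx E).hasFDerivAt.comp _ (h5 v)).congr_of_eventuallyEq ?_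
    filter_upwards [hD.mem_nhds h0] with p hp using h.fderiv_flowIn_I he i hp v
  rw [h2, h2]
  exact congrArg (fun L : ℝ × E →L[ℝ] E => L (1, 0)) ((h5 (Complex.I • v)).unique h6)

theorem smooth_moment (h : IsHamiltonianTorusAction m w μ) (he : e ∈ atlas E M) (j : Fin m) :
    ContDiffOn ℝ ∞ (fun y => μ (e.symm y) j) e.target := by
  have := isManifold_real (E := E) (M := M)
  have h1 : ContMDiffOn 𝓘(ℝ, E) 𝓘(ℝ, Fin m → ℝ) ∞ (fun y => μ (e.symm y)) e.target :=
    h.smooth_μ.comp_contMDiffOn (contMDiffOn_symm_of_mem_maximalAtlas (I := 𝓘(ℝ, E)) (n := ∞)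
      (IsManifold.subset_maximalAtlas he))
  exact contDiffOn_pi.1 (contMDiffOn_iff_contDiffOn.1 h1) j

theorem fderiv_moment (h : IsHamiltonianTorusAction m w μ) (he : e ∈ atlas E M) (j : Fin m) {y : E}
    (hy : y ∈ e.target) :
    fderiv ℝ (fun z => μ (e.symm z) j) y = flat (formIn w e y) (generatorIn e j y) := by
  have h1 := (h.smooth_μ.mdifferentiable (by simp) (e.symm y)).hasMFDerivAt
  have h2 := (HasMFDerivAt.comp y h1 (hasMFDerivAt_chart_symm he hy)).hasFDerivAt
  have h3 := (hasFDerivAt_pi'.1 h2 j).fderiv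
  have h4 : fderiv ℝ (fun z => μ (e.symm z) j) y = _ := h3
  rw [h4, generatorIn, formIn, (isChartChange he hy).flat_comp]
  ext v
  rw [ContinuousLinearMap.comp_apply, flat_apply, ← h.moment]
  rfl

/-- The component μ_j is constant along the flow of V_i, so ω(V_j, V_i) = dμ_j(V_i) = 0. -/
theorem isotropic_generatorIn (h : IsHamiltonianTorusAction m w μ) (he : e ∈ atlas E M)
    (i j : Fin m) {y : E} (hy : y ∈ e.target) :
    flat (formIn w e y) (generatorIn e j y) (generatorIn e i y) = 0 := by
  have h0 := zero_mem_flowDomain i hy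
  have hD := h.isOpen_flowDomain he i
  have h1 := (h.smooth_flowIn he i).hasFDerivAt_of_isOpen hD h0
  have h2 := (h.smooth_moment he j).hasFDerivAt_of_isOpen e.open_target hy
  rw [h.fderiv_moment he j hy, ← flowIn_zero i hy] at h2
  have h3 := h2.comp ((0 : ℝ), y) h1
  have h4 : HasFDerivAt ((fun z => μ (e.symm z) j) ∘ flowIn e i)
      ((flat (formIn w e y) (generatorIn e j y)).comp (ContinuousLinearMap.snd ℝ ℝ E)) (0, y) := by
    have h5 := (h.smooth_moment he j).hasFDerivAt_of_isOpen e.open_target hy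
    rw [h.fderiv_moment he j hy] at h5
    refine (h5.comp ((0 : ℝ), y) hasFDerivAt_snd).congr_of_eventuallyEq ?_
    filter_upwards [hD.mem_nhds h0] with p hp
    change μ (e.symm (e (torusExp (Pi.single i p.1 : Fin m → ℝ) • e.symm p.2))) j =
      μ (e.symm p.2) j
    rw [e.left_inv hp.2, h.invariant_μ]
  have h6 := congrArg (fun L : ℝ × E →L[ℝ] ℝ => L (1, 0)) (h3.unique h4)
  simp only [ContinuousLinearMap.comp_apply, h.fderiv_flowIn he i hy, flowIn_zero i hy] at h6
  simpa using h6

end IsHamiltonianTorusAction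

theorem IsHamiltonianTorusAction.localData (h : IsHamiltonianTorusAction m w μ) (hw : IsKahler w)
    (he : e ∈ atlas E M) (i j : Fin m) :
    LocalData (formIn w e) (generatorIn e i) (generatorIn e j) e.target := by
  have hsymm : ∀ k : Fin m, ∀ y ∈ e.target, ∀ u v,
      fderiv ℝ (fun z => flat (formIn w e z) (generatorIn e k z)) y u v =
        fderiv ℝ (fun z => flat (formIn w e z) (generatorIn e k z)) y v u := by
    intro k y hy u v
    have h1 : (fun z => flat (formIn w e z) (generatorIn e k z)) =ᶠ[nhds y]
        fderiv ℝ (fun z => μ (e.symm z) k) := by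
      filter_upwards [e.open_target.mem_nhds hy] with z hz using (h.fderiv_moment he k hz).symm
    rw [h1.fderiv_eq]
    exact (((h.smooth_moment he k).contDiffAt
      (e.open_target.mem_nhds hy)).isSymmSndFDerivAt (by
      rw [minSmoothness_of_isRCLikeNormedField]; exact WithTop.coe_le_coe.2 le_top)).eq u v
  exact
    { isOpen := e.open_target
      smooth_w := (hw.closed e he).1
      closed_w := (hw.closed e he).2
      positive := fun y hy => (isChartChange he hy).isPositive (hw.isPositive _)
      smooth_V := h.smooth_generatorIn he i
      smooth_W := h.smooth_generatorIn he j
      holomorphic_V := fun y hy => h.holomorphic_generatorIn he i hy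
      holomorphic_W := fun y hy => h.holomorphic_generatorIn he j hy
      hamiltonian_V := hsymm i
      hamiltonian_W := hsymm j
      isotropic := fun y hy => h.isotropic_generatorIn he j i hy }

end TorusInCharts

/-! ### The global family and its generalized Kähler–Einstein property. -/

section Family

variable {E : Type*} [NormedAddCommGroup E] [NormedSpace ℂ E]
  {M : Type*} [TopologicalSpace M] [ChartedSpace E M]
  {e : OpenPartialHomeomorph M E} {m : ℕ} [MulAction (Fin m → Circle) M]
  {w : M → Form2 E} {μ : M → (Fin m → ℝ)}

/-- The deformation of the complex structure by the bivector of two generators and by the `2`-form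
of the differentials of their Hamiltonians. -/
def torusDeform (w : M → Form2 E) (i j : Fin m) (t : ℝ) (x : M) : GT E →L[ℝ] GT E :=
  deform t (generator i x) (generator j x) (flat (w x) (generator i x))
    (flat (w x) (generator j x))

theorem formIn_zero (e : OpenPartialHomeomorph M E) :
    formIn (fun _ => (0 : Form2 E)) e = fun _ => 0 := by
  funext y
  rfl

theorem isSmoothClosed_zero : IsSmoothClosed (fun _ : M => (0 : Form2 E)) := by
  intro e _
  rw [formIn_zero]
  refine ⟨contDiffOn_const, fun y _ => ?_⟩
  rw [extDeriv, fderiv_fun_const]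
  exact map_zero (ContinuousAlternatingMap.alternatizeUncurryFinCLM ℝ E ℝ)

variable [IsManifold 𝓘(ℂ, E) ω M]

theorem endIn_torusDeform (w : M → Form2 E) (he : e ∈ atlas E M) (i j : Fin m) (t : ℝ) {y : E}
    (hy : y ∈ e.target) :
    endIn (torusDeform w i j t) e y = deform t (generatorIn e i y) (generatorIn e j y)
      (flat (formIn w e y) (generatorIn e i y)) (flat (formIn w e y) (generatorIn e j y)) := by
  rw [endIn, torusDeform, (isChartChange he hy).deform_conj, generatorIn, generatorIn, formIn,
    (isChartChange he hy).flat_comp, (isChartChange he hy).flat_comp]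

theorem IsHamiltonianTorusAction.isotropic (h : IsHamiltonianTorusAction m w μ) (i j : Fin m)
    (x : M) : flat (w x) (generator j x) (generator i x) = 0 := by
  have he := chart_mem_atlas E x
  have hx := mem_chart_source E x
  have hy := (chartAt E x).map_source hx
  have h1 := h.isotropic_generatorIn he i j hy
  rw [generatorIn, generatorIn, formIn, (isChartChange he hy).flat_comp,
    ContinuousLinearMap.comp_apply, fromChart_toChart he hy, (chartAt E x).left_inv hx] at h1
  exact h1

theorem IsHamiltonianTorusAction.isIsotropicData (h : IsHamiltonianTorusAction m w μ) (i j : Fin m)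
    (x : M) : IsIsotropicData (generator i x) (generator j x) (flat (w x) (generator i x))
      (flat (w x) (generator j x)) :=
  ⟨h.isotropic i i x, h.isotropic j i x, h.isotropic i j x, h.isotropic j j x⟩

variable [FiniteDimensional ℂ E]

theorem endIn_ofSymplectic (hw : IsKahler w) (he : e ∈ atlas E M) {y : E} (hy : y ∈ e.target) :
    endIn (fun x => ofSymplectic (w x)) e y = ofSymplectic (formIn w e y) :=
  (isChartChange he hy).ofSymplectic_conj (hw.isPositive _).flat_injective
    ((isChartChange he hy).isPositive (hw.isPositive _)).flat_injective

theorem IsKahler.isGenComplex_ofSymplectic (hw : IsKahler w) :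
    IsGenComplex (fun x => ofSymplectic (w x)) := by
  have : FiniteDimensional ℝ E := FiniteDimensional.complexToReal E
  have hnd : ∀ e ∈ atlas E M, ∀ y ∈ e.target, ∀ v, flat (formIn w e y) v = 0 → v = 0 :=
    fun e he y hy => ((isChartChange he hy).isPositive (hw.isPositive _)).flat_injective
  refine ⟨fun e he => ?_, fun x u => ofSymplectic_sq (hw.isPositive x).flat_injective u,
    fun x u v => pairing_ofSymplectic (hw.isPositive x).flat_injective u v, fun e he => ?_⟩
  · exact (contDiffOn_ofSymplectic (hw.closed e he).1 (hnd e he)).congr fun y hy =>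
      endIn_ofSymplectic hw he hy
  · exact (involutive_ofSymplectic e.open_target (hw.closed e he).1 (hw.closed e he).2
      (hnd e he)).congr fun y hy => endIn_ofSymplectic hw he hy

theorem IsHamiltonianTorusAction.smooth_torusDeform (h : IsHamiltonianTorusAction m w μ)
    (hw : IsKahler w) (he : e ∈ atlas E M) (i j : Fin m) :
    ContDiffOn ℝ ∞ (fun p : ℝ × E => endIn (torusDeform w i j p.1) e p.2) (univ ×ˢ e.target) := by
  have hL := h.localData hw he i j
  have hs : ∀ {F : Type _} [NormedAddCommGroup F] [NormedSpace ℝ F] {f : E → F},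
      ContDiffOn ℝ ∞ f e.target →
        ContDiffOn ℝ ∞ (fun p : ℝ × E => f p.2) ((univ : Set ℝ) ×ˢ e.target) := fun hf =>
    hf.comp contDiff_snd.contDiffOn fun p hp => hp.2
  refine (contDiffOn_deform (t := fun p : ℝ × E => p.1) contDiff_fst.contDiffOn (hs hL.smooth_V)
    (hs hL.smooth_W) ?_ ?_).congr fun p hp => endIn_torusDeform w he i j p.1 hp.2
  · exact hL.smooth_flat_V.comp contDiff_snd.contDiffOn fun p hp => hp.2
  · exact hL.symm.smooth_flat_V.comp contDiff_snd.contDiffOn fun p hp => hp.2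

theorem IsHamiltonianTorusAction.isGenComplex_torusDeform (h : IsHamiltonianTorusAction m w μ)
    (hw : IsKahler w) (i j : Fin m) (t : ℝ) : IsGenComplex (torusDeform w i j t) := by
  refine ⟨fun e he => ?_, fun x u => (h.isIsotropicData i j x).deform_sq t u,
    fun x u v => (h.isIsotropicData i j x).pairing_deform t u v, fun e he => ?_⟩
  · have h1 : MapsTo (fun y : E => (t, y)) e.target ((univ : Set ℝ) ×ˢ e.target) :=
      fun y hy => ⟨mem_univ _, hy⟩
    have h2 := (h.smooth_torusDeform hw he i j).comp
      (contDiff_prodMk_right (𝕜 := ℝ) (n := ∞) t).contDiffOn h1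
    exact h2
  · have hL := h.localData hw he i j
    exact (involutive_deform hL.isOpen hL.smooth_V hL.smooth_W hL.smooth_flat_V
      hL.symm.smooth_flat_V hL.holomorphic_V hL.holomorphic_W (fun y hy => hL.commute hy)
      hL.hamiltonian_V hL.hamiltonian_W (fun y hy => hL.isIsotropicData hy) t).congr fun y hy =>
        endIn_torusDeform w he i j t hy

theorem IsHamiltonianTorusAction.isGenKahler_torusDeform (h : IsHamiltonianTorusAction m w μ)
    (hw : IsKahler w) (i j : Fin m) (t : ℝ) :
    IsGenKahler (torusDeform w i j t) (fun _ => 0) w := by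
  have : FiniteDimensional ℝ E := FiniteDimensional.complexToReal E
  have h0 : (fun x => ofSpinor ((fun _ => 0 : M → Form2 E) x) (w x)) = fun x => ofSymplectic (w x) :=
    funext fun x => ofSpinor_zero (w x)
  refine ⟨isSmoothClosed_zero, hw.closed, fun x v hv => ⟨_, (hw.pos x v hv).ne'⟩,
    h.isGenComplex_torusDeform hw i j t, ?_, fun x u => ?_, fun x u hu => ?_⟩
  · rw [h0]
    exact hw.isGenComplex_ofSymplectic
  · rw [ofSpinor_zero]
    exact (hw.isPositive x).deform_ofSymplectic t _ _ u
  · rw [ofSpinor_zero]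
    exact (hw.isPositive x).pairing_deform_ofSymplectic_pos (h.isIsotropicData i j x) t hu

/-- `formP` is twice `ricciForm`, which carries a factor 1/2, and the generalized Ricci form is
minus `formP`; hence the constant `-2 * c`. The trivialization exists on a whole chart. -/
theorem IsHamiltonianTorusAction.isGenRicci_torusDeform (h : IsHamiltonianTorusAction m w μ)
    (hw : IsKahler w) {c : ℝ} (hc : ∀ e ∈ atlas E M, ∀ y ∈ e.target, ∀ u v : E,
      ricciForm w e y u v = c * formIn w e y ![u, v]) (i j : Fin m) (t : ℝ) :
    IsGenRicci (torusDeform w i j t) (fun _ => 0) w (fun x => (-2 * c) • w x) := by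
  intro e he y₀ hy₀
  have hL := h.localData hw he i j
  have hK : ∀ y ∈ e.target, endIn (torusDeform w i j t) e y = _ := fun y hy =>
    endIn_torusDeform w he i j t hy
  refine ⟨e.target, e.open_target, hy₀, subset_rfl, ?_⟩
  rw [formIn_zero]
  refine ⟨_, _, _, hL.isTrivialization t hK, fun y hy u v => ?_⟩
  · rw [hL.formP_eq t hK hy]
    have h1 := hc e he y hy u v
    rw [ricciForm] at h1
    have h2 : formIn (fun x => (-2 * c) • w x) e y ![u, v] = (-2 * c) * formIn w e y ![u, v] := rfl
    have h3 : (fun z => (fderiv ℝ (logDet (formIn w e)) z).comp (cplx E)) =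
      fun z => (fderiv ℝ (fun z' => Real.log (detMetric w e z')) z).comp (cplx E) := rfl
    rw [h2, h3]
    linarith

end Family

/-! ### Rigidity of holomorphic vector fields. -/

section Identity

variable {E : Type*} [NormedAddCommGroup E] [NormedSpace ℂ E]

/-- A holomorphic map on a ball that vanishes near a point of it vanishes. -/
theorem eq_zero_of_holomorphic_of_eventuallyEq_zero {F : Type*} [NormedAddCommGroup F]
    [NormedSpace ℂ F] [CompleteSpace F] {f : E → F} {S : Set E} (hS : IsOpen S) (hc : Convex ℝ S)
    (hf : ContDiffOn ℝ ∞ f S)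
    (hI : ∀ y ∈ S, ∀ v, fderiv ℝ f y (Complex.I • v) = Complex.I • fderiv ℝ f y v) {z : E}
    (hz : z ∈ S) (h0 : ∀ᶠ y in nhds z, f y = 0) {y : E} (hy : y ∈ S) : f y = 0 := by
  -- Restriction to the complex line through `z` and `y` reduces to the identity theorem in one
  -- variable; convexity keeps the preimage of `S` connected.
  let L : ℂ → E := fun ζ => z + ζ • (y - z)
  have hLc : Continuous L := by fun_prop
  have hLd : ∀ ζ, HasFDerivAt L ((1 : ℂ →L[ℂ] ℂ).smulRight (y - z)) ζ := fun ζ =>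
    ((1 : ℂ →L[ℂ] ℂ).smulRight (y - z)).hasFDerivAt.const_add z
  have hT : IsOpen (L ⁻¹' S) := hS.preimage hLc
  have hTc : Convex ℝ (L ⁻¹' S) := by
    intro a ha b hb p q hp hq hpq
    have h1 := hc ha hb hp hq hpq
    have h2 : L (p • a + q • b) = p • L a + q • L b := by
      have h3 : p • z + q • z = z := by rw [← add_smul, hpq, one_smul]
      simp only [L]
      rw [add_smul, smul_assoc, smul_assoc, smul_add, smul_add]
      calc z + (p • a • (y - z) + q • b • (y - z))
          = p • z + q • z + (p • a • (y - z) + q • b • (y - z)) := by rw [h3]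
        _ = _ := by abel
    change L (p • a + q • b) ∈ S
    rwa [h2]
  have hdiff : DifferentiableOn ℂ (f ∘ L) (L ⁻¹' S) := by
    intro ζ hζ
    have h1 := (hf.hasFDerivAt_of_isOpen hS hζ).comp ζ ((hLd ζ).restrictScalars ℝ)
    refine (hasFDerivAt_of_restrictScalars ℝ
      (f' := (1 : ℂ →L[ℂ] ℂ).smulRight (fderiv ℝ f (L ζ) (y - z))) h1
        ?_).differentiableAt.differentiableWithinAt
    refine ContinuousLinearMap.ext fun a => ?_
    exact (map_complex_smul (hI _ hζ) a (y - z)).symm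
  have hL0 : L 0 = z := by simp [L]
  have hL1 : L 1 = y := by simp [L]
  have h2 : (f ∘ L) =ᶠ[nhds 0] 0 := by
    have h3 : Filter.Tendsto L (nhds 0) (nhds z) := hL0 ▸ hLc.tendsto 0
    exact h3.eventually h0
  have h4 := (hdiff.analyticOnNhd hT).eqOn_zero_of_preconnected_of_eventuallyEq_zero
    hTc.isPreconnected (z₀ := 0) (by rw [mem_preimage, hL0]; exact hz) h2
    (x := 1) (by rw [mem_preimage, hL1]; exact hy)
  rw [Function.comp_apply, hL1] at h4
  exact h4

/-- Two holomorphic vector fields that are real multiples of each other have locally constant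
ratio. -/
theorem exists_eventually_eq_smul {V W : E → E} {U : Set E} (hU : IsOpen U)
    (hV : ContDiffOn ℝ ∞ V U) (hW : ContDiffOn ℝ ∞ W U)
    (hVI : ∀ y ∈ U, ∀ x, fderiv ℝ V y (Complex.I • x) = Complex.I • fderiv ℝ V y x)
    (hWI : ∀ y ∈ U, ∀ x, fderiv ℝ W y (Complex.I • x) = Complex.I • fderiv ℝ W y x)
    (hr : ∀ y ∈ U, V y ≠ 0 → ∃ r : ℝ, W y = r • V y) {z : E} (hz : z ∈ U) (hVz : V z ≠ 0) :
    ∃ c : ℝ, ∀ᶠ y in nhds z, W y = c • V y := by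
  -- A real functional that does not vanish on `V z` writes the ratio as the smooth function l(W) /
  -- l(V) near `z`.
  obtain ⟨l, hl⟩ := SeparatingDual.exists_ne_zero (R := ℝ) hVz
  have hS : IsOpen (U ∩ (fun y => l (V y)) ⁻¹' {0}ᶜ) :=
    (l.continuous.comp_continuousOn hV.continuousOn).isOpen_inter_preimage hU
      isOpen_compl_singleton
  set S := U ∩ (fun y => l (V y)) ⁻¹' {0}ᶜ with hSdef
  let h : E → ℝ := fun y => l (W y) / l (V y)
  have hWh : ∀ y ∈ S, W y = h y • V y := by
    intro y hy
    have hne : l (V y) ≠ 0 := hy.2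
    obtain ⟨r, hr⟩ := hr y hy.1 fun h0 => hne (by rw [h0, map_zero])
    simp only [h]
    rw [hr, map_smul, smul_eq_mul, mul_div_cancel_right₀ _ hne]
  have hh : ContDiffOn ℝ ∞ h S :=
    (l.contDiff.comp_contDiffOn (hW.mono inter_subset_left)).div
      (l.contDiff.comp_contDiffOn (hV.mono inter_subset_left)) fun y hy => hy.2
  have hd : ∀ y ∈ S, fderiv ℝ h y = 0 := by
    intro y hy
    have hne : V y ≠ 0 := fun h0 => hy.2 (by
      change l (V y) = 0
      rw [h0, map_zero])
    have h1 := (hh.hasFDerivAt_of_isOpen hS hy).smul (hV.hasFDerivAt_of_isOpen hU hy.1)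
    have h2 : HasFDerivAt W _ y := h1.congr_of_eventuallyEq (by
      filter_upwards [hS.mem_nhds hy] with x hx using hWh x hx)
    have h3 : ∀ x, fderiv ℝ W y x = h y • fderiv ℝ V y x + fderiv ℝ h y x • V y := by
      intro x
      rw [h2.fderiv]
      rfl
    ext x
    have h4 := hWI y hy.1 x
    rw [h3, h3, hVI y hy.1, smul_add, smul_comm Complex.I (h y)] at h4
    have h5 := add_left_cancel h4
    -- Complex linearity of both derivatives leaves dh(ix) V = i dh(x) V. As dh is real and V ≠ 0,
    -- the imaginary part gives dh(x) = 0.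
    have h6 : ((fderiv ℝ h y (Complex.I • x) : ℂ) - Complex.I * (fderiv ℝ h y x : ℂ)) • V y = 0 := by
      rw [sub_smul, mul_smul, Complex.coe_smul, Complex.coe_smul, h5, sub_self]
    have h7 := congrArg Complex.im ((smul_eq_zero.1 h6).resolve_right hne)
    simpa using h7
  have hzS : z ∈ S := ⟨hz, hl⟩
  obtain ⟨ε, hε, hb⟩ := Metric.isOpen_iff.1 hS z hzS
  refine ⟨h z, ?_⟩
  filter_upwards [Metric.ball_mem_nhds z hε] with y hy
  have h1 := (convex_ball z ε).is_const_of_fderivWithin_eq_zero (𝕜 := ℝ)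
    (fun x hx => ((hh.hasFDerivAt_of_isOpen hS (hb hx)).differentiableAt).differentiableWithinAt)
    (fun x hx => by
      rw [fderivWithin_of_isOpen Metric.isOpen_ball hx, hd x (hb hx)]) hy (Metric.mem_ball_self hε)
  rw [hWh y (hb hy), h1]

end Identity

/-! ### The family is not ordinary for nonzero parameter. -/

section Nontrivial

/-- B-field transforms fix covectors and `ofComplex` maps covectors to covectors, whatever the
regularity of the 2-form. -/
theorem IsOrdinary.apply_fst {E : Type*} [NormedAddCommGroup E] [NormedSpace ℂ E] {M : Type*}
    {K : M → (GT E →L[ℝ] GT E)} (h : IsOrdinary K) (x : M)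
    (ξ : E →L[ℝ] ℝ) : (K x (0, ξ)).1 = 0 := by
  obtain ⟨j, B, -, hK⟩ := h
  rw [hK]
  simp [ContinuousLinearMap.comp_apply, bField_apply, ofComplex_apply]

variable {E : Type*} [NormedAddCommGroup E] [NormedSpace ℂ E]
  {M : Type*} [TopologicalSpace M] [ChartedSpace E M]
  {e : OpenPartialHomeomorph M E} {m : ℕ} [MulAction (Fin m → Circle) M]
  {w : M → Form2 E} {μ : M → (Fin m → ℝ)}

variable [IsManifold 𝓘(ℂ, E) ω M]

/-- A curve in `M` with vanishing derivative is constant. -/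
theorem eq_of_hasMFDerivAt_zero {c : ℝ → M}
    (hc : ∀ s, HasMFDerivAt 𝓘(ℝ, ℝ) 𝓘(ℝ, E) c s (0 : ℝ →L[ℝ] E)) (s t : ℝ) : c s = c t := by
  refine IsLocallyConstant.apply_eq_of_preconnectedSpace
    ((IsLocallyConstant.iff_eventually_eq c).2 fun s => ?_) s t
  have hcc : Continuous c := continuous_iff_continuousAt.2 fun s => (hc s).continuousAt
  have he := chart_mem_atlas E (c s)
  have hs := mem_chart_source E (c s)
  generalize chartAt E (c s) = e at he hs
  obtain ⟨ε, hε, hb⟩ := Metric.isOpen_iff.1 (e.open_source.preimage hcc) s hs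
  have hd : ∀ r ∈ Metric.ball s ε, HasFDerivAt (e ∘ c) (0 : ℝ →L[ℝ] E) r := by
    intro r hr
    have h1 := (HasMFDerivAt.comp r (hasMFDerivAt_chart he (hb hr)) (hc r)).hasFDerivAt
    have h2 : (toChart (E := E) e (e (c r))).comp (0 : ℝ →L[ℝ] E) = 0 :=
      ContinuousLinearMap.comp_zero _
    exact h2 ▸ h1
  filter_upwards [Metric.ball_mem_nhds s hε] with r hr
  have h1 := (convex_ball s ε).is_const_of_fderivWithin_eq_zero (𝕜 := ℝ) (f := e ∘ c)
    (fun x hx => (hd x hx).differentiableAt.differentiableWithinAt)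
    (fun x hx => by
      rw [fderivWithin_of_isOpen Metric.isOpen_ball hx, (hd x hx).fderiv])
    hr (Metric.mem_ball_self hε)
  exact e.injOn (hb hr) hs h1

/-- If an element of the Lie algebra generates the zero vector field, it is zero. -/
theorem IsHamiltonianTorusAction.eq_zero_of_orbitDeriv (h : IsHamiltonianTorusAction m w μ)
    {a : Fin m → ℝ} (ha : ∀ x : M, orbitDeriv (E := E) m x a = 0) : a = 0 := by
  have h1 : ∀ (s : ℝ) (x : M), torusExp (s • a) • x = x := by
    intro s x
    have h2 : ∀ s, HasMFDerivAt 𝓘(ℝ, ℝ) 𝓘(ℝ, E) (fun s : ℝ => torusExp (s • a) • x) s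
        (0 : ℝ →L[ℝ] E) := by
      intro s
      -- By the group law the velocity at time `s` is the velocity at time zero of the orbit through
      -- the moved point.
      have h3 := h.hasMFDerivAt_curve a (torusExp (s • a) • x)
      have h4 : (orbitDeriv (E := E) m (torusExp (s • a) • x)).comp
          ((1 : ℝ →L[ℝ] ℝ).smulRight a) = 0 := by
        refine ContinuousLinearMap.ext fun r => ?_
        simp [ha]
      rw [← sub_self s] at h3
      have h5 : HasMFDerivAt 𝓘(ℝ, ℝ) 𝓘(ℝ, ℝ) (fun r : ℝ => r - s) s (1 : ℝ →L[ℝ] ℝ) :=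
        ((hasFDerivAt_id s).sub_const s).hasMFDerivAt
      have h6 := HasMFDerivAt.comp (f := fun r : ℝ => r - s) s h3 h5
      have h7 : ((fun r : ℝ => torusExp (r • a) • torusExp (s • a) • x) ∘ fun r : ℝ => r - s) =
          fun r : ℝ => torusExp (r • a) • x := by
        funext r
        rw [Function.comp_apply, smul_smul, ← torusExp_add, ← add_smul, sub_add_cancel]
      rw [h7] at h6
      have h8 : ((orbitDeriv (E := E) m (torusExp (s • a) • x)).comp
          ((1 : ℝ →L[ℝ] ℝ).smulRight a)).comp (1 : ℝ →L[ℝ] ℝ) = 0 := by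
        rw [h4, ContinuousLinearMap.zero_comp]
      exact (congrArg _ h8).mp h6
    have h3 := eq_of_hasMFDerivAt_zero h2 s 0
    simpa [torusExp_zero] using h3
  by_contra hne
  obtain ⟨k, hk⟩ := Function.ne_iff.1 hne
  rw [Pi.zero_apply] at hk
  -- At time π / a_k the k-th coordinate of the group element is e^{iπ}, which is not 1.
  have h2 := congrFun (h.effective (torusExp ((Real.pi / a k) • a)) (h1 _)) k
  rw [torusExp, Pi.smul_apply, smul_eq_mul, div_mul_cancel₀ _ hk, Pi.one_apply,
    Circle.exp_eq_one] at h2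
  obtain ⟨n, hn⟩ := h2
  have h3 : (1 : ℝ) = 2 * n := by
    have := Real.pi_pos
    have h4 : Real.pi * (1 - 2 * n) = 0 := by linarith
    have h5 := (mul_eq_zero.1 h4).resolve_left Real.pi_ne_zero
    linarith
  have h4 : (1 : ℤ) = 2 * n := by exact_mod_cast h3
  omega

/-- The set of points near which the relation holds is open by definition, and closed because a
holomorphic field on a ball in a chart vanishes once it does so near one point. -/
theorem IsHamiltonianTorusAction.generator_eq_smul_of_eventually [FiniteDimensional ℂ E]
    [ConnectedSpace M] (h : IsHamiltonianTorusAction m w μ) (i j : Fin m) {c : ℝ} {x₀ : M}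
    (h0 : ∀ᶠ x in nhds x₀, generator (E := E) j x = c • generator (E := E) i x) (x : M) :
    generator (E := E) j x = c • generator (E := E) i x := by
  have : CompleteSpace E := FiniteDimensional.complete ℂ E
  let S : Set M := {x₀ | ∀ᶠ x in nhds x₀, generator (E := E) j x = c • generator (E := E) i x}
  have hS : IsClopen S := by
    refine ⟨isClosed_of_closure_subset fun x hx => ?_, isOpen_iff_mem_nhds.2 fun x hx =>
      eventually_eventually_nhds.2 hx⟩
    have he := chart_mem_atlas E x
    have hxs := mem_chart_source E x
    generalize chartAt E x = e at he hxs
    obtain ⟨ε, hε, hb⟩ := Metric.isOpen_iff.1 e.open_target _ (e.map_source hxs)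
    have hN : e.source ∩ e ⁻¹' Metric.ball (e x) ε ∈ nhds x :=
      (e.continuousOn.isOpen_inter_preimage e.open_source Metric.isOpen_ball).mem_nhds
        ⟨hxs, Metric.mem_ball_self hε⟩
    obtain ⟨z, hzN, hzS⟩ := mem_closure_iff_nhds.1 hx _ hN
    have hf : ContDiffOn ℝ ∞ (fun y => generatorIn e j y - c • generatorIn e i y) e.target :=
      (h.smooth_generatorIn he j).sub ((h.smooth_generatorIn he i).const_smul c)
    have hfI : ∀ y ∈ e.target, ∀ v,
        fderiv ℝ (fun y => generatorIn e j y - c • generatorIn e i y) y (Complex.I • v) =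
          Complex.I • fderiv ℝ (fun y => generatorIn e j y - c • generatorIn e i y) y v := by
      intro y hy v
      have h1 := ((h.smooth_generatorIn he j).hasFDerivAt_of_isOpen e.open_target hy).sub
        (((h.smooth_generatorIn he i).hasFDerivAt_of_isOpen e.open_target hy).const_smul c)
      have h2 : fderiv ℝ (fun y => generatorIn e j y - c • generatorIn e i y) y = _ := h1.fderiv
      rw [h2, sub_apply, sub_apply, smul_apply, smul_apply, h.holomorphic_generatorIn he j hy,
        h.holomorphic_generatorIn he i hy, smul_sub, smul_comm c Complex.I]
    have hz0 : ∀ᶠ y in nhds (e z), generatorIn e j y - c • generatorIn e i y = 0 := by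
      have h1 : Filter.Tendsto e.symm (nhds (e z)) (nhds z) := by
        have := e.continuousAt_symm (e.map_source hzN.1)
        rw [ContinuousAt, e.left_inv hzN.1] at this
        exact this
      filter_upwards [h1.eventually hzS] with y hy
      rw [generatorIn, generatorIn, hy, map_smul, sub_self]
    have h1 : ∀ y ∈ Metric.ball (e x) ε, generatorIn e j y - c • generatorIn e i y = 0 :=
      fun y hy => eq_zero_of_holomorphic_of_eventuallyEq_zero Metric.isOpen_ball
        (convex_ball (e x) ε) (hf.mono hb) (fun y hy => hfI y (hb hy)) hzN.2 hz0 hy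
    change ∀ᶠ x in nhds x, _
    filter_upwards [hN] with x' hx'
    have hy := e.map_source hx'.1
    have h2 := congrArg (fromChart e (e x')) (h1 (e x') hx'.2)
    rw [generatorIn, generatorIn, map_sub, map_smul, fromChart_toChart he hy,
      fromChart_toChart he hy, e.left_inv hx'.1, map_zero] at h2
    exact sub_eq_zero.1 h2
  have h1 : S = univ := hS.eq_univ ⟨x₀, h0⟩
  have h2 : x ∈ S := h1 ▸ mem_univ x
  exact h2.self_of_nhds

/-- If the structure were ordinary, one generator would be a real multiple of the other wherever the
latter is nonzero, then a constant multiple locally, then globally; the corresponding combination of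
basis vectors of the Lie algebra would act trivially. -/
theorem IsHamiltonianTorusAction.not_isOrdinary_torusDeform [FiniteDimensional ℂ E]
    [ConnectedSpace M] (h : IsHamiltonianTorusAction m w μ) (hw : IsKahler w) {i j : Fin m}
    (hij : i ≠ j) {t : ℝ} (ht : t ≠ 0) : ¬ IsOrdinary (torusDeform w i j t) := by
  intro hord
  have hdep : ∀ x : M, flat (w x) (generator i x) (Complex.I • generator i x) • generator j x =
      flat (w x) (generator i x) (Complex.I • generator j x) • generator (E := E) i x := fun x =>
    smul_eq_smul_of_deform (h.isotropic j i x) ht (hord.apply_fst x)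
  have hr : ∀ x : M, generator (E := E) i x ≠ 0 →
      ∃ r : ℝ, generator (E := E) j x = r • generator (E := E) i x := by
    intro x hx
    have hpos := hw.pos x _ hx
    rw [← flat_apply] at hpos
    refine ⟨(flat (w x) (generator i x) (Complex.I • generator i x))⁻¹ *
      flat (w x) (generator i x) (Complex.I • generator j x), ?_⟩
    rw [mul_smul, ← hdep, smul_smul, inv_mul_cancel₀ hpos.ne', one_smul]
  by_cases hV : ∀ x : M, generator (E := E) i x = 0
  · have h1 := h.eq_zero_of_orbitDeriv (a := Pi.single i 1) fun x => by
      rw [← h.generator_eq, hV]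
    have h2 := congrFun h1 i
    simp at h2
  · push Not at hV
    obtain ⟨x₀, hx₀⟩ := hV
    have he := chart_mem_atlas E x₀
    have hxs := mem_chart_source E x₀
    generalize chartAt E x₀ = e at he hxs
    have hy₀ := e.map_source hxs
    obtain ⟨c, hc⟩ := exists_eventually_eq_smul e.open_target (h.smooth_generatorIn he i)
      (h.smooth_generatorIn he j) (fun y hy => h.holomorphic_generatorIn he i hy)
      (fun y hy => h.holomorphic_generatorIn he j hy) (fun y hy hne => by
        obtain ⟨r, hr⟩ := hr (e.symm y) fun h0 => hne (by rw [generatorIn, h0, map_zero])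
        exact ⟨r, by rw [generatorIn, generatorIn, hr, map_smul]⟩) hy₀ (by
        intro h0
        have h1 := congrArg (fromChart e (e x₀)) h0
        rw [generatorIn, fromChart_toChart he hy₀, e.left_inv hxs, map_zero] at h1
        exact hx₀ h1)
    have hev : ∀ᶠ x in nhds x₀, generator (E := E) j x = c • generator (E := E) i x := by
      filter_upwards [(e.continuousAt hxs).eventually hc, e.open_source.mem_nhds hxs] with x hx hxs
      have h2 := congrArg (fromChart e (e x)) hx
      rw [generatorIn, generatorIn, map_smul, fromChart_toChart he (e.map_source hxs),
        fromChart_toChart he (e.map_source hxs), e.left_inv hxs] at h2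
      exact h2
    have hall := h.generator_eq_smul_of_eventually i j hev
    -- As `i ≠ j`, the j-th entry of this vector is `1`, so it cannot be zero.
    have h1 := h.eq_zero_of_orbitDeriv (a := Pi.single j 1 - c • Pi.single i 1) fun x => by
      rw [map_sub, map_smul, ← h.generator_eq, ← h.generator_eq, hall, sub_self]
    have h2 := congrFun h1 j
    simp [hij.symm] at h2

end Nontrivial

end GKE

end

theorem mainTheorem7 {E : Type*} [NormedAddCommGroup E] [NormedSpace ℂ E] [FiniteDimensional ℂ E]
    {M : Type*} [TopologicalSpace M] [T2Space M] [SecondCountableTopology M] [ConnectedSpace M]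
    [ChartedSpace E M] [IsManifold 𝓘(ℂ, E) ω M]
    (m : ℕ) (hm : 2 ≤ m) [MulAction (Fin m → Circle) M]
    (w : M → GKE.Form2 E) (μ : M → (Fin m → ℝ))
    (hw : GKE.IsToricKahlerEinstein m w μ) :
    ∃ (K : ℝ → M → (GKE.GT E →L[ℝ] GKE.GT E)) (b w' : ℝ → M → GKE.Form2 E) (l : ℝ),
      GKE.IsSmoothFamily K b w' ∧
      (∀ x, K 0 x = GKE.ofComplex (GKE.cplx E)) ∧ (∀ x, b 0 x = 0) ∧ (∀ x, w' 0 x = w x) ∧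
      (∀ t, GKE.IsGenKahlerEinstein (K t) (b t) (w' t) l) ∧
      (∀ t, t ≠ 0 → ¬ GKE.IsOrdinary (K t)) := by
  obtain ⟨-, ⟨hK, c, hc⟩, h⟩ := hw
  have hij : (⟨0, by omega⟩ : Fin m) ≠ ⟨1, by omega⟩ := by simp
  -- Any two distinct circle factors would serve; their existence is where `2 ≤ m` enters. The
  -- spinor e^{iω} stays constant along the family.
  exact ⟨GKE.torusDeform w ⟨0, by omega⟩ ⟨1, by omega⟩, fun _ _ => 0, fun _ => w, -2 * c,
    ⟨fun e he => h.smooth_torusDeform hK he _ _, fun e _ => by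
      simp only [GKE.formIn_zero]
      exact contDiffOn_const,
      fun e he => (hK.closed e he).1.comp contDiffOn_snd fun p hp => hp.2⟩,
    fun x => GKE.deform_zero _ _ _ _, fun _ => rfl, fun _ => rfl,
    fun t => ⟨h.isGenKahler_torusDeform hK _ _ t, h.isGenRicci_torusDeform hK hc _ _ t⟩,
    fun t ht => h.not_isOrdinary_torusDeform hK hij ht⟩
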